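/- **Setting.** Let $N\ge 1$, $S\ge 1$, let $a=t_0<t_1<\dots<t_S=b$ be arbitrary knots, and let $1\le S_M\le S$. The subinterval number $s$ is $[t_{s-1},t_s]$, with length $L_s=t_s-t_{s-1}$. Let $S_{D,c}$ be the space of functions on $[a,b]$ that are polynomials of degree at most $D$ on each subinterval and whose derivatives of orders $0,\dots,c$ are continuous at the inner knots. A quadrature rule is a finite set of pairs (node, weight) with distinct nodes in $[a,b]$ and real weights; it is exact on a space if $\int_a^b f=\sum_i w_i f(x_i)$ for all $f$ in the space, and optimal if no exact rule has fewer nodes. $P_n^{(p,q)}$ are the Jacobi polynomials and $'$ is $d/dx$. **Formulae for $c=0$.** Put $F(n)=1+\alpha n(n+1)$ and, with $P=P_n^{(1,0)}$, $$Q_n(\alpha,x)=(F(n)+\alpha n)P+\alpha(1-x)P',\qquad w=\frac{2(2n+1)F(n)^2}{n(n+1)\,Q_n'(x)\,Q_{n-1}(x)\,(1-x)},\tag{Q0}$$ $$\Gamma=(n+1)(1+n(n+2)\alpha),\qquad \alpha_{new}=\frac1\lambda\cdot\frac{1+(n+1)^2\alpha}{(n+1)\Gamma}.$$ With $P=P_n^{(0,0)}$,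 $H(n)=1+n^2(\alpha_L+\alpha_R+(n^2-1)\alpha_L\alpha_R)$, $H_1(n)=\alpha_L+\alpha_R+2n(n+1)\alpha_L\alpha_R$, $H_2(n,\alpha)=1+\alpha n(n+1)$: $$M_n=(H(n)+nH_1(n))P+\big(\alpha_LH_2(n,\alpha_R)(1-x)-\alpha_RH_2(n,\alpha_L)(1+x)\big)P',$$ $$M_{\omega,n}=M_n+\omega M_{n-1},\qquad w=\frac{2H(n)^2}{n\,M_{\omega,n}'(x)\,M_{n-1}(x)}.\tag{M0}$$ **Formulae for $c=1$.** Put $F(n)=1+n(n+2)\big(\alpha+6(n^2+2n-1)\beta-3(n-1)n(n+1)^2(n+2)(n+3)\beta^2\big)$, $F_1(n)=\alpha+12\beta\big(n^2+3n+1-n(n+1)^2(n+2)^2(n+3)\beta\big)$, $F_2(n)=\beta(1-3n(n+1)(n+2)(n+3)\beta)$ and, with $P=P_n^{(2,0)}$, $$Q_n(\alpha,\beta,x)=(F+nF_1)P+F_1(1-x)P'-36F_2P'+12F_2(1-x)P'',\qquad w=\frac{8(n+1)F(n)^2}{n(n+2)\,Q_n'(x)\,Q_{n-1}(x)\,(1-x)^2}.\tag{Q1}$$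 The recursion uses $\Gamma=\tfrac12(n+1)(n+2)\big(1+n(n+3)\alpha+6n(n+3)(n^2+3n-1)\beta-3n^2(n-1)(n+4)(n+2)(n+1)(n+3)^2\beta^2\big)$, $E=1+(n+1)(n+2)\big(\alpha+3n(n+3)\beta(2-(n-1)(n+1)(n+2)(n+4)\beta)\big)$, $G=1-3n(n+1)(n+2)(n+3)\beta$, $K=8n^2+24n+12+n(n+3)\big((11n^2+33n+16)\alpha+12(4n^4+24n^3+34n^2-6n-8)\beta+3n(n+1)(n+2)(n+3)(-4(n+1)(n+2)(2n^2+6n-5)\beta^2-3(n-1)n(n+1)(n+2)(n+3)(n+4)\alpha\beta^2+2(3n^2+9n-6)\alpha\beta+\alpha^2)\big)$: $$\alpha_{new}=\frac1\lambda\Big(-\alpha+\frac{EK}{12\Gamma^2}\Big),\qquad \beta_{new}=\frac1{\lambda^2}\Big(\beta+\frac{EG}{6(n+1)(n+2)\Gamma}\Big).$$ For the middle, with $P=P_n^{(0,0)}$, put $H_0(n,\alpha,\beta)=1+n(n-1)\big(\alpha+(n+1)(n-2)\beta(6-3\beta(n+2)n(n-1)(n-3))\big)$, $h_L=H_0(n+1,\alpha_L,\beta_L)$,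 $h_R=H_0(n+1,\alpha_R,\beta_R)$, $H(n)=\tfrac12H_0(n,\alpha_L,\beta_L)h_R+\tfrac12H_0(n,\alpha_R,\beta_R)h_L-36(n-1)n^2(n+1)(\beta_L-\beta_R)^2$, $H_1(n,\alpha,\beta)=\alpha+12n(n+1)\beta(1-(n-1)(n+2)(n^2+n+3)\beta)$, $H_2(n,\beta)=\beta(1-3(n-1)n(n+1)(n+2)\beta)$, $H_3(n,\alpha,\beta)=H_0(n+1,\alpha,\beta)+24n(n+1)H_2(n,\beta)$, $H_4(n,\alpha,\beta)=1+n(n+1)(2\alpha+3(n-1)n(n+1)(n+2)(13n^2+13n-18)\beta^2)$ and $$\begin{aligned}M_n={}&\tfrac12\big(H_3(n,\alpha_L,\beta_L)h_R+H_3(n,\alpha_R,\beta_R)h_L\big)P+\big(H_1(n,\alpha_L,\beta_L)h_R(1-x)-H_1(n,\alpha_R,\beta_R)h_L(1+x)\big)P'\\&+12\big(H_2(n,\beta_L)h_R(1-x)+H_2(n,\beta_R)h_L(1+x)\big)P''-36(\beta_L-\beta_R)^2n(n+1)\big(n(n+1)P-2xP'+2P''\big)\\&+12\big(H_2(n,\beta_R)H_4(n,\alpha_L,\beta_L)-H_2(n,\beta_L)H_4(n,\alpha_R,\beta_R)\big)P'\\&+72n(n+1)(\beta_L-\beta_R)\big(\beta_L+\beta_R-6(n-1)n(n+1)(n+2)\beta_L\beta_R\big)xP'',\end{aligned}$$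 $$w=\frac{2H(n)^2}{n\,M_n'(x)\,M_{n-1}(x)}.\tag{M1}$$ **Algorithm.** Start at subinterval $1$ with all parameters ($\alpha$, or $\alpha,\beta$) equal to $0$, and pass from subinterval $s$ to $s+1$, for $1\le s<S_M$, by the recursion with $n=N$ and $\lambda=L_{s+1}/L_s$; the values reached at subinterval $S_M$ are $\alpha_L$ (and $\beta_L$). Do the same from subinterval $S$ leftwards to $S_M$, with $\lambda=L_{s-1}/L_s$ in the step from $s$ to $s-1$; this gives $\alpha_R$ (and $\beta_R$). On each subinterval $s\ne S_M$ take the roots $x$ of $Q_N$ with the weights (Q0) or (Q1) for $n=N$; on subintervals to the right of $S_M$ replace $(x,w)$ by $(-x,w)$. On subinterval $S_M$ take the roots of $M_{\omega,N+1}$ ($c=0$, $\omega\in\mathbb R$ free) or of $M_{N+1}$ ($c=1$) with the weights (M0) or (M1) for $n=N+1$. Scale all pairs from $[-1,1]$ to their subintervals, by $x\mapsto t_{s-1}+L_s(1+x)/2$ and $w\mapsto wL_s/2$. **Claim for $c=0$ (a one-parameter family of optimal rules).** On every subinterval $s\neq S_M$, $\Gamma\ne0$, $Q_N$ has $N$ distinct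 real roots, all in $(-1,1)$, and the denominators in (Q0) do not vanish. For every $\omega\in\mathbb R$, $M_{\omega,N+1}$ has $N+1$ distinct real roots, at which the denominators in (M0) do not vanish; there is $\delta>0$ such that these roots lie in $(-1,1)$ whenever $|\omega|<\delta$. For every $\omega$ for which the roots of $M_{\omega,N+1}$ lie in $[-1,1]$, the algorithm gives a quadrature rule with $NS+1$ nodes that is exact on $S_{2N,0}$ and optimal. Different such $\omega$ give different rules. **Claim for $c=1$ (Gaussian rules).** Suppose that the algorithm can be carried out with its roots where they have to lie: on each subinterval $s\ne S_M$, $\Gamma\neq0$ and $Q_N$ has $N$ distinct real roots in $[-1,1]$, and $M_{N+1}$ has $N+1$ distinct real roots in $[-1,1]$. Then none of the denominators in (Q1) and (M1) vanishes at these roots, and the algorithm gives a quadrature rule with $NS+1$ nodes that is exact on $S_{2N+1,1}$ and optimal. -/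

import Mathlib

open Polynomial

namespace SplineQuad

/-! ### Spline spaces and quadrature rules -/

/-- The spline space `S_{D,c}` on the interval `[t 0, t S]` split by the knots
`t 0 < t 1 < ⋯ < t S`: on each of the `S` subintervals `f` is a polynomial of degree at most `D`,
and at each inner knot the derivatives of orders `0, …, c` of the two adjacent pieces agree. -/
def splineSpace (D c S : ℕ) (t : ℕ → ℝ) : Set (ℝ → ℝ) :=
  {f | ∃ p : ℕ → ℝ[X],
    (∀ s < S, (p s).natDegree ≤ D ∧ ∀ x ∈ Set.Icc (t s) (t (s + 1)), f x = (p s).eval x) ∧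
    ∀ s, s + 1 < S → ∀ k ≤ c,
      (derivative^[k] (p s)).eval (t (s + 1)) = (derivative^[k] (p (s + 1))).eval (t (s + 1))}

/-- A finite set of pairs (node, weight) is a quadrature rule on `[a, b]` exact on `V`: the nodes
lie in `[a, b]`, each node carries one weight, and the weighted sum is the integral on `V`. -/
def IsExactRule (V : Set (ℝ → ℝ)) (a b : ℝ) (R : Finset (ℝ × ℝ)) : Prop :=
  (∀ p ∈ R, p.1 ∈ Set.Icc a b) ∧ Set.InjOn Prod.fst (R : Set (ℝ × ℝ)) ∧
    ∀ f ∈ V, ∫ x in a..b, f x = ∑ p ∈ R, p.2 * f p.1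

/-- An exact rule is optimal if no exact rule has fewer nodes. -/
def IsOptimalRule (V : Set (ℝ → ℝ)) (a b : ℝ) (R : Finset (ℝ × ℝ)) : Prop :=
  IsExactRule V a b R ∧ ∀ R' : Finset (ℝ × ℝ), IsExactRule V a b R' → R.card ≤ R'.card

/-- `P` has exactly `k` distinct real roots, and all of them lie in `I`. -/
def HasDistinctRootsIn (P : ℝ[X]) (k : ℕ) (I : Set ℝ) : Prop :=
  P.roots.toFinset.card = k ∧ ∀ x ∈ P.roots, x ∈ I

/-! ### Jacobi polynomials -/

/-- The Jacobi polynomial `P_n^{(a,b)}` (for natural `a`, `b`):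
`∑ s, C(n+a, n-s) C(n+b, s) ((x-1)/2)^s ((x+1)/2)^(n-s)`.
The Legendre polynomial is `P_n^{(0,0)}`. -/
noncomputable def jacobi (a b n : ℕ) : ℝ[X] :=
  ∑ s ∈ Finset.range (n + 1),
    C (((n + a).choose (n - s) : ℝ) * ((n + b).choose s : ℝ)) *
      (C (1 / 2) * (X - 1)) ^ s * (C (1 / 2) * (X + 1)) ^ (n - s)

/-! ### Continuity class 0 -/

namespace C0

def F (n α : ℝ) : ℝ := 1 + α * n * (n + 1)

/-- The polynomials `Q_n(α, x)` for the subintervals beside the middle one. -/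
noncomputable def Q (n : ℕ) (α : ℝ) : ℝ[X] :=
  C (F n α + α * n) * jacobi 1 0 n + C α * (1 - X) * derivative (jacobi 1 0 n)

/-- Denominator of the weight at a root `x` of `Q_n(α, ·)`. -/
noncomputable def weightQDen (n : ℕ) (α x : ℝ) : ℝ :=
  n * (n + 1) * (derivative (Q n α)).eval x * (Q (n - 1) α).eval x * (1 - x)

noncomputable def weightQ (n : ℕ) (α x : ℝ) : ℝ :=
  2 * (2 * n + 1) * F n α ^ 2 / weightQDen n α x

def Γ (n α : ℝ) : ℝ := (n + 1) * (1 + n * (n + 2) * α)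

/-- The recursion map for `α`, with stretching factor `r`. -/
noncomputable def step (n r α : ℝ) : ℝ :=
  (1 + (n + 1) ^ 2 * α) / ((n + 1) * Γ n α) / r

/-- The parameter `α` of the subinterval with index `s`, when the subintervals are visited in
order and have lengths `ℓ 0, ℓ 1, …`. -/
noncomputable def param (n : ℝ) (ℓ : ℕ → ℝ) : ℕ → ℝ
  | 0 => 0
  | s + 1 => step n (ℓ (s + 1) / ℓ s) (param n ℓ s)

def H (n αL αR : ℝ) : ℝ := 1 + n ^ 2 * (αL + αR + (n - 1) * (n + 1) * αL * αR)

def H₁ (n αL αR : ℝ) : ℝ := αL + αR + 2 * n * (n + 1) * αL * αR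

def H₂ (n α : ℝ) : ℝ := 1 + α * n * (n + 1)

/-- The polynomials `M_n(αL, αR, x)` for the middle subinterval. -/
noncomputable def M (n : ℕ) (αL αR : ℝ) : ℝ[X] :=
  C (H n αL αR + n * H₁ n αL αR) * jacobi 0 0 n +
    (C (αL * H₂ n αR) * (1 - X) - C (αR * H₂ n αL) * (1 + X)) * derivative (jacobi 0 0 n)

/-- `M_{ω,n} = M_n + ω M_{n-1}` (used for `n ≥ 1`). -/
noncomputable def Mω (ω : ℝ) (n : ℕ) (αL αR : ℝ) : ℝ[X] :=
  M n αL αR + C ω * M (n - 1) αL αR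

/-- Denominator of the weight at a root `x` of `M_{ω,n}(αL, αR, ·)`. -/
noncomputable def weightMDen (ω : ℝ) (n : ℕ) (αL αR x : ℝ) : ℝ :=
  n * (derivative (Mω ω n αL αR)).eval x * (M (n - 1) αL αR).eval x

noncomputable def weightM (ω : ℝ) (n : ℕ) (αL αR x : ℝ) : ℝ :=
  2 * H n αL αR ^ 2 / weightMDen ω n αL αR x

end C0

/-! ### Continuity class 1 -/

namespace C1

def F (n α β : ℝ) : ℝ :=
  1 + n * (n + 2) * (α + 6 * (n ^ 2 + 2 * n - 1) * β
    - 3 * (n - 1) * n * (n + 1) ^ 2 * (n + 2) * (n + 3) * β ^ 2)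

def F₁ (n α β : ℝ) : ℝ :=
  α + 12 * β * (n ^ 2 + 3 * n + 1 - n * (n + 1) ^ 2 * (n + 2) ^ 2 * (n + 3) * β)

def F₂ (n β : ℝ) : ℝ := β * (1 - 3 * n * (n + 1) * (n + 2) * (n + 3) * β)

/-- The polynomials `Q_n(α, β, x)` for the subintervals beside the middle one. -/
noncomputable def Q (n : ℕ) (α β : ℝ) : ℝ[X] :=
  C (F n α β + n * F₁ n α β) * jacobi 2 0 n
    + C (F₁ n α β) * (1 - X) * derivative (jacobi 2 0 n)
    - C (36 * F₂ n β) * derivative (jacobi 2 0 n)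
    + C (12 * F₂ n β) * (1 - X) * derivative (derivative (jacobi 2 0 n))

/-- Denominator of the weight at a root `x` of `Q_n(α, β, ·)`. -/
noncomputable def weightQDen (n : ℕ) (α β x : ℝ) : ℝ :=
  n * (n + 2) * ((derivative (Q n α β)).eval x * (Q (n - 1) α β).eval x * (1 - x) ^ 2)

noncomputable def weightQ (n : ℕ) (α β x : ℝ) : ℝ :=
  8 * (n + 1) * F n α β ^ 2 / weightQDen n α β x

noncomputable def Γ (n α β : ℝ) : ℝ :=
  (1 + n * (n + 3) * α + 6 * n * (n + 3) * (n ^ 2 + 3 * n - 1) * β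
    - 3 * n ^ 2 * (n - 1) * (n + 4) * (n + 2) * (1 + n) * (n + 3) ^ 2 * β ^ 2)
    * (1 + n) * (n + 2) / 2

def E (n α β : ℝ) : ℝ :=
  1 + (n + 1) * (n + 2) *
    (α + 3 * n * (n + 3) * β * (2 - (n - 1) * (n + 1) * (n + 2) * (n + 4) * β))

def G (n β : ℝ) : ℝ := 1 - 3 * n * (n + 1) * (n + 2) * (n + 3) * β

noncomputable def stepα (n α β : ℝ) : ℝ :=
  -α + E n α β * (8 * n ^ 2 + 24 * n + 12 + n * (n + 3) * ((11 * n ^ 2 + 33 * n + 16) * α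
    + 12 * (4 * n ^ 4 + 24 * n ^ 3 + 34 * n ^ 2 - 6 * n - 8) * β
    + 3 * n * (n + 1) * (n + 2) * (n + 3) *
      (-4 * (n + 1) * (n + 2) * (2 * n ^ 2 + 6 * n - 5) * β ^ 2
        - 3 * (n - 1) * n * (n + 1) * (n + 2) * (n + 3) * (n + 4) * α * β ^ 2
        + 2 * (3 * n ^ 2 + 9 * n - 6) * α * β + α ^ 2)))
    / (12 * Γ n α β ^ 2)

noncomputable def stepβ (n α β : ℝ) : ℝ :=
  β + E n α β * G n β / (6 * (n + 1) * (n + 2) * Γ n α β)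

/-- The recursion map for `(α, β)`, with stretching factor `r`. -/
noncomputable def step (n r : ℝ) (q : ℝ × ℝ) : ℝ × ℝ :=
  (stepα n q.1 q.2 / r, stepβ n q.1 q.2 / r ^ 2)

/-- The parameters `(α, β)` of the subinterval with index `s`, when the subintervals are visited
in order and have lengths `ℓ 0, ℓ 1, …`. -/
noncomputable def param (n : ℝ) (ℓ : ℕ → ℝ) : ℕ → ℝ × ℝ
  | 0 => (0, 0)
  | s + 1 => step n (ℓ (s + 1) / ℓ s) (param n ℓ s)

def H₀ (n α β : ℝ) : ℝ :=
  1 + n * (n - 1) * (α + (n + 1) * (n - 2) * β * (6 - 3 * β * (n + 2) * n * (n - 1) * (n - 3)))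

noncomputable def H (n αL αR βL βR : ℝ) : ℝ :=
  1 / 2 * H₀ n αL βL * H₀ (n + 1) αR βR + 1 / 2 * H₀ n αR βR * H₀ (n + 1) αL βL
    - 36 * (n - 1) * n ^ 2 * (n + 1) * (βL - βR) ^ 2

def H₁ (n α β : ℝ) : ℝ :=
  α + 12 * n * (n + 1) * β * (1 - (n - 1) * (n + 2) * (n ^ 2 + n + 3) * β)

def H₂ (n β : ℝ) : ℝ := β * (1 - 3 * (n - 1) * n * (n + 1) * (n + 2) * β)

def H₃ (n α β : ℝ) : ℝ := H₀ (n + 1) α β + 24 * n * (n + 1) * H₂ n β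

def H₄ (n α β : ℝ) : ℝ :=
  1 + n * (n + 1) *
    (2 * α + 3 * (n - 1) * n * (n + 1) * (n + 2) * (13 * n ^ 2 + 13 * n - 18) * β ^ 2)

/-- The polynomials `M_n(αL, αR, βL, βR, x)` for the middle subinterval. -/
noncomputable def M (n : ℕ) (αL αR βL βR : ℝ) : ℝ[X] :=
  C (1 / 2 * (H₃ n αL βL * H₀ (n + 1) αR βR + H₃ n αR βR * H₀ (n + 1) αL βL)) * jacobi 0 0 n
    + (C (H₁ n αL βL * H₀ (n + 1) αR βR) * (1 - X)
        - C (H₁ n αR βR * H₀ (n + 1) αL βL) * (1 + X)) * derivative (jacobi 0 0 n)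
    + 12 * (C (H₂ n βL * H₀ (n + 1) αR βR) * (1 - X)
        + C (H₂ n βR * H₀ (n + 1) αL βL) * (1 + X)) * derivative (derivative (jacobi 0 0 n))
    - C (36 * (βL - βR) ^ 2 * n * (n + 1)) *
        (C ((n : ℝ) * (n + 1)) * jacobi 0 0 n - 2 * X * derivative (jacobi 0 0 n)
          + 2 * derivative (derivative (jacobi 0 0 n)))
    + C (12 * (H₂ n βR * H₄ n αL βL - H₂ n βL * H₄ n αR βR)) * derivative (jacobi 0 0 n)
    + C (72 * n * (n + 1) * (βL - βR) *
          (βL + βR - 6 * (n - 1) * n * (n + 1) * (n + 2) * βL * βR)) *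
        X * derivative (derivative (jacobi 0 0 n))

/-- Denominator of the weight at a root `x` of `M_n(αL, αR, βL, βR, ·)`. -/
noncomputable def weightMDen (n : ℕ) (αL αR βL βR x : ℝ) : ℝ :=
  n * (derivative (M n αL αR βL βR)).eval x * (M (n - 1) αL αR βL βR).eval x

noncomputable def weightM (n : ℕ) (αL αR βL βR x : ℝ) : ℝ :=
  2 * H n αL αR βL βR ^ 2 / weightMDen n αL αR βL βR x

end C1

/-! ### The algorithm -/

/-- The pairs `(x, w x)` for the real roots `x` of `P`. -/
noncomputable def rootPairs (P : ℝ[X]) (w : ℝ → ℝ) : Finset (ℝ × ℝ) :=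
  P.roots.toFinset.image fun x => (x, w x)

/-- Scale a node and a weight from `[-1, 1]` to `[u, v]`. -/
noncomputable def scale (u v : ℝ) (p : ℝ × ℝ) : ℝ × ℝ :=
  (u + (v - u) * ((1 + p.1) / 2), (v - u) / 2 * p.2)

/-- Length of the subinterval `[t s, t (s + 1)]`. -/
def lenL (t : ℕ → ℝ) (s : ℕ) : ℝ := t (s + 1) - t s

/-- Length of the `j`-th subinterval counted from the right (starting with `j = 0`). -/
def lenR (S : ℕ) (t : ℕ → ℝ) (j : ℕ) : ℝ := t (S - j) - t (S - j - 1)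

/-- Collect the output: `left s` holds the pairs on `[-1, 1]` for the subinterval `s < m`, `mid`
those for the middle subinterval `m`, and `right j` (to be reflected) those for the `j`-th
subinterval counted from the right. Subintervals are numbered from `0` to `S - 1`. -/
noncomputable def assemble (S m : ℕ) (t : ℕ → ℝ) (left right : ℕ → Finset (ℝ × ℝ))
    (mid : Finset (ℝ × ℝ)) : Finset (ℝ × ℝ) :=
  ((Finset.range m).biUnion fun s => (left s).image (scale (t s) (t (s + 1)))) ∪
    mid.image (scale (t m) (t (m + 1))) ∪
    (Finset.range (S - 1 - m)).biUnion fun j =>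
      (right j).image fun p => scale (t (S - j - 1)) (t (S - j)) (-p.1, p.2)

namespace C0

/-- Parameter of the subinterval `s`, propagated from the left end. -/
noncomputable def αLeft (N : ℕ) (t : ℕ → ℝ) (s : ℕ) : ℝ := param N (lenL t) s

/-- Parameter of the `j`-th subinterval from the right, propagated from the right end. -/
noncomputable def αRight (N S : ℕ) (t : ℕ → ℝ) (j : ℕ) : ℝ := param N (lenR S t) j

/-- The polynomial `M_{ω,N+1}` of the middle subinterval `m`. -/
noncomputable def midPoly (N S m : ℕ) (t : ℕ → ℝ) (ω : ℝ) : ℝ[X] :=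
  Mω ω (N + 1) (αLeft N t m) (αRight N S t (S - 1 - m))

/-- The output of the algorithm for continuity class 0, with free parameter `ω`. -/
noncomputable def rule (N S m : ℕ) (t : ℕ → ℝ) (ω : ℝ) : Finset (ℝ × ℝ) :=
  assemble S m t
    (fun s => rootPairs (Q N (αLeft N t s)) (weightQ N (αLeft N t s)))
    (fun j => rootPairs (Q N (αRight N S t j)) (weightQ N (αRight N S t j)))
    (rootPairs (midPoly N S m t ω)
      (weightM ω (N + 1) (αLeft N t m) (αRight N S t (S - 1 - m))))

end C0

namespace C1

/-- Parameters of the subinterval `s`, propagated from the left end. -/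
noncomputable def pLeft (N : ℕ) (t : ℕ → ℝ) (s : ℕ) : ℝ × ℝ := param N (lenL t) s

/-- Parameters of the `j`-th subinterval from the right, propagated from the right end. -/
noncomputable def pRight (N S : ℕ) (t : ℕ → ℝ) (j : ℕ) : ℝ × ℝ := param N (lenR S t) j

/-- The polynomial `M_{N+1}` of the middle subinterval `m`. -/
noncomputable def midPoly (N S m : ℕ) (t : ℕ → ℝ) : ℝ[X] :=
  M (N + 1) (pLeft N t m).1 (pRight N S t (S - 1 - m)).1
    (pLeft N t m).2 (pRight N S t (S - 1 - m)).2

/-- Denominator of the weight at a root `x` of the polynomial of the middle subinterval. -/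
noncomputable def midDen (N S m : ℕ) (t : ℕ → ℝ) (x : ℝ) : ℝ :=
  weightMDen (N + 1) (pLeft N t m).1 (pRight N S t (S - 1 - m)).1
    (pLeft N t m).2 (pRight N S t (S - 1 - m)).2 x

/-- The output of the algorithm for continuity class 1. -/
noncomputable def rule (N S m : ℕ) (t : ℕ → ℝ) : Finset (ℝ × ℝ) :=
  assemble S m t
    (fun s => rootPairs (Q N (pLeft N t s).1 (pLeft N t s).2)
      (weightQ N (pLeft N t s).1 (pLeft N t s).2))
    (fun j => rootPairs (Q N (pRight N S t j).1 (pRight N S t j).2)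
      (weightQ N (pRight N S t j).1 (pRight N S t j).2))
    (rootPairs (midPoly N S m t)
      (weightM (N + 1) (pLeft N t m).1 (pRight N S t (S - 1 - m)).1
        (pLeft N t m).2 (pRight N S t (S - 1 - m)).2))

/-- A side step with parameters `q = (α, β)` can be carried out: the recursion does not divide by
zero, and `Q_N(α, β, ·)` has `N` distinct real roots, all in `[-1, 1]`. -/
def SideAdmissible (N : ℕ) (q : ℝ × ℝ) : Prop :=
  Γ N q.1 q.2 ≠ 0 ∧ HasDistinctRootsIn (Q N q.1 q.2) N (Set.Icc (-1) 1)

end C1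

end SplineQuad

/-!
Write `L_{α,β}` for the functional `f ↦ ∫ f + 2α f(-1) - 24β f'(-1)` on polynomials, the integral
being over `[-1, 1]`; for `c = 0` the derivative term is absent. The closed formula for `Q_n` gives a
polynomial that is orthogonal to all lower degrees for the functional `f ↦ L_{α,β} ((1 - x)^{c+1} f)`
(`massFunctional_Q_mul`): integration by parts leaves boundary terms at `-1`, and the coefficients are
such that the end point terms of `L_{α,β}` cancel them. Hence the roots of `Q_N` are the free nodes of
a Gauss–Radau formula for `L_{α,β}` with a fixed node at `1`, simple for `c = 0` and double for
`c = 1`. The weights of the fixed node are found by testing with `Q_N`, and for `c = 1` also with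
`(1 - x) Q_N`; they are the end point terms `2 λ α_new` and `-24 λ^2 β_new` of the recursion
(`side_quadrature`). The free weights are Christoffel numbers, found by testing with
`Q_N / (X - x) · Q_{N-1}`; that product also shows that their denominators do not vanish
(`gauss_of_orthogonal`, `radau_of_orthogonal`, `radau_two_of_orthogonal`).

So on each subinterval the rule trades end point terms at the left for end point terms at the right.
Scaling to the subintervals multiplies them by powers of the length, and as the splines are `C^c` the
error telescopes towards the middle (`left_chain`; the right half is its reflection). There,
`M_{N+1}` is orthogonal for the functional with terms at both end points (`massFunctional_M_mul`), and
its Gauss formula absorbs what arrives from both sides (`mid_quadrature`, `ChainFit.sum_eq`). For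
`c = 0` exactness is needed up to degree `2N` only, one less than the Gauss formula gives, and this
leaves the freedom to add `ω M_N`.

The facts used about `P_n^{(a,0)}` come from Rodrigues' formula: it yields orthogonality and the norm
(`intPoly_jacobi_mul`). The Jacobi operator is self-adjoint, so orthogonality yields the differential
equation (`jacobi_ode`), and that determines the derivatives at the end points.

For `c = 0` the recursion keeps `α` nonnegative, so all functionals involved are positive, and the
classical argument shows that the roots are real, distinct and, with full orthogonality, in
`(-1, 1)` (`card_roots_of_orthogonal`, `roots_mem_Ioo_of_orthogonal`); a perturbation estimate gives
the latter for small `ω` (`exists_delta_roots_mem_Ioo`).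

For optimality, suppose that an exact rule had at most `N S` nodes. Going from left to right, one
builds a nonzero nonnegative spline with double zeros at the nodes inside the subintervals it lives
on: a subinterval with `N` inner nodes lets a positive piece pass, one with fewer lets it end or begin
(`HasBumps`, `exists_partialSpline`). Its integral is positive although it vanishes at all nodes
(`IsExactRule.card_gt`).
-/

namespace SplineQuad

/-! ### The reference functionals on `[-1, 1]` -/

/-- Integration over `[-1, 1]`, as a linear functional on polynomials. -/
noncomputable def intPoly : ℝ[X] →ₗ[ℝ] ℝ where
  toFun f := ∫ x in (-1 : ℝ)..1, f.eval x
  map_add' f g := by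
    simp only [eval_add]
    exact intervalIntegral.integral_add (f.continuous.intervalIntegrable _ _)
      (g.continuous.intervalIntegrable _ _)
  map_smul' c f := by
    simp [eval_smul]

theorem intPoly_apply (f : ℝ[X]) : intPoly f = ∫ x in (-1 : ℝ)..1, f.eval x := rfl

theorem intPoly_C_mul (c : ℝ) (f : ℝ[X]) : intPoly (C c * f) = c * intPoly f := by
  rw [← smul_eq_C_mul, map_smul, smul_eq_mul]

theorem intPoly_derivative (f : ℝ[X]) :
    intPoly (derivative f) = f.eval 1 - f.eval (-1) := by
  rw [intPoly_apply]
  exact intervalIntegral.integral_eq_sub_of_hasDerivAt (fun x _ => f.hasDerivAt x)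
    ((derivative f).continuous.intervalIntegrable _ _)

theorem intPoly_derivative_mul (f g : ℝ[X]) :
    intPoly (derivative f * g) =
      f.eval 1 * g.eval 1 - f.eval (-1) * g.eval (-1) - intPoly (f * derivative g) := by
  have h := intPoly_derivative (f * g)
  rw [derivative_mul, map_add, eval_mul, eval_mul] at h
  linarith

theorem intPoly_pos {p : ℝ[X]} (hp : p ≠ 0) (h : ∀ x ∈ Set.Icc (-1 : ℝ) 1, 0 ≤ p.eval x) :
    0 < intPoly p := by
  rw [intPoly_apply]
  refine intervalIntegral.integral_pos (by norm_num) p.continuous.continuousOn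
    (fun x hx => h x ⟨hx.1.le, hx.2⟩) ?_
  by_contra! hn
  refine hp (eq_zero_of_infinite_isRoot p
    ((Set.Icc_infinite (by norm_num : (-1 : ℝ) < 1)).mono fun x hx => ?_))
  exact le_antisymm (hn x hx) (h x hx)

/-- Integration over `[-1, 1]`, perturbed by multiples of the values and of the derivatives at the
two end points. -/
noncomputable def massFunctional (aL bL aR bR : ℝ) : ℝ[X] →ₗ[ℝ] ℝ :=
  intPoly + aL • (leval (-1)) + bL • (leval (-1)).comp derivative + aR • (leval 1) +
    bR • (leval 1).comp derivative

theorem massFunctional_apply (aL bL aR bR : ℝ) (f : ℝ[X]) :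
    massFunctional aL bL aR bR f =
      intPoly f + aL * f.eval (-1) + bL * (derivative f).eval (-1) + aR * f.eval 1 +
        bR * (derivative f).eval 1 := rfl

/-! ### Gaussian quadrature for a linear functional -/

theorem eval_derivative_X_sub_C_mul_self (x : ℝ) (q : ℝ[X]) :
    (derivative ((X - C x) * q)).eval x = q.eval x := by
  simp [derivative_mul]

/-- Gauss quadrature with the Christoffel weights. If `Q` has `n = j + 1` distinct roots and is
orthogonal, with respect to `L`, to the polynomials of degree less than `d`, then interpolation at
the roots integrates `L` exactly in degrees less than `n + d`. The weights are found by testing with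
the product of `Q / (X - x)` and the previous orthogonal polynomial `R`. -/
theorem gauss_of_orthogonal {j d : ℕ} (L : ℝ[X] →ₗ[ℝ] ℝ) {Q R : ℝ[X]} {c : ℝ}
    (hQ : Q.natDegree ≤ j + 1) (hroots : Q.roots.toFinset.card = j + 1) (hd : j ≤ d)
    (horth : ∀ g : ℝ[X], g.degree < d → L (Q * g) = 0) (hR : R.natDegree ≤ j)
    (hRL : ∀ g : ℝ[X], g.natDegree ≤ j → L (R * g) = g.coeff j * c) (hc : Q.coeff (j + 1) * c ≠ 0) :
    (∀ x ∈ Q.roots, (derivative Q).eval x * R.eval x ≠ 0) ∧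
    ∀ f : ℝ[X], f.degree < (j + 1 + d : ℕ) →
      L f = ∑ x ∈ Q.roots.toFinset,
        Q.coeff (j + 1) * c / ((derivative Q).eval x * R.eval x) * f.eval x := by
  classical
  have hQ0 : Q ≠ 0 := by
    rintro rfl
    simp at hroots
  have hQn : Q.natDegree = j + 1 := by
    refine le_antisymm hQ ?_
    rw [← hroots]
    exact (Multiset.toFinset_card_le _).trans (card_roots' Q)
  set s := Q.roots.toFinset with hs
  have hinj : Set.InjOn (id : ℝ → ℝ) s := Function.injective_id.injOn
  set v : ℝ → ℝ := fun x => L (Lagrange.basis s id x) with hv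
  have hquad : ∀ f : ℝ[X], f.degree < (j + 1 + d : ℕ) → L f = ∑ x ∈ s, v x * f.eval x := by
    intro f hf
    have hmod : f % Q + Q * (f / Q) = f := EuclideanDomain.mod_add_div f Q
    have h1 : L (Q * (f / Q)) = 0 := by
      apply horth
      by_cases hfQ : Q.degree ≤ f.degree
      · have h2 := degree_add_div hQ0 hfQ
        by_cases h0 : f / Q = 0
        · rw [h0, degree_zero]
          exact WithBot.bot_lt_coe d
        · have hf0 : f ≠ 0 := by
            rintro rfl
            simp at h0
          rw [degree_eq_natDegree hQ0, degree_eq_natDegree h0, degree_eq_natDegree hf0] at h2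
          rw [degree_eq_natDegree hf0] at hf
          rw [degree_eq_natDegree h0]
          norm_cast at h2 hf ⊢
          omega
      · rw [(Polynomial.div_eq_zero_iff hQ0).2 (not_le.1 hfQ), degree_zero]
        exact WithBot.bot_lt_coe d
    have h2 : f % Q = Lagrange.interpolate s id fun x => f.eval x := by
      refine Lagrange.eq_interpolate_of_eval_eq _ hinj ?_ ?_
      · refine (EuclideanDomain.mod_lt f hQ0).trans_le ?_
        rw [hroots]
        exact degree_le_of_natDegree_le hQ
      · intro x hx
        have hx0 : Q.eval x = 0 := by
          have := (Multiset.mem_toFinset.1 hx)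
          exact (mem_roots hQ0).1 this
        conv_rhs => rw [← hmod]
        simp [hx0]
    calc L f = L (f % Q) + L (Q * (f / Q)) := by rw [← map_add, hmod]
      _ = ∑ x ∈ s, v x * f.eval x := by
        rw [h1, h2, add_zero, Lagrange.interpolate_apply, map_sum]
        refine Finset.sum_congr rfl fun x _ => ?_
        rw [← smul_eq_C_mul, map_smul, smul_eq_mul, mul_comm]
  have key : ∀ x ∈ s, v x * ((derivative Q).eval x * R.eval x) = Q.coeff (j + 1) * c := by
    intro x hx
    have hx' : x ∈ Q.roots := Multiset.mem_toFinset.1 hx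
    have hx0 : Q.IsRoot x := (mem_roots hQ0).1 hx'
    obtain ⟨q, hq⟩ := dvd_iff_isRoot.2 hx0
    have hq0 : q ≠ 0 := by
      rintro rfl
      simp [hq] at hQ0
    have hqdeg : q.natDegree = j := by
      have := natDegree_mul (X_sub_C_ne_zero x) hq0
      rw [← hq, hQn, natDegree_X_sub_C] at this
      omega
    have hqc : q.coeff j = Q.coeff (j + 1) := by
      have h1 := leadingCoeff_mul (X - C x) q
      rw [← hq, leadingCoeff_X_sub_C, one_mul, leadingCoeff, leadingCoeff, hQn, hqdeg] at h1
      exact h1.symm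
    have h1 : L (R * q) = Q.coeff (j + 1) * c := by rw [hRL q hqdeg.le, hqc]
    have h2 := hquad (R * q) (by
      refine (degree_le_of_natDegree_le (natDegree_mul_le_of_le hR hqdeg.le)).trans_lt ?_
      exact_mod_cast (by omega : j + j < j + 1 + d))
    rw [← h1, h2, Finset.sum_eq_single x, hq, eval_derivative_X_sub_C_mul_self, eval_mul]
    · ring
    · intro y hy hyx
      have hy0 : Q.eval y = 0 := (mem_roots hQ0).1 (Multiset.mem_toFinset.1 hy)
      have : q.eval y = 0 := by
        rw [hq, eval_mul, eval_sub, eval_X, eval_C] at hy0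
        exact (mul_eq_zero.1 hy0).resolve_left (sub_ne_zero.2 hyx)
      simp [this]
    · intro h
      exact (h hx).elim
  have hne : ∀ x ∈ s, (derivative Q).eval x * R.eval x ≠ 0 := fun x hx h0 => by
    have := key x hx
    rw [h0, mul_zero] at this
    exact hc this.symm
  refine ⟨fun x hx => hne x (Multiset.mem_toFinset.2 hx), fun f hf => ?_⟩
  rw [hquad f hf]
  refine Finset.sum_congr rfl fun x hx => ?_
  rw [← key x hx, mul_div_assoc, div_self (hne x hx), mul_one]

/-- Gauss–Radau quadrature with a simple fixed node at `1`, whose weight is not computed from the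
other weights but by testing with `Q`. -/
theorem radau_of_orthogonal {j : ℕ} (L : ℝ[X] →ₗ[ℝ] ℝ) {Q R : ℝ[X]} {c : ℝ}
    (hQ : Q.natDegree ≤ j + 1) (hroots : Q.roots.toFinset.card = j + 1)
    (horth : ∀ g : ℝ[X], g.natDegree ≤ j → L ((1 - X) * (Q * g)) = 0) (hR : R.natDegree ≤ j)
    (hRL : ∀ g : ℝ[X], g.natDegree ≤ j → L ((1 - X) * (R * g)) = g.coeff j * c)
    (hc : Q.coeff (j + 1) * c ≠ 0) (hQ1 : Q.eval 1 ≠ 0) :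
    (∀ x ∈ Q.roots, (derivative Q).eval x * R.eval x * (1 - x) ≠ 0) ∧
    ∀ f : ℝ[X], f.natDegree ≤ 2 * (j + 1) →
      L f = ∑ x ∈ Q.roots.toFinset,
        Q.coeff (j + 1) * c / ((derivative Q).eval x * R.eval x * (1 - x)) * f.eval x +
          L Q / Q.eval 1 * f.eval 1 := by
  classical
  have hQ0 : Q ≠ 0 := by
    rintro rfl
    simp at hroots
  have hx1 : ∀ x ∈ Q.roots, 1 - x ≠ 0 := by
    intro x hx h
    apply hQ1
    rw [sub_eq_zero.1 h]
    exact (mem_roots hQ0).1 hx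
  obtain ⟨hne, hG⟩ := gauss_of_orthogonal (d := j + 1) (L ∘ₗ LinearMap.mulLeft ℝ (1 - X)) hQ hroots
    (Nat.le_succ j)
    (fun g hg => horth g (by
      rw [degree_lt_iff_coeff_zero] at hg
      exact natDegree_le_iff_coeff_eq_zero.2 fun N hN => hg N hN)) hR hRL hc
  refine ⟨fun x hx => mul_ne_zero (hne x hx) (hx1 x hx), ?_⟩
  set W : ℝ → ℝ := fun x => Q.coeff (j + 1) * c / ((derivative Q).eval x * R.eval x * (1 - x))
    with hW
  -- The residual of the quadrature formula without the fixed node only sees the value at `1`.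
  set Z : ℝ[X] →ₗ[ℝ] ℝ := L - ∑ x ∈ Q.roots.toFinset, W x • leval x with hZ
  have hZa : ∀ f, Z f = L f - ∑ x ∈ Q.roots.toFinset, W x * f.eval x := by
    intro f
    simp [hZ, LinearMap.sum_apply]
  have hZ0 : ∀ g : ℝ[X], g.natDegree ≤ 2 * j + 1 → Z ((1 - X) * g) = 0 := by
    intro g hg
    have h := hG g ((degree_le_of_natDegree_le hg).trans_lt (by
      exact_mod_cast (by omega : 2 * j + 1 < j + 1 + (j + 1))))
    rw [hZa, sub_eq_zero]
    simp only [LinearMap.comp_apply, LinearMap.mulLeft_apply] at h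
    rw [h]
    refine Finset.sum_congr rfl fun x hx => ?_
    have := hx1 x (Multiset.mem_toFinset.1 hx)
    have h2 := hne x (Multiset.mem_toFinset.1 hx)
    simp only [hW, eval_mul, eval_sub, eval_one, eval_X]
    field_simp
  have hZ1 : ∀ f : ℝ[X], f.natDegree ≤ 2 * (j + 1) → Z f = f.eval 1 * Z 1 := by
    intro f hf
    obtain ⟨g, hg⟩ : (X - C 1) ∣ f - C (f.eval 1) := X_sub_C_dvd_sub_C_eval
    have hgd : g.natDegree ≤ 2 * j + 1 := by
      by_cases hg0 : g = 0
      · simp [hg0]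
      have h1 := natDegree_mul (X_sub_C_ne_zero (1 : ℝ)) hg0
      rw [← hg, natDegree_sub_C, natDegree_X_sub_C] at h1
      omega
    have h2 : f = C (f.eval 1) * 1 + (1 - X) * (-g) := by
      have : f = C (f.eval 1) + (X - C 1) * g := by rw [← hg]; ring
      rw [C_1] at this
      linear_combination this
    conv_lhs => rw [h2]
    rw [map_add, hZ0 _ (by rwa [natDegree_neg]), ← smul_eq_C_mul, map_smul, smul_eq_mul, add_zero]
  have hZQ : L Q = Q.eval 1 * Z 1 := by
    rw [← hZ1 Q (by omega), hZa, Finset.sum_eq_zero, sub_zero]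
    intro x hx
    have : Q.eval x = 0 := (mem_roots hQ0).1 (Multiset.mem_toFinset.1 hx)
    simp [this]
  intro f hf
  have h1 := hZ1 f hf
  rw [hZa] at h1
  rw [hZQ, mul_div_cancel_left₀ _ hQ1]
  linarith

/-- Gauss–Radau quadrature with a double fixed node at `1`. The weights of the value and of the
derivative at `1` are found by testing with `Q` and `(1 - X) Q`. -/
theorem radau_two_of_orthogonal {j : ℕ} (L : ℝ[X] →ₗ[ℝ] ℝ) {Q R : ℝ[X]} {c A B : ℝ}
    (hQ : Q.natDegree ≤ j + 1) (hroots : Q.roots.toFinset.card = j + 1)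
    (horth : ∀ g : ℝ[X], g.natDegree ≤ j → L ((1 - X) ^ 2 * (Q * g)) = 0) (hR : R.natDegree ≤ j)
    (hRL : ∀ g : ℝ[X], g.natDegree ≤ j → L ((1 - X) ^ 2 * (R * g)) = g.coeff j * c)
    (hc : Q.coeff (j + 1) * c ≠ 0) (hQ1 : Q.eval 1 ≠ 0)
    (hA : L Q = A * Q.eval 1 + B * (derivative Q).eval 1)
    (hB : L ((1 - X) * Q) = -(B * Q.eval 1)) :
    (∀ x ∈ Q.roots, (derivative Q).eval x * R.eval x * (1 - x) ^ 2 ≠ 0) ∧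
    ∀ f : ℝ[X], f.natDegree ≤ 2 * (j + 1) + 1 →
      L f = ∑ x ∈ Q.roots.toFinset,
        Q.coeff (j + 1) * c / ((derivative Q).eval x * R.eval x * (1 - x) ^ 2) * f.eval x +
          A * f.eval 1 + B * (derivative f).eval 1 := by
  classical
  have hQ0 : Q ≠ 0 := by
    rintro rfl
    simp at hroots
  have hx1 : ∀ x ∈ Q.roots, 1 - x ≠ 0 := by
    intro x hx h
    apply hQ1
    rw [sub_eq_zero.1 h]
    exact (mem_roots hQ0).1 hx
  obtain ⟨hne, hG⟩ := gauss_of_orthogonal (d := j + 1) (L ∘ₗ LinearMap.mulLeft ℝ ((1 - X) ^ 2)) hQ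
    hroots (Nat.le_succ j)
    (fun g hg => horth g (by
      rw [degree_lt_iff_coeff_zero] at hg
      exact natDegree_le_iff_coeff_eq_zero.2 fun N hN => hg N hN)) hR hRL hc
  refine ⟨fun x hx => mul_ne_zero (hne x hx) (pow_ne_zero 2 (hx1 x hx)), ?_⟩
  set W : ℝ → ℝ := fun x => Q.coeff (j + 1) * c / ((derivative Q).eval x * R.eval x * (1 - x) ^ 2)
    with hW
  -- The residual of the formula without the fixed node only sees the value and the slope at `1`.
  set Z : ℝ[X] →ₗ[ℝ] ℝ := L - ∑ x ∈ Q.roots.toFinset, W x • leval x with hZ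
  have hZa : ∀ f, Z f = L f - ∑ x ∈ Q.roots.toFinset, W x * f.eval x := by
    intro f
    simp [hZ, LinearMap.sum_apply]
  have hZ0 : ∀ g : ℝ[X], g.natDegree ≤ 2 * j + 1 → Z ((1 - X) ^ 2 * g) = 0 := by
    intro g hg
    have h := hG g ((degree_le_of_natDegree_le hg).trans_lt (by
      exact_mod_cast (by omega : 2 * j + 1 < j + 1 + (j + 1))))
    rw [hZa, sub_eq_zero]
    simp only [LinearMap.comp_apply, LinearMap.mulLeft_apply] at h
    rw [h]
    refine Finset.sum_congr rfl fun x hx => ?_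
    have := hx1 x (Multiset.mem_toFinset.1 hx)
    have h2 := hne x (Multiset.mem_toFinset.1 hx)
    simp only [hW, eval_mul, eval_sub, eval_one, eval_X, eval_pow]
    field_simp
  have hZ1 : ∀ f : ℝ[X], f.natDegree ≤ 2 * (j + 1) + 1 →
      Z f = f.eval 1 * Z 1 + (derivative f).eval 1 * Z (X - 1) := by
    intro f hf
    obtain ⟨g, hg⟩ : (X - C 1) ∣ f - C (f.eval 1) := X_sub_C_dvd_sub_C_eval
    obtain ⟨k, hk⟩ : (X - C 1) ∣ g - C (g.eval 1) := X_sub_C_dvd_sub_C_eval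
    have hgd : g.natDegree ≤ 2 * j + 2 := by
      by_cases hg0 : g = 0
      · simp [hg0]
      have h1 := natDegree_mul (X_sub_C_ne_zero (1 : ℝ)) hg0
      rw [← hg, natDegree_sub_C, natDegree_X_sub_C] at h1
      omega
    have hkd : k.natDegree ≤ 2 * j + 1 := by
      by_cases hk0 : k = 0
      · simp [hk0]
      have h1 := natDegree_mul (X_sub_C_ne_zero (1 : ℝ)) hk0
      rw [← hk, natDegree_sub_C, natDegree_X_sub_C] at h1
      omega
    have hf1 : f = C (f.eval 1) + (X - C 1) * g := by rw [← hg]; ring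
    have hg1 : g = C (g.eval 1) + (X - C 1) * k := by rw [← hk]; ring
    have hgf : g.eval 1 = (derivative f).eval 1 := by
      rw [hf1]
      simp [derivative_mul]
    have h2 : f = C (f.eval 1) * 1 + C ((derivative f).eval 1) * (X - 1) + (1 - X) ^ 2 * k := by
      rw [← hgf]
      rw [C_1] at hf1 hg1
      linear_combination hf1 + (X - 1) * hg1
    conv_lhs => rw [h2]
    rw [map_add, map_add, hZ0 _ hkd, ← smul_eq_C_mul, ← smul_eq_C_mul, map_smul, map_smul,
      smul_eq_mul, smul_eq_mul, add_zero]
  have hQx : ∀ x ∈ Q.roots.toFinset, Q.eval x = 0 := fun x hx =>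
    (mem_roots hQ0).1 (Multiset.mem_toFinset.1 hx)
  have hZQ : L Q = Q.eval 1 * Z 1 + (derivative Q).eval 1 * Z (X - 1) := by
    rw [← hZ1 Q (by omega), hZa, Finset.sum_eq_zero, sub_zero]
    intro x hx
    simp [hQx x hx]
  have hZQ' : L ((1 - X) * Q) = -(Q.eval 1 * Z (X - 1)) := by
    have hd : ((1 - X) * Q).natDegree ≤ 2 * (j + 1) + 1 := by
      have h1 : (1 - X : ℝ[X]).natDegree ≤ 1 := by compute_degree
      have := natDegree_mul_le_of_le h1 hQ
      omega
    have h1 := hZ1 _ hd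
    rw [hZa, Finset.sum_eq_zero, sub_zero] at h1
    · rw [h1]
      simp [derivative_mul]
    · intro x hx
      simp [hQx x hx]
  have hB' : Z (X - 1) = B := by
    rw [hB] at hZQ'
    have : Q.eval 1 * (Z (X - 1) - B) = 0 := by linarith
    linarith [(mul_eq_zero.1 this).resolve_left hQ1]
  have hA' : Z 1 = A := by
    rw [hA, hB'] at hZQ
    have : Q.eval 1 * (Z 1 - A) = 0 := by linarith
    linarith [(mul_eq_zero.1 this).resolve_left hQ1]
  intro f hf
  have h1 := hZ1 f hf
  rw [hZa, hA', hB'] at h1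
  linarith

/-! ### Jacobi polynomials `P_n^{(a,0)}` -/

theorem natDegree_half_mul_X_sub_one_le : (C (1 / 2) * (X - 1) : ℝ[X]).natDegree ≤ 1 := by
  compute_degree

theorem natDegree_half_mul_X_add_one_le : (C (1 / 2) * (X + 1) : ℝ[X]).natDegree ≤ 1 := by
  compute_degree

theorem jacobi_natDegree_le (a n : ℕ) : (jacobi a 0 n).natDegree ≤ n := by
  refine natDegree_sum_le_of_forall_le _ _ fun s hs => ?_
  have hs' := Finset.mem_range.1 hs
  have h1 := natDegree_pow_le_of_le s natDegree_half_mul_X_sub_one_le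
  have h2 := natDegree_pow_le_of_le (n - s) natDegree_half_mul_X_add_one_le
  have h3 := natDegree_mul_le_of_le (natDegree_C_mul_le
    (((n + a).choose (n - s) : ℝ) * ((n + 0).choose s : ℝ)) _ |>.trans h1) h2
  omega

theorem jacobi_coeff (a n : ℕ) :
    (jacobi a 0 n).coeff n = ((2 * n + a).choose n : ℝ) / 2 ^ n := by
  have hterm : ∀ s ∈ Finset.range (n + 1),
      (C (((n + a).choose (n - s) : ℝ) * ((n + 0).choose s : ℝ)) *
        (C (1 / 2) * (X - 1)) ^ s * (C (1 / 2) * (X + 1)) ^ (n - s) : ℝ[X]).coeff n =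
      ((n.choose s * (n + a).choose (n - s) : ℕ) : ℝ) / 2 ^ n := by
    intro s hs
    have hs' := Finset.mem_range.1 hs
    have hns : s * 1 + (n - s) * 1 = n := by omega
    have h1 := natDegree_pow_le_of_le s natDegree_half_mul_X_sub_one_le
    have h2 := natDegree_pow_le_of_le (n - s) natDegree_half_mul_X_add_one_le
    have h3 := coeff_mul_add_eq_of_natDegree_le h1 h2
    rw [coeff_pow_of_natDegree_le natDegree_half_mul_X_sub_one_le,
      coeff_pow_of_natDegree_le natDegree_half_mul_X_add_one_le, hns] at h3
    rw [mul_assoc, coeff_C_mul, h3]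
    have e1 : (C (1 / 2) * (X - 1) : ℝ[X]).coeff 1 = 1 / 2 := by
      rw [coeff_C_mul, coeff_sub, coeff_X_one, coeff_one]; norm_num
    have e2 : (C (1 / 2) * (X + 1) : ℝ[X]).coeff 1 = 1 / 2 := by
      rw [coeff_C_mul, coeff_add, coeff_X_one, coeff_one]; norm_num
    rw [e1, e2, ← pow_add, show s + (n - s) = n by omega]
    push_cast
    rw [add_zero, one_div, inv_pow]
    ring
  rw [jacobi, finsetSum_coeff, Finset.sum_congr rfl hterm, ← Finset.sum_div, ← Nat.cast_sum]
  congr 2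
  rw [show 2 * n + a = n + (n + a) by ring, Nat.add_choose_eq,
    Finset.Nat.sum_antidiagonal_eq_sum_range_succ_mk]

theorem jacobi_eval_one (a n : ℕ) : (jacobi a 0 n).eval 1 = ((n + a).choose n : ℝ) := by
  rw [jacobi, eval_finsetSum, Finset.sum_eq_single 0]
  · simp; norm_num
  · intro s _ hs
    simp [hs]
  · simp

/-- Rodrigues' formula. -/
theorem jacobi_rodrigues (a n : ℕ) :
    derivative^[n] ((X - 1) ^ (n + a) * (X + 1) ^ n : ℝ[X]) =
      C ((n.factorial : ℝ) * 2 ^ n) * ((X - 1) ^ a * jacobi a 0 n) := by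
  have e1 : (X - 1 : ℝ[X]) = X - C 1 := by rw [C_1]
  have e2 : (X + 1 : ℝ[X]) = X + C 1 := by rw [C_1]
  rw [iterate_derivative_mul, jacobi, Finset.mul_sum, Finset.mul_sum]
  refine Finset.sum_congr rfl fun s hs => ?_
  have hs' : s ≤ n := Nat.lt_succ_iff.1 (Finset.mem_range.1 hs)
  rw [e1, e2, iterate_derivative_X_sub_pow, iterate_derivative_X_add_pow, ← e1, ← e2,
    show n + a - (n - s) = a + s by omega, Nat.descFactorial_eq_factorial_mul_choose,
    Nat.descFactorial_eq_factorial_mul_choose]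
  simp only [nsmul_eq_mul, mul_pow, ← C_pow]
  have hfac : (n.choose s * s.factorial * (n - s).factorial : ℝ) = n.factorial := by
    exact_mod_cast Nat.choose_mul_factorial_mul_factorial hs'
  have h2 : (C (2 ^ n) * (C ((1 / 2) ^ s) * C ((1 / 2) ^ (n - s))) : ℝ[X]) = 1 := by
    rw [← C_mul, ← C_mul, ← pow_add, show s + (n - s) = n by omega, ← mul_pow]
    norm_num
  have hfac' := congrArg (C : ℝ → ℝ[X]) hfac
  simp only [C_mul, C_eq_natCast] at hfac'
  simp only [C_mul, C_eq_natCast, pow_add, add_zero, Nat.cast_mul]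
  linear_combination ((X - 1) ^ a * (X - 1) ^ s * (X + 1) ^ (n - s) * ((n + a).choose (n - s) : ℝ[X])
    * (n.choose s : ℝ[X])) * (hfac' - (n.factorial : ℝ[X]) * h2)

/-- Repeated integration by parts: the zeros of `U` at the end points kill all boundary terms. -/
theorem intPoly_iterate_derivative_mul {U : ℝ[X]} (g : ℝ[X]) (n : ℕ)
    (h : ∀ k < n, (derivative^[k] U).eval 1 = 0 ∧ (derivative^[k] U).eval (-1) = 0) :
    intPoly (derivative^[n] U * g) = (-1) ^ n * intPoly (U * derivative^[n] g) := by
  induction n generalizing g with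
  | zero => simp
  | succ n ih =>
    rw [Function.iterate_succ_apply', intPoly_derivative_mul, (h n n.lt_succ_self).1,
      (h n n.lt_succ_self).2, ih _ fun k hk => h k (hk.trans n.lt_succ_self),
      ← Function.iterate_succ_apply]
    ring

theorem intPoly_one_sub_pow_mul_one_add_pow (p q : ℕ) :
    intPoly ((1 - X) ^ p * (1 + X) ^ q) =
      2 ^ (p + q + 1) * p.factorial * q.factorial / (p + q + 1).factorial := by
  induction q generalizing p with
  | zero =>
    have h := intPoly_derivative_mul ((1 - X) ^ (p + 1)) 1
    simp only [derivative_pow, derivative_sub, derivative_one, derivative_X, mul_one, mul_zero,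
      map_zero, eval_pow, eval_sub, eval_one, eval_X, zero_sub, Nat.add_sub_cancel,
      sub_self, sub_zero, ne_eq, Nat.succ_ne_zero, not_false_eq_true, zero_pow, C_eq_natCast] at h
    have e : (((p + 1 : ℕ) : ℝ[X]) * (1 - X) ^ p * -1 : ℝ[X]) = C (-(p + 1) : ℝ) * (1 - X) ^ p := by
      simp; ring
    rw [e, intPoly_C_mul] at h
    rw [pow_zero, mul_one, add_zero, Nat.factorial_succ, Nat.factorial_zero]
    have : (p.factorial : ℝ) ≠ 0 := by positivity
    have : (p + 1 : ℝ) ≠ 0 := by positivity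
    norm_num at h
    push_cast
    field_simp
    linarith
  | succ q ih =>
    have h := intPoly_derivative_mul ((1 - X) ^ (p + 1)) ((1 + X) ^ (q + 1))
    simp only [derivative_pow, derivative_sub, derivative_add, derivative_one, derivative_X,
      eval_pow, eval_sub, eval_add, eval_one, eval_X, zero_sub, Nat.add_sub_cancel, zero_add,
      sub_self, ne_eq, Nat.succ_ne_zero, not_false_eq_true, zero_pow, C_eq_natCast,
      add_neg_cancel, zero_mul, mul_zero, mul_one] at h
    have e1 : (((p + 1 : ℕ) : ℝ[X]) * (1 - X) ^ p * -1 * (1 + X) ^ (q + 1) : ℝ[X]) =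
        C (-(p + 1) : ℝ) * ((1 - X) ^ p * (1 + X) ^ (q + 1)) := by
      simp; ring
    have e2 : ((1 - X) ^ (p + 1) * (((q + 1 : ℕ) : ℝ[X]) * (1 + X) ^ q) : ℝ[X]) =
        C (q + 1 : ℝ) * ((1 - X) ^ (p + 1) * (1 + X) ^ q) := by
      simp; ring
    rw [e1, e2, intPoly_C_mul, intPoly_C_mul, ih] at h
    have h3 : (p + 1 : ℝ) ≠ 0 := by positivity
    have h4 : ((p + 1 + q + 1).factorial : ℝ) ≠ 0 := by positivity
    rw [show p + (q + 1) + 1 = p + 1 + q + 1 by ring, Nat.factorial_succ q]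
    rw [Nat.factorial_succ p] at h
    rw [← mul_right_inj' h3]
    push_cast at h ⊢
    linear_combination -h

/-- The integral of `(1 - x)^a P_n^{(a,0)}(x) x^n` over `[-1, 1]`. -/
noncomputable def jacobiNorm (a n : ℕ) : ℝ :=
  2 ^ (n + a + 1) * (n + a).factorial * n.factorial / (2 * n + a + 1).factorial

/-- The Jacobi polynomial `P_n^{(a,0)}` is orthogonal to all lower degrees for the weight
`(1 - x)^a`. -/
theorem intPoly_jacobi_mul (a n : ℕ) {g : ℝ[X]} (hg : g.natDegree ≤ n) :
    intPoly ((1 - X) ^ a * (jacobi a 0 n * g)) = g.coeff n * jacobiNorm a n := by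
  -- By Rodrigues' formula all `n` derivatives can be moved to `g`, which leaves a constant.
  set U : ℝ[X] := (X - 1) ^ (n + a) * (X + 1) ^ n with hU
  have hz : ∀ k < n, (derivative^[k] U).eval 1 = 0 ∧ (derivative^[k] U).eval (-1) = 0 := by
    intro k hk
    constructor
    · obtain ⟨q, hq⟩ := pow_sub_dvd_iterate_derivative_of_pow_dvd k
        (Dvd.intro _ rfl : (X - 1 : ℝ[X]) ^ (n + a) ∣ U)
      rw [hq]
      have : n + a - k ≠ 0 := by omega
      simp [this]
    · obtain ⟨q, hq⟩ := pow_sub_dvd_iterate_derivative_of_pow_dvd k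
        (Dvd.intro_left _ rfl : (X + 1 : ℝ[X]) ^ n ∣ U)
      rw [hq]
      have : n - k ≠ 0 := by omega
      simp [this]
  have h := intPoly_iterate_derivative_mul g n hz
  have hgn : derivative^[n] g = C ((n.factorial : ℝ) * g.coeff n) := by
    rw [eq_C_of_natDegree_le_zero (p := derivative^[n] g)
      ((natDegree_iterate_derivative g n).trans (by omega)), coeff_iterate_derivative, zero_add,
      Nat.descFactorial_self, nsmul_eq_mul]
  rw [hU, jacobi_rodrigues, ← hU, hgn] at h
  have e1 : C ((n.factorial : ℝ) * 2 ^ n) * ((X - 1) ^ a * jacobi a 0 n) * g =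
      C ((n.factorial : ℝ) * 2 ^ n * (-1) ^ a) * ((1 - X) ^ a * (jacobi a 0 n * g)) := by
    have : (X - 1 : ℝ[X]) ^ a = C ((-1) ^ a) * (1 - X) ^ a := by
      rw [C_pow, ← mul_pow]; congr 1; simp
    rw [this, C_mul (b := (-1 : ℝ) ^ a)]; ring
  have e2 : U * C ((n.factorial : ℝ) * g.coeff n) =
      C ((n.factorial : ℝ) * g.coeff n * (-1) ^ (n + a)) * ((1 - X) ^ (n + a) * (1 + X) ^ n) := by
    have : (X - 1 : ℝ[X]) ^ (n + a) = C ((-1) ^ (n + a)) * (1 - X) ^ (n + a) := by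
      rw [C_pow, ← mul_pow]; congr 1; simp
    rw [hU, this, C_mul (b := (-1 : ℝ) ^ (n + a))]; ring
  rw [e1, e2, intPoly_C_mul, intPoly_C_mul, intPoly_one_sub_pow_mul_one_add_pow] at h
  have hn : (n.factorial : ℝ) ≠ 0 := by positivity
  have hs : ∀ m : ℕ, ((-1 : ℝ) ^ m) * (-1) ^ m = 1 := fun m => by rw [← mul_pow]; norm_num
  have h2 : (2 : ℝ) ^ n * intPoly ((1 - X) ^ a * (jacobi a 0 n * g)) =
      g.coeff n * (2 ^ (n + a + n + 1) * (n + a).factorial * n.factorial /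
        (n + a + n + 1).factorial) := by
    rw [← mul_right_inj' hn]
    rw [pow_add (-1 : ℝ)] at h
    linear_combination (-1) ^ a * h - (n.factorial : ℝ) * 2 ^ n *
      intPoly ((1 - X) ^ a * (jacobi a 0 n * g)) * hs a + n.factorial * g.coeff n *
        (2 ^ (n + a + n + 1) * (n + a).factorial * n.factorial / (n + a + n + 1).factorial) *
        ((-1) ^ n * (-1) ^ n * hs a + hs n)
  have h3 : (2 : ℝ) ^ n ≠ 0 := by positivity
  rw [← mul_right_inj' h3, h2, jacobiNorm, show n + a + n + 1 = 2 * n + a + 1 by ring,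
    show 2 * n + a + 1 = n + (n + a + 1) by ring, pow_add]
  ring

/-- This product is what becomes of the numerator of the Christoffel weights, and it is the source of
the factors in `n` in the closed formulas for them. -/
theorem jacobi_coeff_mul_jacobiNorm (a n : ℕ) :
    (jacobi a 0 (n + 1)).coeff (n + 1) * jacobiNorm a n =
      2 ^ a * (2 * n + 2 + a) / ((n + 1) * (n + 1 + a)) := by
  have h : ((2 * (n + 1) + a).choose (n + 1) : ℝ) =
      (2 * (n + 1) + a).factorial / ((n + 1).factorial * (n + 1 + a).factorial) := by
    rw [Nat.cast_choose ℝ (by omega), show 2 * (n + 1) + a - (n + 1) = n + 1 + a by omega]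
  have e1 : ((2 * (n + 1) + a).factorial : ℝ) =
      (2 * n + 2 + a) * (2 * n + a + 1).factorial := by
    rw [show 2 * (n + 1) + a = 2 * n + a + 1 + 1 by ring, Nat.factorial_succ (2 * n + a + 1)]
    push_cast; ring
  have e2 : ((n + 1 + a).factorial : ℝ) = (n + 1 + a) * (n + a).factorial := by
    rw [show n + 1 + a = n + a + 1 by ring, Nat.factorial_succ (n + a)]
    push_cast; ring
  rw [jacobi_coeff, jacobiNorm, h, e1, e2, Nat.factorial_succ n]
  have := Nat.factorial_ne_zero n
  have := Nat.factorial_ne_zero (n + a)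
  have := Nat.factorial_ne_zero (2 * n + a + 1)
  have : (n + 1 + a : ℝ) ≠ 0 := by positivity
  push_cast
  rw [show n + a + 1 = n + 1 + a by ring, pow_add 2 (n + 1) a]
  field_simp

theorem jacobi_coeff_pos (a n : ℕ) : 0 < (jacobi a 0 n).coeff n := by
  rw [jacobi_coeff]
  have := Nat.choose_pos (show n ≤ 2 * n + a by omega)
  positivity

/-! ### The Jacobi differential equation -/

/-- The differential operator of which `P_n^{(a,0)}` is an eigenvector. -/
noncomputable def jacobiOp (a : ℕ) (y : ℝ[X]) : ℝ[X] :=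
  (1 - X ^ 2) * derivative (derivative y) - (C (a : ℝ) + C (a + 2 : ℝ) * X) * derivative y

theorem derivative_weight_mul_derivative (a : ℕ) (y : ℝ[X]) :
    derivative ((1 - X) ^ (a + 1) * (1 + X) * derivative y) = (1 - X) ^ a * jacobiOp a y := by
  rw [jacobiOp]
  simp only [derivative_mul, derivative_pow, derivative_sub, derivative_add, derivative_one,
    derivative_X, Nat.add_sub_cancel, C_add, map_natCast, Nat.cast_add, Nat.cast_one]
  rw [show (C 2 : ℝ[X]) = 2 from rfl, C_1]
  ring

theorem intPoly_weight_mul_jacobiOp (a : ℕ) (y g : ℝ[X]) :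
    intPoly ((1 - X) ^ a * jacobiOp a y * g) =
      -intPoly ((1 - X) ^ (a + 1) * (1 + X) * derivative y * derivative g) := by
  rw [← derivative_weight_mul_derivative, intPoly_derivative_mul]
  simp

theorem natDegree_jacobiOp_le (a : ℕ) {m : ℕ} {y : ℝ[X]} (hy : y.natDegree ≤ m) :
    (jacobiOp a y).natDegree ≤ m := by
  rw [natDegree_le_iff_coeff_eq_zero]
  intro k hk
  have hc : ∀ i, m < i → y.coeff i = 0 := natDegree_le_iff_coeff_eq_zero.1 hy
  obtain ⟨l, rfl⟩ : ∃ l, k = l + 1 := ⟨k - 1, by omega⟩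
  simp only [jacobiOp, sub_mul, add_mul, one_mul, coeff_sub, coeff_add, mul_assoc, coeff_C_mul,
    coeff_X_mul, coeff_derivative, X_pow_mul, coeff_mul_X_pow']
  split_ifs with h
  · rw [hc (l + 1 + 1 + 1) (by omega), hc (l + 1 + 1) (by omega), hc (l + 1) (by omega)]
    rw [hc _ (by omega)]
    ring
  · rw [hc (l + 1 + 1 + 1) (by omega), hc (l + 1 + 1) (by omega), hc (l + 1) (by omega)]
    ring

theorem coeff_jacobiOp (a : ℕ) {m : ℕ} {y : ℝ[X]} (hy : y.natDegree ≤ m) :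
    (jacobiOp a y).coeff m = -(m * (m + a + 1) * y.coeff m) := by
  have hc : ∀ i, m < i → y.coeff i = 0 := natDegree_le_iff_coeff_eq_zero.1 hy
  simp only [jacobiOp, sub_mul, add_mul, one_mul, coeff_sub, coeff_add, mul_assoc, coeff_C_mul,
    coeff_derivative, X_pow_mul, coeff_mul_X_pow']
  rw [hc (m + 1 + 1) (by omega), hc (m + 1) (by omega)]
  rcases m with _ | _ | l
  · simp
  · simp [coeff_derivative]; ring
  · rw [coeff_X_mul, coeff_derivative, if_pos (by omega), show l + 1 + 1 - 2 = l by omega]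
    push_cast
    ring

/-- The Jacobi differential equation. The left side has degree less than `n`, and by self-adjointness
of the operator it is orthogonal to all such polynomials, hence to itself. -/
theorem jacobi_ode (a n : ℕ) :
    jacobiOp a (jacobi a 0 n) + C ((n : ℝ) * (n + a + 1)) * jacobi a 0 n = 0 := by
  set P := jacobi a 0 n with hP
  have hPn : P.natDegree ≤ n := jacobi_natDegree_le a n
  set z := jacobiOp a P + C ((n : ℝ) * (n + a + 1)) * P with hz
  have hzn : z.natDegree ≤ n :=
    natDegree_add_le_of_degree_le (natDegree_jacobiOp_le a hPn) ((natDegree_C_mul_le _ _).trans hPn)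
  have hzc : z.coeff n = 0 := by
    rw [hz, coeff_add, coeff_jacobiOp a hPn, coeff_C_mul]; ring
  have hLz : (jacobiOp a z).coeff n = 0 := by
    rw [coeff_jacobiOp a hzn, hzc]; ring
  have h0 : intPoly ((1 - X) ^ a * (P * z)) = 0 := by
    rw [intPoly_jacobi_mul a n hzn, hzc, zero_mul]
  have h1 : intPoly ((1 - X) ^ a * jacobiOp a P * z) = 0 := by
    rw [intPoly_weight_mul_jacobiOp]
    have h2 := intPoly_weight_mul_jacobiOp a z P
    have h3 : intPoly ((1 - X) ^ a * (P * jacobiOp a z)) = 0 := by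
      rw [intPoly_jacobi_mul a n (natDegree_jacobiOp_le a hzn), hLz, zero_mul]
    rw [show (1 - X) ^ a * jacobiOp a z * P = (1 - X) ^ a * (P * jacobiOp a z) by ring, h3] at h2
    rw [show (1 - X) ^ (a + 1) * (1 + X) * derivative P * derivative z =
      (1 - X) ^ (a + 1) * (1 + X) * derivative z * derivative P by ring, ← h2]
  by_contra hne
  have hpos : 0 < intPoly ((1 - X) ^ a * z ^ 2) := by
    refine intPoly_pos (mul_ne_zero (pow_ne_zero _ ?_) (pow_ne_zero _ hne)) fun x hx => ?_
    · intro h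
      have := congrArg (eval 0) h
      simp at this
    · simp only [eval_mul, eval_pow, eval_sub, eval_one, eval_X]
      have : 0 ≤ 1 - x := by linarith [hx.2]
      positivity
  have h4 : (1 - X) ^ a * z ^ 2 = (1 - X) ^ a * jacobiOp a P * z +
      C ((n : ℝ) * (n + a + 1)) * ((1 - X) ^ a * (P * z)) := by
    conv_lhs => rw [pow_two]
    nth_rw 1 [hz]
    ring
  rw [h4, map_add, intPoly_C_mul, h0, h1] at hpos
  simp at hpos

/-- The differential equation differentiated `k` times. At `x = ±1` its leading term vanishes, so that
it gives each end point derivative from the preceding one. -/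
theorem iterate_derivative_jacobi_ode (a n k : ℕ) :
    (1 - X ^ 2) * derivative^[k + 2] (jacobi a 0 n) -
      (C (a : ℝ) + C (2 * k + a + 2 : ℝ) * X) * derivative^[k + 1] (jacobi a 0 n) +
      C ((n : ℝ) * (n + a + 1) - k * (k + a + 1)) * derivative^[k] (jacobi a 0 n) = 0 := by
  induction k with
  | zero =>
    have h := jacobi_ode a n
    rw [jacobiOp] at h
    simpa using h
  | succ k ih =>
    have h := congrArg derivative ih
    simp only [derivative_add, derivative_sub, derivative_mul, derivative_C, derivative_X,
      derivative_one, derivative_X_pow, ← Function.iterate_succ_apply' (⇑derivative),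
      Nat.succ_eq_add_one, derivative_zero] at h
    rw [← h]
    simp only [C_add, C_sub, C_mul, map_natCast, Nat.cast_add, Nat.cast_one, C_1,
      show (C 2 : ℝ[X]) = 2 from rfl]
    norm_num
    ring_nf

theorem jacobi_iterate_derivative_eval_one (a n k : ℕ) :
    (2 * k + 2 + 2 * a) * (derivative^[k + 1] (jacobi a 0 n)).eval 1 =
      (n * (n + a + 1) - k * (k + a + 1)) * (derivative^[k] (jacobi a 0 n)).eval 1 := by
  have h := congrArg (eval 1) (iterate_derivative_jacobi_ode a n k)
  simp only [eval_add, eval_sub, eval_mul, eval_C, eval_X, eval_pow, eval_one, eval_zero] at h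
  linear_combination -h

theorem jacobi_iterate_derivative_eval_neg_one (a n k : ℕ) :
    (2 * k + 2) * (derivative^[k + 1] (jacobi a 0 n)).eval (-1) =
      -((n * (n + a + 1) - k * (k + a + 1)) * (derivative^[k] (jacobi a 0 n)).eval (-1)) := by
  have h := congrArg (eval (-1)) (iterate_derivative_jacobi_ode a n k)
  simp only [eval_add, eval_sub, eval_mul, eval_C, eval_X, eval_pow, eval_one, eval_zero] at h
  linear_combination h

/-- Integrating the differential equation against `g` moves all derivatives to `g`. With a `g` whose
image under the adjoint operator is simple, this yields the moments of `P_n^{(a,0)}` without the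
weight. -/
theorem intPoly_jacobi_mul_adjoint (a n : ℕ) (g : ℝ[X]) :
    intPoly (jacobi a 0 n * (derivative (derivative ((1 - X ^ 2) * g)) +
      derivative ((C (a : ℝ) + C (a + 2 : ℝ) * X) * g) + C ((n : ℝ) * (n + a + 1)) * g)) =
      2 * a * (jacobi a 0 n).eval 1 * g.eval 1 := by
  set P := jacobi a 0 n
  have h := jacobi_ode a n
  rw [jacobiOp] at h
  have h1 := intPoly_derivative_mul (derivative P) ((1 - X ^ 2) * g)
  have h2 := intPoly_derivative_mul P (derivative ((1 - X ^ 2) * g))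
  have h3 := intPoly_derivative_mul P ((C (a : ℝ) + C (a + 2 : ℝ) * X) * g)
  have h4 : intPoly (derivative (derivative P) * ((1 - X ^ 2) * g)) -
      intPoly (derivative P * ((C (a : ℝ) + C (a + 2 : ℝ) * X) * g)) +
      intPoly (P * (C ((n : ℝ) * (n + a + 1)) * g)) = 0 := by
    rw [← map_sub, ← map_add, ← map_zero intPoly]
    congr 1
    linear_combination g * h
  rw [mul_add, mul_add, map_add, map_add]
  simp only [derivative_mul (g := g), eval_add, eval_mul, eval_sub, eval_pow, eval_X, eval_one,
    eval_C, derivative_sub, derivative_one, derivative_X_pow] at h1 h2 h3 h4 ⊢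
  norm_num at h1 h2 h3 h4 ⊢
  linarith

theorem intPoly_jacobi_one (n : ℕ) : intPoly (jacobi 1 0 n) = 2 / (n + 1) := by
  have h := intPoly_jacobi_mul_adjoint 1 n 1
  rw [jacobi_eval_one] at h
  have e : (derivative (derivative ((1 - X ^ 2) * 1)) +
      derivative ((C ((1 : ℕ) : ℝ) + C (((1 : ℕ) : ℝ) + 2) * X) * 1) +
      C ((n : ℝ) * (n + (1 : ℕ) + 1)) * 1 : ℝ[X]) = C ((n + 1 : ℝ) ^ 2) := by
    simp
    rw [show (C 2 : ℝ[X]) = 2 from rfl]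
    ring
  rw [e, mul_comm, intPoly_C_mul, Nat.choose_succ_self_right] at h
  have : (n + 1 : ℝ) ≠ 0 := by positivity
  field_simp
  simp at h
  have h5 : (n + 1 : ℝ) * ((n + 1) * intPoly (jacobi 1 0 n) - 2) = 0 := by linear_combination h
  linarith [(mul_eq_zero.1 h5).resolve_left this]

theorem choose_add_two (n : ℕ) : ((n + 2).choose n : ℝ) = (n + 1) * (n + 2) / 2 := by
  rw [Nat.choose_symm_add, Nat.cast_choose_two]
  push_cast
  ring

theorem intPoly_jacobi_two (n : ℕ) : intPoly (jacobi 2 0 n) = 2 := by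
  have h := intPoly_jacobi_mul_adjoint 2 n 1
  rw [jacobi_eval_one, choose_add_two] at h
  have e : (derivative (derivative ((1 - X ^ 2) * 1)) +
      derivative ((C ((2 : ℕ) : ℝ) + C (((2 : ℕ) : ℝ) + 2) * X) * 1) +
      C ((n : ℝ) * (n + (2 : ℕ) + 1)) * 1 : ℝ[X]) = C ((n + 1 : ℝ) * (n + 2)) := by
    simp
    rw [show (C 2 : ℝ[X]) = 2 from rfl]
    ring
  rw [e, mul_comm, intPoly_C_mul] at h
  have : (n + 1 : ℝ) * (n + 2) ≠ 0 := by positivity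
  simp at h
  have h5 : (n + 1 : ℝ) * (n + 2) * (intPoly (jacobi 2 0 n) - 2) = 0 := by linear_combination h
  linarith [(mul_eq_zero.1 h5).resolve_left this]

theorem intPoly_one_sub_X_mul_jacobi_two (n : ℕ) :
    intPoly ((1 - X) * jacobi 2 0 n) = 4 / ((n + 1) * (n + 2)) := by
  have h := intPoly_jacobi_mul_adjoint 2 n (1 - X)
  have e : (derivative (derivative ((1 - X ^ 2) * (1 - X))) +
      derivative ((C ((2 : ℕ) : ℝ) + C (((2 : ℕ) : ℝ) + 2) * X) * (1 - X)) +
      C ((n : ℝ) * (n + (2 : ℕ) + 1)) * (1 - X) : ℝ[X]) =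
      C ((n + 1 : ℝ) * (n + 2)) * (1 - X) - 2 := by
    simp
    rw [show (C 2 : ℝ[X]) = 2 from rfl]
    ring
  rw [e, show jacobi 2 0 n * (C ((n + 1 : ℝ) * (n + 2)) * (1 - X) - 2) =
    C ((n + 1 : ℝ) * (n + 2)) * ((1 - X) * jacobi 2 0 n) - C 2 * jacobi 2 0 n by
      rw [show (C 2 : ℝ[X]) = 2 from rfl]; ring, map_sub,
    intPoly_C_mul, intPoly_C_mul, intPoly_jacobi_two] at h
  have : (n + 1 : ℝ) * (n + 2) ≠ 0 := by positivity
  rw [eq_div_iff this]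
  simp at h
  linarith

/-! ### Integrals against derivatives of Jacobi polynomials -/

theorem natDegree_one_sub_X_mul_derivative_le {g : ℝ[X]} {n : ℕ} (hg : g.natDegree ≤ n) :
    ((1 - X) * derivative g).natDegree ≤ n := by
  rw [natDegree_le_iff_coeff_eq_zero] at hg ⊢
  intro k hk
  obtain ⟨l, rfl⟩ : ∃ l, k = l + 1 := ⟨k - 1, by omega⟩
  rw [sub_mul, one_mul, coeff_sub, coeff_X_mul, coeff_derivative, coeff_derivative,
    hg _ (by omega), hg _ (by omega)]
  ring

theorem coeff_one_sub_X_mul_derivative {g : ℝ[X]} {n : ℕ} (hg : g.natDegree ≤ n) :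
    ((1 - X) * derivative g).coeff n = -(n * g.coeff n) := by
  rw [natDegree_le_iff_coeff_eq_zero] at hg
  rw [sub_mul, one_mul, coeff_sub, coeff_derivative, hg _ (by omega)]
  rcases n with _ | l
  · simp
  · rw [coeff_X_mul, coeff_derivative]
    push_cast
    ring

/-- Integration by parts leaves a boundary term at `-1`, which is what the end point masses of the
quadrature functionals are there to compensate. -/
theorem intPoly_weight_mul_derivative_jacobi (a n : ℕ) {g : ℝ[X]} (hg : g.natDegree ≤ n) :
    intPoly ((1 - X) ^ (a + 1) * (derivative (jacobi a 0 n) * g)) =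
      -(2 ^ (a + 1) * (jacobi a 0 n).eval (-1) * g.eval (-1)) +
        (n + a + 1) * (g.coeff n * jacobiNorm a n) := by
  have h := intPoly_derivative_mul (jacobi a 0 n) ((1 - X) ^ (a + 1) * g)
  have h1 : jacobi a 0 n * derivative ((1 - X) ^ (a + 1) * g) =
      (1 - X) ^ a * (jacobi a 0 n * ((1 - X) * derivative g - C (a + 1 : ℝ) * g)) := by
    simp only [derivative_mul, derivative_pow, derivative_sub, derivative_one, derivative_X,
      Nat.add_sub_cancel, C_add, map_natCast, Nat.cast_add, Nat.cast_one, C_1]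
    ring
  have hd : ((1 - X) * derivative g - C (a + 1 : ℝ) * g).natDegree ≤ n :=
    (natDegree_sub_le _ _).trans (max_le (natDegree_one_sub_X_mul_derivative_le hg)
      ((natDegree_C_mul_le _ _).trans hg))
  rw [h1, intPoly_jacobi_mul a n hd, coeff_sub, coeff_C_mul,
    coeff_one_sub_X_mul_derivative hg] at h
  rw [show (1 - X) ^ (a + 1) * (derivative (jacobi a 0 n) * g) =
    derivative (jacobi a 0 n) * ((1 - X) ^ (a + 1) * g) by ring, h]
  simp only [eval_mul, eval_pow, eval_sub, eval_one, eval_X, sub_self, ne_eq, Nat.succ_ne_zero,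
    not_false_eq_true, zero_pow, zero_mul, mul_zero]
  norm_num
  ring

/-! ### Continuity class 0: the side polynomials -/

namespace C0

theorem natDegree_Q_le (n : ℕ) (α : ℝ) : (Q n α).natDegree ≤ n := by
  have hP := jacobi_natDegree_le 1 n
  rw [Q, mul_assoc]
  exact natDegree_add_le_of_degree_le ((natDegree_C_mul_le _ _).trans hP)
    ((natDegree_C_mul_le _ _).trans (natDegree_one_sub_X_mul_derivative_le hP))

theorem coeff_Q (n : ℕ) (α : ℝ) : (Q n α).coeff n = F n α * (jacobi 1 0 n).coeff n := by
  rw [Q, mul_assoc, coeff_add, coeff_C_mul, coeff_C_mul,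
    coeff_one_sub_X_mul_derivative (jacobi_natDegree_le 1 n)]
  ring

theorem eval_one_Q (n : ℕ) (α : ℝ) : (Q n α).eval 1 = Γ n α := by
  simp only [Q, eval_add, eval_mul, eval_C, eval_sub, eval_one, eval_X, sub_self, jacobi_eval_one,
    Nat.choose_succ_self_right, F, Γ]
  push_cast
  ring

theorem eval_neg_one_Q (n : ℕ) (α : ℝ) : (Q n α).eval (-1) = (jacobi 1 0 n).eval (-1) := by
  have h := jacobi_iterate_derivative_eval_neg_one 1 n 0
  simp only [Function.iterate_zero, Function.iterate_succ, Function.comp_apply, id_eq] at h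
  simp only [Q, eval_add, eval_mul, eval_C, eval_sub, eval_one, eval_X, F]
  push_cast at h
  linear_combination α * h

/-- `Q_n(α, ·)` is orthogonal for the weight `1 - x` times the Lebesgue measure with the additional
mass `2α` at `-1`. -/
theorem massFunctional_Q_mul (n : ℕ) (α : ℝ) {g : ℝ[X]} (hg : g.natDegree ≤ n) :
    massFunctional (2 * α) 0 0 0 ((1 - X) * (Q n α * g)) =
      g.coeff n * (F (n + 1) α * jacobiNorm 1 n) := by
  have h1 := intPoly_jacobi_mul 1 n hg
  have h2 := intPoly_weight_mul_derivative_jacobi 1 n hg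
  rw [massFunctional_apply, eval_mul, eval_mul, eval_neg_one_Q, show (1 - X) * (Q n α * g) =
    C (F n α + α * n) * ((1 - X) ^ 1 * (jacobi 1 0 n * g)) +
      C α * ((1 - X) ^ (1 + 1) * (derivative (jacobi 1 0 n) * g)) by rw [Q]; ring,
    map_add, intPoly_C_mul, intPoly_C_mul, h1, h2]
  simp only [eval_sub, eval_one, eval_X, F]
  push_cast
  ring

/-- Testing the formula with `Q_n` itself isolates the weight of the fixed node `1`. -/
theorem massFunctional_Q (n : ℕ) (α : ℝ) :
    massFunctional (2 * α) 0 0 0 (Q n α) = 2 * (1 + (n + 1) ^ 2 * α) / (n + 1) := by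
  have h := intPoly_derivative_mul (jacobi 1 0 n) (1 - X)
  simp only [derivative_sub, derivative_one, derivative_X, zero_sub, mul_neg, mul_one, map_neg,
    intPoly_jacobi_one, eval_sub, eval_one, eval_X] at h
  rw [massFunctional_apply, eval_neg_one_Q, show Q n α = C (F n α + α * n) * jacobi 1 0 n +
      C α * (derivative (jacobi 1 0 n) * (1 - X)) by rw [Q]; ring,
    map_add, intPoly_C_mul, intPoly_C_mul, h, intPoly_jacobi_one]
  have : (n + 1 : ℝ) ≠ 0 := by positivity
  simp only [F]
  field_simp
  ring

/-- The quadrature formula of a side interval: `Q_N` carries the mass `2α` at the left end over to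
the mass `2 λ α_new` at the right end. -/
theorem side_quadrature {N : ℕ} (hN : 1 ≤ N) {α : ℝ} (hΓ : Γ N α ≠ 0) (hF : F N α ≠ 0)
    (hroots : (Q N α).roots.toFinset.card = N) :
    (∀ x ∈ (Q N α).roots, weightQDen N α x ≠ 0) ∧
    ∀ f : ℝ[X], f.natDegree ≤ 2 * N →
      massFunctional (2 * α) 0 0 0 f =
        ∑ x ∈ (Q N α).roots.toFinset, weightQ N α x * f.eval x +
          2 * ((1 + (N + 1) ^ 2 * α) / ((N + 1) * Γ N α)) * f.eval 1 := by
  obtain ⟨j, rfl⟩ : ∃ j, N = j + 1 := ⟨N - 1, by omega⟩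
  have hk : (Q (j + 1) α).coeff (j + 1) * (F (j + 1) α * jacobiNorm 1 j) =
      2 * (2 * j + 3) / ((j + 1) * (j + 2)) * F (j + 1) α ^ 2 := by
    have := jacobi_coeff_mul_jacobiNorm 1 j
    rw [coeff_Q]
    push_cast at this ⊢
    linear_combination F (j + 1) α ^ 2 * this
  push_cast at hF
  have hc : (Q (j + 1) α).coeff (j + 1) * (F (j + 1) α * jacobiNorm 1 j) ≠ 0 := by
    rw [hk]
    have : (2 * (2 * j + 3) / ((j + 1) * (j + 2)) : ℝ) ≠ 0 := by positivity
    exact mul_ne_zero this (pow_ne_zero 2 hF)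
  obtain ⟨hne, hquad⟩ := radau_of_orthogonal (massFunctional (2 * α) 0 0 0)
    (natDegree_Q_le (j + 1) α) hroots
    (fun g hg => by
      rw [massFunctional_Q_mul _ _ (hg.trans j.le_succ),
        coeff_eq_zero_of_natDegree_lt (by omega), zero_mul])
    (natDegree_Q_le j α) (fun g hg => massFunctional_Q_mul j α hg) hc
    (by rwa [eval_one_Q])
  have hden : ∀ x, weightQDen (j + 1) α x = (j + 1) * (j + 2) *
      ((derivative (Q (j + 1) α)).eval x * (Q j α).eval x * (1 - x)) := by
    intro x
    simp only [weightQDen, Nat.add_sub_cancel]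
    push_cast
    ring
  have hj : ((j + 1) * (j + 2) : ℝ) ≠ 0 := by positivity
  refine ⟨fun x hx => ?_, fun f hf => ?_⟩
  · rw [hden]
    exact mul_ne_zero hj (hne x hx)
  · rw [hquad f hf, massFunctional_Q, eval_one_Q]
    congr 1
    · refine Finset.sum_congr rfl fun x hx => ?_
      have := hne x (Multiset.mem_toFinset.1 hx)
      rw [hk, weightQ, hden]
      push_cast
      field_simp
      ring
    · have : ((j : ℝ) + 1 + 1) ≠ 0 := by positivity
      push_cast at hΓ ⊢
      field_simp

end C0

/-! ### Integrals against Legendre polynomials -/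

section Legendre

variable {n : ℕ} {g : ℝ[X]}

theorem natDegree_X_mul_derivative_le (hg : g.natDegree ≤ n) :
    (X * derivative g).natDegree ≤ n := by
  rw [natDegree_le_iff_coeff_eq_zero] at hg ⊢
  intro k hk
  obtain ⟨l, rfl⟩ : ∃ l, k = l + 1 := ⟨k - 1, by omega⟩
  rw [coeff_X_mul, coeff_derivative, hg _ (by omega), zero_mul]

theorem coeff_X_mul_derivative : (X * derivative g).coeff n = n * g.coeff n := by
  rcases n with _ | l
  · simp
  · rw [coeff_X_mul, coeff_derivative]
    push_cast
    ring

theorem coeff_derivative_eq_zero (hg : g.natDegree ≤ n) : (derivative g).coeff n = 0 := by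
  rw [coeff_derivative, coeff_eq_zero_of_natDegree_lt (by omega), zero_mul]

theorem natDegree_derivative_le_of_le (hg : g.natDegree ≤ n) : (derivative g).natDegree ≤ n :=
  (natDegree_derivative_le g).trans (by omega)

theorem legendre_eval_one : (jacobi 0 0 n).eval 1 = 1 := by
  simp [jacobi_eval_one]

theorem intPoly_legendre_mul (hg : g.natDegree ≤ n) :
    intPoly (jacobi 0 0 n * g) = g.coeff n * jacobiNorm 0 n := by
  simpa using intPoly_jacobi_mul 0 n hg

theorem intPoly_derivative_legendre_mul (hg : g.natDegree ≤ n) :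
    intPoly (derivative (jacobi 0 0 n) * g) =
      g.eval 1 - (jacobi 0 0 n).eval (-1) * g.eval (-1) := by
  rw [intPoly_derivative_mul, intPoly_legendre_mul (natDegree_derivative_le_of_le hg),
    coeff_derivative_eq_zero hg, legendre_eval_one]
  ring

theorem intPoly_X_mul_derivative_legendre_mul (hg : g.natDegree ≤ n) :
    intPoly (X * derivative (jacobi 0 0 n) * g) =
      g.eval 1 + (jacobi 0 0 n).eval (-1) * g.eval (-1) -
        (n + 1) * (g.coeff n * jacobiNorm 0 n) := by
  have h := intPoly_derivative_mul (jacobi 0 0 n) (X * g)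
  rw [derivative_mul, derivative_X, one_mul, intPoly_legendre_mul
    ((natDegree_add_le _ _).trans (max_le hg (natDegree_X_mul_derivative_le hg))), coeff_add,
    coeff_X_mul_derivative, legendre_eval_one] at h
  rw [show X * derivative (jacobi 0 0 n) * g = derivative (jacobi 0 0 n) * (X * g) by ring, h]
  simp only [eval_mul, eval_X]
  ring

theorem intPoly_derivative_two_legendre_mul (hg : g.natDegree ≤ n) :
    intPoly (derivative (derivative (jacobi 0 0 n)) * g) =
      (derivative (jacobi 0 0 n)).eval 1 * g.eval 1 -
        (derivative (jacobi 0 0 n)).eval (-1) * g.eval (-1) -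
        (derivative g).eval 1 + (jacobi 0 0 n).eval (-1) * (derivative g).eval (-1) := by
  rw [intPoly_derivative_mul, intPoly_derivative_legendre_mul (natDegree_derivative_le_of_le hg)]
  ring

theorem intPoly_X_mul_derivative_two_legendre_mul (hg : g.natDegree ≤ n) :
    intPoly (X * derivative (derivative (jacobi 0 0 n)) * g) =
      (derivative (jacobi 0 0 n)).eval 1 * g.eval 1 +
        (derivative (jacobi 0 0 n)).eval (-1) * g.eval (-1) -
        (g.eval 1 - (jacobi 0 0 n).eval (-1) * g.eval (-1)) -
        ((derivative g).eval 1 + (jacobi 0 0 n).eval (-1) * (derivative g).eval (-1)) := by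
  have h := intPoly_derivative_mul (derivative (jacobi 0 0 n)) (X * g)
  rw [derivative_mul, derivative_X, one_mul, mul_add, map_add,
    intPoly_derivative_legendre_mul hg,
    show derivative (jacobi 0 0 n) * (X * derivative g) =
      X * derivative (jacobi 0 0 n) * derivative g by ring,
    intPoly_X_mul_derivative_legendre_mul (natDegree_derivative_le_of_le hg),
    coeff_derivative_eq_zero hg] at h
  rw [show X * derivative (derivative (jacobi 0 0 n)) * g =
    derivative (derivative (jacobi 0 0 n)) * (X * g) by ring, h]
  simp only [eval_mul, eval_X]
  ring

theorem legendre_derivative_eval_one :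
    (derivative (jacobi 0 0 n)).eval 1 = n * (n + 1) / 2 := by
  have h := jacobi_iterate_derivative_eval_one 0 n 0
  simp only [Function.iterate_zero, Function.iterate_succ, Function.comp_apply, id_eq,
    legendre_eval_one] at h
  push_cast at h
  linarith

theorem legendre_derivative_eval_neg_one :
    (derivative (jacobi 0 0 n)).eval (-1) = -(n * (n + 1) / 2 * (jacobi 0 0 n).eval (-1)) := by
  have h := jacobi_iterate_derivative_eval_neg_one 0 n 0
  simp only [Function.iterate_zero, Function.iterate_succ, Function.comp_apply, id_eq] at h
  push_cast at h
  linarith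

theorem legendre_derivative_two_eval_one :
    (derivative (derivative (jacobi 0 0 n))).eval 1 =
      (n * (n + 1) - 2) * (n * (n + 1)) / 8 := by
  have h := jacobi_iterate_derivative_eval_one 0 n 1
  simp only [Function.iterate_zero, Function.iterate_succ, Function.comp_apply, id_eq,
    legendre_derivative_eval_one] at h
  push_cast at h
  linarith

theorem legendre_derivative_two_eval_neg_one :
    (derivative (derivative (jacobi 0 0 n))).eval (-1) =
      (n * (n + 1) - 2) * (n * (n + 1)) / 8 * (jacobi 0 0 n).eval (-1) := by
  have h := jacobi_iterate_derivative_eval_neg_one 0 n 1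
  simp only [Function.iterate_zero, Function.iterate_succ, Function.comp_apply, id_eq,
    legendre_derivative_eval_neg_one] at h
  push_cast at h
  linarith

theorem legendre_derivative_three_eval_one :
    (derivative (derivative (derivative (jacobi 0 0 n)))).eval 1 =
      (n * (n + 1) - 6) * (n * (n + 1) - 2) * (n * (n + 1)) / 48 := by
  have h := jacobi_iterate_derivative_eval_one 0 n 2
  simp only [Function.iterate_zero, Function.iterate_succ, Function.comp_apply, id_eq,
    legendre_derivative_two_eval_one] at h
  push_cast at h
  linarith

theorem legendre_derivative_three_eval_neg_one :
    (derivative (derivative (derivative (jacobi 0 0 n)))).eval (-1) =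
      -((n * (n + 1) - 6) * (n * (n + 1) - 2) * (n * (n + 1)) / 48 *
        (jacobi 0 0 n).eval (-1)) := by
  have h := jacobi_iterate_derivative_eval_neg_one 0 n 2
  simp only [Function.iterate_zero, Function.iterate_succ, Function.comp_apply, id_eq,
    legendre_derivative_two_eval_neg_one] at h
  push_cast at h
  linarith

end Legendre

/-! ### Continuity class 0: the middle polynomial -/

namespace C0

theorem M_eq (n : ℕ) (αL αR : ℝ) :
    M n αL αR = C (H n αL αR + n * H₁ n αL αR) * jacobi 0 0 n +
      C (αL * H₂ n αR - αR * H₂ n αL) * derivative (jacobi 0 0 n) +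
      C (-(αL * H₂ n αR + αR * H₂ n αL)) * (X * derivative (jacobi 0 0 n)) := by
  rw [M]
  simp only [C_add, C_sub, C_neg]
  ring

theorem natDegree_M_le (n : ℕ) (αL αR : ℝ) : (M n αL αR).natDegree ≤ n := by
  have hP := jacobi_natDegree_le 0 n
  rw [M_eq]
  exact natDegree_add_le_of_degree_le (natDegree_add_le_of_degree_le
    ((natDegree_C_mul_le _ _).trans hP)
    ((natDegree_C_mul_le _ _).trans (natDegree_derivative_le_of_le hP)))
    ((natDegree_C_mul_le _ _).trans (natDegree_X_mul_derivative_le hP))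

theorem coeff_M (n : ℕ) (αL αR : ℝ) :
    (M n αL αR).coeff n = H n αL αR * (jacobi 0 0 n).coeff n := by
  rw [M_eq]
  simp only [coeff_add, coeff_C_mul, coeff_X_mul_derivative,
    coeff_derivative_eq_zero (jacobi_natDegree_le 0 n), H, H₁, H₂]
  ring

/-- `M_n` is orthogonal for the Lebesgue measure with additional masses `2αL` and `2αR` at the two
end points. -/
theorem massFunctional_M_mul (n : ℕ) (αL αR : ℝ) {g : ℝ[X]} (hg : g.natDegree ≤ n) :
    massFunctional (2 * αL) 0 (2 * αR) 0 (M n αL αR * g) =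
      g.coeff n * (H (n + 1) αL αR * jacobiNorm 0 n) := by
  have h1 := intPoly_legendre_mul hg
  have h2 := intPoly_derivative_legendre_mul hg
  have h3 := intPoly_X_mul_derivative_legendre_mul hg
  have e : M n αL αR * g = C (H n αL αR + n * H₁ n αL αR) * (jacobi 0 0 n * g) +
      C (αL * H₂ n αR - αR * H₂ n αL) * (derivative (jacobi 0 0 n) * g) +
      C (-(αL * H₂ n αR + αR * H₂ n αL)) * (X * derivative (jacobi 0 0 n) * g) := by
    rw [M_eq]; ring
  rw [massFunctional_apply, eval_mul, eval_mul, e, map_add, map_add, intPoly_C_mul, intPoly_C_mul,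
    intPoly_C_mul, h1, h2, h3, M_eq]
  simp only [eval_add, eval_mul, eval_C, eval_X, legendre_eval_one, legendre_derivative_eval_one,
    legendre_derivative_eval_neg_one, H, H₁, H₂]
  ring

theorem natDegree_Mω_le (ω : ℝ) (j : ℕ) (αL αR : ℝ) : (Mω ω (j + 1) αL αR).natDegree ≤ j + 1 :=
  natDegree_add_le_of_degree_le (natDegree_M_le _ _ _)
    ((natDegree_C_mul_le _ _).trans ((natDegree_M_le _ _ _).trans (by omega)))

theorem coeff_Mω (ω : ℝ) (j : ℕ) (αL αR : ℝ) :
    (Mω ω (j + 1) αL αR).coeff (j + 1) =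
      H (j + 1) αL αR * (jacobi 0 0 (j + 1)).coeff (j + 1) := by
  have : (M j αL αR).coeff (j + 1) = 0 :=
    coeff_eq_zero_of_natDegree_lt (Nat.lt_succ_of_le (natDegree_M_le _ _ _))
  rw [Mω, Nat.add_sub_cancel, coeff_add, coeff_C_mul, coeff_M, this]
  push_cast
  ring

theorem massFunctional_Mω_mul (ω : ℝ) (j : ℕ) (αL αR : ℝ) {g : ℝ[X]} (hg : g.natDegree ≤ j) :
    massFunctional (2 * αL) 0 (2 * αR) 0 (Mω ω (j + 1) αL αR * g) =
      ω * (g.coeff j * (H (j + 1) αL αR * jacobiNorm 0 j)) := by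
  rw [Mω, Nat.add_sub_cancel, add_mul, mul_assoc, ← smul_eq_C_mul, map_add, map_smul,
    massFunctional_M_mul _ _ _ (hg.trans j.le_succ), massFunctional_M_mul _ _ _ hg,
    coeff_eq_zero_of_natDegree_lt (Nat.lt_succ_of_le hg), smul_eq_mul]
  ring

/-- The quadrature formula of the middle interval. -/
theorem mid_quadrature (j : ℕ) {ω αL αR : ℝ} (hH : H (j + 1) αL αR ≠ 0)
    (hroots : (Mω ω (j + 1) αL αR).roots.toFinset.card = j + 1) :
    (∀ x ∈ (Mω ω (j + 1) αL αR).roots, weightMDen ω (j + 1) αL αR x ≠ 0) ∧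
    ∀ f : ℝ[X], f.natDegree ≤ 2 * j →
      massFunctional (2 * αL) 0 (2 * αR) 0 f =
        ∑ x ∈ (Mω ω (j + 1) αL αR).roots.toFinset, weightM ω (j + 1) αL αR x * f.eval x := by
  have hk : (Mω ω (j + 1) αL αR).coeff (j + 1) * (H (j + 1) αL αR * jacobiNorm 0 j) =
      2 / (j + 1) * H (j + 1) αL αR ^ 2 := by
    have h1 := jacobi_coeff_mul_jacobiNorm 0 j
    have h2 : (2 ^ 0 * (2 * j + 2 + (0 : ℕ)) / ((j + 1) * (j + 1 + (0 : ℕ))) : ℝ) =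
        2 / (j + 1) := by
      have : (j + 1 : ℝ) ≠ 0 := by positivity
      push_cast
      field_simp
      ring
    rw [h2] at h1
    rw [coeff_Mω]
    linear_combination H (j + 1) αL αR ^ 2 * h1
  have hc : (Mω ω (j + 1) αL αR).coeff (j + 1) * (H (j + 1) αL αR * jacobiNorm 0 j) ≠ 0 := by
    rw [hk]
    have : (2 / (j + 1) : ℝ) ≠ 0 := by positivity
    exact mul_ne_zero this (pow_ne_zero 2 hH)
  obtain ⟨hne, hquad⟩ := gauss_of_orthogonal (d := j) (massFunctional (2 * αL) 0 (2 * αR) 0)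
    (natDegree_Mω_le ω j αL αR) hroots le_rfl
    (fun g hg => by
      rw [degree_lt_iff_coeff_zero] at hg
      rw [massFunctional_Mω_mul _ _ _ _ (natDegree_le_iff_coeff_eq_zero.2 fun N hN => hg N hN.le),
        hg j le_rfl]
      ring)
    (natDegree_M_le j αL αR) (fun g hg => massFunctional_M_mul j αL αR hg) hc
  have hden : ∀ x, weightMDen ω (j + 1) αL αR x = (j + 1) *
      ((derivative (Mω ω (j + 1) αL αR)).eval x * (M j αL αR).eval x) := by
    intro x
    simp only [weightMDen, Nat.add_sub_cancel]
    push_cast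
    ring
  have hj : (j + 1 : ℝ) ≠ 0 := by positivity
  refine ⟨fun x hx => ?_, fun f hf => ?_⟩
  · rw [hden]
    exact mul_ne_zero hj (hne x hx)
  · rw [hquad f ((degree_le_of_natDegree_le hf).trans_lt (by
      exact_mod_cast (by omega : 2 * j < j + 1 + j)))]
    refine Finset.sum_congr rfl fun x hx => ?_
    have := hne x (Multiset.mem_toFinset.1 hx)
    rw [hk, weightM, hden]
    push_cast
    field_simp

end C0

/-! ### Continuity class 1: the side polynomials -/

namespace C1

section EndPoints

variable (n : ℕ)

theorem jacobi_two_derivative_eval_one :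
    (derivative (jacobi 2 0 n)).eval 1 = n * (n + 3) * ((n + 1) * (n + 2)) / 12 := by
  have h := jacobi_iterate_derivative_eval_one 2 n 0
  simp only [Function.iterate_zero, Function.iterate_succ, Function.comp_apply, id_eq,
    jacobi_eval_one, choose_add_two] at h
  push_cast at h
  linarith

theorem jacobi_two_derivative_two_eval_one :
    (derivative (derivative (jacobi 2 0 n))).eval 1 =
      (n * (n + 3) - 4) * (n * (n + 3) * ((n + 1) * (n + 2))) / 96 := by
  have h := jacobi_iterate_derivative_eval_one 2 n 1
  simp only [Function.iterate_zero, Function.iterate_succ, Function.comp_apply, id_eq,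
    jacobi_two_derivative_eval_one] at h
  push_cast at h
  linarith

theorem jacobi_two_derivative_eval_neg_one :
    (derivative (jacobi 2 0 n)).eval (-1) =
      -(n * (n + 3) / 2 * (jacobi 2 0 n).eval (-1)) := by
  have h := jacobi_iterate_derivative_eval_neg_one 2 n 0
  simp only [Function.iterate_zero, Function.iterate_succ, Function.comp_apply, id_eq] at h
  push_cast at h
  linarith

theorem jacobi_two_derivative_two_eval_neg_one :
    (derivative (derivative (jacobi 2 0 n))).eval (-1) =
      (n * (n + 3) - 4) * (n * (n + 3)) / 8 * (jacobi 2 0 n).eval (-1) := by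
  have h := jacobi_iterate_derivative_eval_neg_one 2 n 1
  simp only [Function.iterate_zero, Function.iterate_succ, Function.comp_apply, id_eq,
    jacobi_two_derivative_eval_neg_one] at h
  push_cast at h
  linarith

theorem jacobi_two_derivative_three_eval_neg_one :
    (derivative (derivative (derivative (jacobi 2 0 n)))).eval (-1) =
      -((n * (n + 3) - 10) * (n * (n + 3) - 4) * (n * (n + 3)) / 48 *
        (jacobi 2 0 n).eval (-1)) := by
  have h := jacobi_iterate_derivative_eval_neg_one 2 n 2
  simp only [Function.iterate_zero, Function.iterate_succ, Function.comp_apply, id_eq,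
    jacobi_two_derivative_two_eval_neg_one] at h
  push_cast at h
  linarith

end EndPoints

variable (n : ℕ) (α β : ℝ)

theorem Q_eq : Q n α β = C (F n α β + n * F₁ n α β) * jacobi 2 0 n +
    C (F₁ n α β) * ((1 - X) * derivative (jacobi 2 0 n)) +
    C (12 * F₂ n β) * ((1 - X) * derivative (derivative (jacobi 2 0 n)) -
      C 3 * derivative (jacobi 2 0 n)) := by
  rw [Q, show (36 : ℝ) * F₂ n β = 12 * F₂ n β * 3 by ring, C_mul (b := (3 : ℝ))]
  ring

theorem natDegree_Q_le : (Q n α β).natDegree ≤ n := by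
  have hP := jacobi_natDegree_le 2 n
  have hP' := natDegree_derivative_le_of_le hP
  rw [Q_eq]
  exact natDegree_add_le_of_degree_le (natDegree_add_le_of_degree_le
    ((natDegree_C_mul_le _ _).trans hP)
    ((natDegree_C_mul_le _ _).trans (natDegree_one_sub_X_mul_derivative_le hP)))
    ((natDegree_C_mul_le _ _).trans ((natDegree_sub_le _ _).trans
      (max_le (natDegree_one_sub_X_mul_derivative_le hP') ((natDegree_C_mul_le _ _).trans hP'))))

theorem coeff_Q : (Q n α β).coeff n = F n α β * (jacobi 2 0 n).coeff n := by
  have hP := jacobi_natDegree_le 2 n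
  rw [Q_eq]
  simp only [coeff_add, coeff_sub, coeff_C_mul, coeff_one_sub_X_mul_derivative hP,
    coeff_one_sub_X_mul_derivative (natDegree_derivative_le_of_le hP),
    coeff_derivative_eq_zero hP]
  ring

theorem eval_one_Q : (Q n α β).eval 1 = Γ n α β := by
  rw [Q_eq]
  simp only [eval_add, eval_sub, eval_mul, eval_C, eval_one, eval_X, jacobi_eval_one,
    choose_add_two, jacobi_two_derivative_eval_one, F, F₁, F₂, Γ]
  ring

/-- The combination `(1 - x) P'' - 3 P'` of derivatives is, up to the weight, a derivative: it is
`((1 - x)^3 P')' / (1 - x)^2`. Two integrations by parts leave only boundary terms at `-1`. -/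
theorem intPoly_weight_mul_combination {n : ℕ} {g : ℝ[X]} (hg : g.natDegree ≤ n) :
    intPoly ((1 - X) ^ 2 * (((1 - X) * derivative (derivative (jacobi 2 0 n)) -
      C 3 * derivative (jacobi 2 0 n)) * g)) =
      -(8 * (derivative (jacobi 2 0 n)).eval (-1) * g.eval (-1)) +
        8 * (jacobi 2 0 n).eval (-1) * (derivative g).eval (-1) := by
  have h := intPoly_derivative_mul (derivative (jacobi 2 0 n)) ((1 - X) ^ 3 * g)
  have h2 := intPoly_weight_mul_derivative_jacobi 2 n (natDegree_derivative_le_of_le hg)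
  rw [coeff_derivative_eq_zero hg] at h2
  have e1 : derivative (jacobi 2 0 n) * derivative ((1 - X) ^ 3 * g) =
      (1 - X) ^ (2 + 1) * (derivative (jacobi 2 0 n) * derivative g) -
        C 3 * ((1 - X) ^ 2 * (derivative (jacobi 2 0 n) * g)) := by
    simp only [derivative_mul, derivative_pow, derivative_sub, derivative_one, derivative_X]
    norm_num
    rw [show (C 3 : ℝ[X]) = 3 from rfl]
    ring
  have e2 : (1 - X) ^ 2 * (((1 - X) * derivative (derivative (jacobi 2 0 n)) -
      C 3 * derivative (jacobi 2 0 n)) * g) =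
      derivative (derivative (jacobi 2 0 n)) * ((1 - X) ^ 3 * g) -
        C 3 * ((1 - X) ^ 2 * (derivative (jacobi 2 0 n) * g)) := by ring
  rw [e1, map_sub, h2] at h
  rw [e2, map_sub, h]
  simp only [eval_mul, eval_pow, eval_sub, eval_one, eval_X]
  ring

/-- `Q_n(α, β, ·)` is orthogonal for the weight `(1 - x) ^ 2` times the Lebesgue measure with the
additional terms `2α f(-1) - 24β f'(-1)`. -/
theorem massFunctional_Q_mul {g : ℝ[X]} (hg : g.natDegree ≤ n) :
    massFunctional (2 * α) (-24 * β) 0 0 ((1 - X) ^ 2 * (Q n α β * g)) =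
      g.coeff n * (F (n + 1) α β * jacobiNorm 2 n) := by
  have h1 := intPoly_jacobi_mul 2 n hg
  have h2 := intPoly_weight_mul_derivative_jacobi 2 n hg
  have h3 := intPoly_weight_mul_combination hg
  have e : (1 - X) ^ 2 * (Q n α β * g) =
      C (F n α β + n * F₁ n α β) * ((1 - X) ^ 2 * (jacobi 2 0 n * g)) +
      C (F₁ n α β) * ((1 - X) ^ (2 + 1) * (derivative (jacobi 2 0 n) * g)) +
      C (12 * F₂ n β) * ((1 - X) ^ 2 * (((1 - X) * derivative (derivative (jacobi 2 0 n)) -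
        C 3 * derivative (jacobi 2 0 n)) * g)) := by
    rw [Q_eq]; ring
  have ed : (derivative ((1 - X) ^ 2 * (Q n α β * g))).eval (-1) =
      4 * ((derivative (Q n α β)).eval (-1) * g.eval (-1) +
        (Q n α β).eval (-1) * (derivative g).eval (-1)) -
        4 * ((Q n α β).eval (-1) * g.eval (-1)) := by
    simp only [derivative_mul, derivative_pow, derivative_sub, derivative_one, derivative_X,
      eval_add, eval_mul, eval_pow, eval_sub, eval_one, eval_X, eval_C, eval_zero]
    norm_num
    ring
  rw [massFunctional_apply, ed, e, map_add, map_add, intPoly_C_mul, intPoly_C_mul, intPoly_C_mul,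
    h1, h2, h3, ← e, Q_eq]
  simp only [derivative_add, derivative_sub, derivative_mul, derivative_C, derivative_one,
    derivative_X, eval_add, eval_sub, eval_mul, eval_C, eval_one, eval_X, eval_pow, eval_zero,
    jacobi_two_derivative_eval_neg_one, jacobi_two_derivative_two_eval_neg_one,
    jacobi_two_derivative_three_eval_neg_one, F, F₁, F₂]
  push_cast
  ring

section Integrals

theorem intPoly_derivative_jacobi_two : intPoly (derivative (jacobi 2 0 n)) =
    (n + 1) * (n + 2) / 2 - (jacobi 2 0 n).eval (-1) := by
  rw [intPoly_derivative, jacobi_eval_one, choose_add_two]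

theorem intPoly_one_sub_X_mul_derivative_jacobi_two :
    intPoly ((1 - X) * derivative (jacobi 2 0 n)) = 2 - 2 * (jacobi 2 0 n).eval (-1) := by
  have h := intPoly_derivative_mul (jacobi 2 0 n) (1 - X)
  simp only [derivative_sub, derivative_one, derivative_X, zero_sub, mul_neg, mul_one, map_neg,
    intPoly_jacobi_two, eval_sub, eval_one, eval_X] at h
  rw [mul_comm, h]
  ring

theorem intPoly_one_sub_X_sq_mul_derivative_jacobi_two :
    intPoly ((1 - X) ^ 2 * derivative (jacobi 2 0 n)) =
      8 / ((n + 1) * (n + 2)) - 4 * (jacobi 2 0 n).eval (-1) := by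
  have h := intPoly_derivative_mul (jacobi 2 0 n) ((1 - X) ^ 2)
  have e : jacobi 2 0 n * derivative ((1 - X) ^ 2) = C (-2) * ((1 - X) * jacobi 2 0 n) := by
    simp only [derivative_pow, derivative_sub, derivative_one, derivative_X]
    norm_num
    ring
  rw [e, intPoly_C_mul, intPoly_one_sub_X_mul_jacobi_two] at h
  simp only [eval_sub, eval_one, eval_X, eval_pow] at h
  rw [mul_comm, h]
  ring

theorem intPoly_one_sub_X_mul_derivative_two_jacobi_two :
    intPoly ((1 - X) * derivative (derivative (jacobi 2 0 n))) =
      (n + 1) * (n + 2) / 2 - (jacobi 2 0 n).eval (-1) -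
        2 * (derivative (jacobi 2 0 n)).eval (-1) := by
  have h := intPoly_derivative_mul (derivative (jacobi 2 0 n)) (1 - X)
  simp only [derivative_sub, derivative_one, derivative_X, zero_sub, mul_neg, mul_one, map_neg,
    intPoly_derivative_jacobi_two, eval_sub, eval_one, eval_X] at h
  rw [mul_comm, h]
  ring

theorem intPoly_one_sub_X_sq_mul_derivative_two_jacobi_two :
    intPoly ((1 - X) ^ 2 * derivative (derivative (jacobi 2 0 n))) =
      4 - 4 * (jacobi 2 0 n).eval (-1) - 4 * (derivative (jacobi 2 0 n)).eval (-1) := by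
  have h := intPoly_derivative_mul (derivative (jacobi 2 0 n)) ((1 - X) ^ 2)
  have e : derivative (jacobi 2 0 n) * derivative ((1 - X) ^ 2) =
      C (-2) * ((1 - X) * derivative (jacobi 2 0 n)) := by
    simp only [derivative_pow, derivative_sub, derivative_one, derivative_X]
    norm_num
    ring
  rw [e, intPoly_C_mul, intPoly_one_sub_X_mul_derivative_jacobi_two] at h
  simp only [eval_sub, eval_one, eval_X, eval_pow] at h
  rw [mul_comm, h]
  ring

end Integrals

theorem massFunctional_Q : massFunctional (2 * α) (-24 * β) 0 0 (Q n α β) =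
    2 * (F n α β + (n + 1) * F₁ n α β) - 12 * ((n + 1) * (n + 2)) * F₂ n β := by
  rw [massFunctional_apply, Q_eq]
  simp only [LinearMap.map_add, LinearMap.map_sub, intPoly_C_mul, intPoly_jacobi_two,
    intPoly_one_sub_X_mul_derivative_jacobi_two, intPoly_derivative_jacobi_two,
    intPoly_one_sub_X_mul_derivative_two_jacobi_two,
    derivative_mul, derivative_C, derivative_one,
    derivative_X, eval_add, eval_sub, eval_mul, eval_C, eval_one, eval_X, eval_zero,
    jacobi_two_derivative_eval_neg_one, jacobi_two_derivative_two_eval_neg_one,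
    jacobi_two_derivative_three_eval_neg_one, F, F₁, F₂]
  ring

theorem massFunctional_one_sub_X_mul_Q :
    massFunctional (2 * α) (-24 * β) 0 0 ((1 - X) * Q n α β) =
      4 / ((n + 1) * (n + 2)) * (F n α β + (n + 2) * F₁ n α β) - 24 * F₂ n β := by
  have e : (1 - X) * Q n α β =
      C (F n α β + n * F₁ n α β) * ((1 - X) * jacobi 2 0 n) +
      C (F₁ n α β) * ((1 - X) ^ 2 * derivative (jacobi 2 0 n)) +
      C (12 * F₂ n β) * ((1 - X) ^ 2 * derivative (derivative (jacobi 2 0 n)) -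
        C 3 * ((1 - X) * derivative (jacobi 2 0 n))) := by
    rw [Q_eq]; ring
  have ed : (derivative ((1 - X) * Q n α β)).eval (-1) =
      2 * (derivative (Q n α β)).eval (-1) - (Q n α β).eval (-1) := by
    simp only [derivative_mul, derivative_sub, derivative_one, derivative_X, eval_add, eval_mul,
      eval_sub, eval_one, eval_X, eval_zero]
    ring
  rw [massFunctional_apply, ed, e, ← e, eval_mul, e, Q_eq]
  simp only [LinearMap.map_add, LinearMap.map_sub, intPoly_C_mul, intPoly_one_sub_X_mul_jacobi_two,
    intPoly_one_sub_X_mul_derivative_jacobi_two, intPoly_one_sub_X_sq_mul_derivative_jacobi_two,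
    intPoly_one_sub_X_sq_mul_derivative_two_jacobi_two,
    derivative_mul, derivative_C, derivative_one,
    derivative_X, eval_add, eval_sub, eval_mul, eval_C, eval_one, eval_X, eval_zero,
    jacobi_two_derivative_eval_neg_one, jacobi_two_derivative_two_eval_neg_one,
    jacobi_two_derivative_three_eval_neg_one, F, F₁, F₂]
  ring

theorem derivative_eval_one_Q : (derivative (Q n α β)).eval 1 =
    (n * (n + 3) * ((n + 1) * (n + 2)) / 12) *
      (F n α β + (n - 1) * F₁ n α β - 6 * (n * (n + 3) - 4) * F₂ n β) := by
  rw [Q_eq]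
  simp only [derivative_add, derivative_sub, derivative_mul, derivative_C, derivative_one,
    derivative_X, eval_add, eval_sub, eval_mul, eval_C, eval_one, eval_X, eval_zero,
    jacobi_two_derivative_eval_one, jacobi_two_derivative_two_eval_one]
  ring

/-- The weight of the derivative at `1`, as the recursion gives it, is the one found by testing with
`(1 - X) Q_n`; here `Γ` is the value of `Q_n` at `1`. -/
theorem stepβ_mul_Γ {n α β : ℝ} (h1 : n + 1 ≠ 0) (h2 : n + 2 ≠ 0) (hΓ : Γ n α β ≠ 0) :
    24 * (stepβ n α β * Γ n α β) =
      4 / ((n + 1) * (n + 2)) * (F n α β + (n + 2) * F₁ n α β) - 24 * F₂ n β := by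
  have e : stepβ n α β * Γ n α β = β * Γ n α β + E n α β * G n β / (6 * (n + 1) * (n + 2)) := by
    rw [stepβ]
    field_simp
  rw [e, E, G, Γ, F, F₁, F₂]
  field_simp
  ring

/-- The weight of the value at `1`, as the recursion gives it, is the one found by testing with `Q_n`;
the long factor of `stepβ` is the derivative of `Q_n` at `1`. -/
theorem stepα_mul_Γ {n α β : ℝ} (h1 : n + 1 ≠ 0) (h2 : n + 2 ≠ 0) (hΓ : Γ n α β ≠ 0) :
    2 * (stepα n α β * Γ n α β) - 24 * (stepβ n α β * ((n * (n + 3) * ((n + 1) * (n + 2)) / 12) *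
      (F n α β + (n - 1) * F₁ n α β - 6 * (n * (n + 3) - 4) * F₂ n β))) =
      2 * (F n α β + (n + 1) * F₁ n α β) - 12 * ((n + 1) * (n + 2)) * F₂ n β := by
  have hb : 24 * (stepβ n α β * Γ n α β) = 24 * (β * Γ n α β) +
      4 * E n α β * G n β / ((n + 1) * (n + 2)) := by
    rw [stepβ]
    field_simp
    ring
  refine mul_right_cancel₀ hΓ ?_
  have e1 : stepα n α β * Γ n α β ^ 2 = -α * Γ n α β ^ 2 + E n α β * (8 * n ^ 2 + 24 * n + 12 +
    n * (n + 3) * ((11 * n ^ 2 + 33 * n + 16) * α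
    + 12 * (4 * n ^ 4 + 24 * n ^ 3 + 34 * n ^ 2 - 6 * n - 8) * β
    + 3 * n * (n + 1) * (n + 2) * (n + 3) *
      (-4 * (n + 1) * (n + 2) * (2 * n ^ 2 + 6 * n - 5) * β ^ 2
        - 3 * (n - 1) * n * (n + 1) * (n + 2) * (n + 3) * (n + 4) * α * β ^ 2
        + 2 * (3 * n ^ 2 + 9 * n - 6) * α * β + α ^ 2))) / 12 := by
    rw [stepα]
    field_simp
  have e2 : 24 * (stepβ n α β * Γ n α β) * ((n * (n + 3) * ((n + 1) * (n + 2)) / 12)) =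
      n * (n + 3) * (2 * ((n + 1) * (n + 2)) * (β * Γ n α β) + E n α β * G n β / 3) := by
    rw [hb]
    field_simp
    ring
  have e3 : 2 * (-α * Γ n α β ^ 2 + E n α β * (8 * n ^ 2 + 24 * n + 12 +
    n * (n + 3) * ((11 * n ^ 2 + 33 * n + 16) * α
    + 12 * (4 * n ^ 4 + 24 * n ^ 3 + 34 * n ^ 2 - 6 * n - 8) * β
    + 3 * n * (n + 1) * (n + 2) * (n + 3) *
      (-4 * (n + 1) * (n + 2) * (2 * n ^ 2 + 6 * n - 5) * β ^ 2
        - 3 * (n - 1) * n * (n + 1) * (n + 2) * (n + 3) * (n + 4) * α * β ^ 2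
        + 2 * (3 * n ^ 2 + 9 * n - 6) * α * β + α ^ 2))) / 12) -
      n * (n + 3) * (2 * ((n + 1) * (n + 2)) * (β * Γ n α β) + E n α β * G n β / 3) *
        (F n α β + (n - 1) * F₁ n α β - 6 * (n * (n + 3) - 4) * F₂ n β) =
      (2 * (F n α β + (n + 1) * F₁ n α β) - 12 * ((n + 1) * (n + 2)) * F₂ n β) * Γ n α β := by
    rw [E, G, Γ, F, F₁, F₂]
    ring
  rw [← e3, ← e1, ← e2]
  ring

/-- The quadrature formula of a side interval: `Q_N` carries the terms `2α f(-1) - 24β f'(-1)` at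
the left end over to the terms `2 stepα f(1) - 24 stepβ f'(1)` at the right end. -/
theorem side_quadrature {N : ℕ} (hN : 1 ≤ N) {α β : ℝ} (hΓ : Γ N α β ≠ 0)
    (hroots : (Q N α β).roots.toFinset.card = N) :
    (∀ x ∈ (Q N α β).roots, weightQDen N α β x ≠ 0) ∧
    ∀ f : ℝ[X], f.natDegree ≤ 2 * N + 1 →
      massFunctional (2 * α) (-24 * β) 0 0 f =
        ∑ x ∈ (Q N α β).roots.toFinset, weightQ N α β x * f.eval x +
          2 * stepα N α β * f.eval 1 + -24 * stepβ N α β * (derivative f).eval 1 := by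
  obtain ⟨j, rfl⟩ : ∃ j, N = j + 1 := ⟨N - 1, by omega⟩
  have h1 : (((j + 1 : ℕ) : ℝ) + 1) ≠ 0 := by positivity
  have h2 : (((j + 1 : ℕ) : ℝ) + 2) ≠ 0 := by positivity
  -- A polynomial of degree at most `j + 1` with `j + 1` roots has a nonzero top coefficient.
  have hF : F (j + 1 : ℕ) α β ≠ 0 := by
    intro h0
    have hd : (Q (j + 1) α β).natDegree ≤ j := by
      rw [natDegree_le_iff_coeff_eq_zero]
      intro k hk
      rcases (Nat.succ_le_of_lt hk).lt_or_eq with h3 | h3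
      · exact coeff_eq_zero_of_natDegree_lt ((natDegree_Q_le _ _ _).trans_lt h3)
      · rw [← h3, Nat.succ_eq_add_one, coeff_Q, h0, zero_mul]
    have := (Multiset.toFinset_card_le _).trans (card_roots' (Q (j + 1) α β))
    omega
  have hk : (Q (j + 1) α β).coeff (j + 1) * (F (j + 1) α β * jacobiNorm 2 j) =
      8 * (j + 2) / ((j + 1) * (j + 3)) * F (j + 1) α β ^ 2 := by
    have := jacobi_coeff_mul_jacobiNorm 2 j
    rw [coeff_Q]
    push_cast at this ⊢
    linear_combination F (j + 1) α β ^ 2 * this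
  have hc : (Q (j + 1) α β).coeff (j + 1) * (F (j + 1) α β * jacobiNorm 2 j) ≠ 0 := by
    rw [hk]
    push_cast at hF
    have : (8 * (j + 2) / ((j + 1) * (j + 3)) : ℝ) ≠ 0 := by positivity
    exact mul_ne_zero this (pow_ne_zero 2 hF)
  obtain ⟨hne, hquad⟩ := radau_two_of_orthogonal (massFunctional (2 * α) (-24 * β) 0 0)
    (A := 2 * stepα (j + 1 : ℕ) α β) (B := -24 * stepβ (j + 1 : ℕ) α β)
    (natDegree_Q_le (j + 1) α β) hroots
    (fun g hg => by
      rw [massFunctional_Q_mul _ _ _ (hg.trans j.le_succ),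
        coeff_eq_zero_of_natDegree_lt (by omega), zero_mul])
    (natDegree_Q_le j α β) (fun g hg => massFunctional_Q_mul j α β hg) hc
    (by rwa [eval_one_Q])
    (by
      rw [massFunctional_Q, eval_one_Q, derivative_eval_one_Q, ← stepα_mul_Γ h1 h2 hΓ]
      ring)
    (by
      rw [massFunctional_one_sub_X_mul_Q, eval_one_Q, ← stepβ_mul_Γ h1 h2 hΓ]
      ring)
  have hden : ∀ x, weightQDen (j + 1) α β x = (j + 1) * (j + 3) *
      ((derivative (Q (j + 1) α β)).eval x * (Q j α β).eval x * (1 - x) ^ 2) := by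
    intro x
    simp only [weightQDen, Nat.add_sub_cancel]
    push_cast
    ring
  have hj : ((j + 1) * (j + 3) : ℝ) ≠ 0 := by positivity
  refine ⟨fun x hx => ?_, fun f hf => ?_⟩
  · rw [hden]
    exact mul_ne_zero hj (hne x hx)
  · rw [hquad f hf]
    congr 2
    refine Finset.sum_congr rfl fun x hx => ?_
    have := hne x (Multiset.mem_toFinset.1 hx)
    rw [hk, weightQ, hden]
    push_cast
    field_simp
    ring

end C1

/-! ### Continuity class 1: the middle polynomial -/

namespace C1

section Coefficients

/-- Coefficient of `P_n` in `M_n`. -/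
noncomputable def coefP (n αL αR βL βR : ℝ) : ℝ :=
  1 / 2 * (H₃ n αL βL * H₀ (n + 1) αR βR + H₃ n αR βR * H₀ (n + 1) αL βL) -
    36 * (βL - βR) ^ 2 * n * (n + 1) * (n * (n + 1))

/-- Coefficient of `P_n'` in `M_n`. -/
def coefDP (n αL αR βL βR : ℝ) : ℝ :=
  H₁ n αL βL * H₀ (n + 1) αR βR - H₁ n αR βR * H₀ (n + 1) αL βL +
    12 * (H₂ n βR * H₄ n αL βL - H₂ n βL * H₄ n αR βR)

/-- Coefficient of `x P_n'` in `M_n`. -/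
def coefXDP (n αL αR βL βR : ℝ) : ℝ :=
  36 * (βL - βR) ^ 2 * n * (n + 1) * 2 -
    (H₁ n αL βL * H₀ (n + 1) αR βR + H₁ n αR βR * H₀ (n + 1) αL βL)

/-- Coefficient of `P_n''` in `M_n`. -/
def coefDDP (n αL αR βL βR : ℝ) : ℝ :=
  12 * (H₂ n βL * H₀ (n + 1) αR βR + H₂ n βR * H₀ (n + 1) αL βL) -
    36 * (βL - βR) ^ 2 * n * (n + 1) * 2

/-- Coefficient of `x P_n''` in `M_n`. -/
def coefXDDP (n αL αR βL βR : ℝ) : ℝ :=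
  12 * (H₂ n βR * H₀ (n + 1) αL βL - H₂ n βL * H₀ (n + 1) αR βR) +
    72 * n * (n + 1) * (βL - βR) * (βL + βR - 6 * (n - 1) * n * (n + 1) * (n + 2) * βL * βR)

end Coefficients

variable (n : ℕ) (αL αR βL βR : ℝ)

theorem M_eq : M n αL αR βL βR = C (coefP n αL αR βL βR) * jacobi 0 0 n +
    C (coefDP n αL αR βL βR) * derivative (jacobi 0 0 n) +
    C (coefXDP n αL αR βL βR) * (X * derivative (jacobi 0 0 n)) +
    C (coefDDP n αL αR βL βR) * derivative (derivative (jacobi 0 0 n)) +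
    C (coefXDDP n αL αR βL βR) * (X * derivative (derivative (jacobi 0 0 n))) := by
  rw [M, coefP, coefDP, coefXDP, coefDDP, coefXDDP]
  simp only [C_add, C_sub, C_mul, show (C 2 : ℝ[X]) = 2 from rfl,
    show (C 12 : ℝ[X]) = 12 from rfl]
  ring

theorem natDegree_M_le : (M n αL αR βL βR).natDegree ≤ n := by
  have hP := jacobi_natDegree_le 0 n
  have hP' := natDegree_derivative_le_of_le hP
  rw [M_eq]
  refine natDegree_add_le_of_degree_le (natDegree_add_le_of_degree_le (natDegree_add_le_of_degree_le
    (natDegree_add_le_of_degree_le ?_ ?_) ?_) ?_) ?_ <;>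
    refine (natDegree_C_mul_le _ _).trans ?_
  · exact hP
  · exact hP'
  · exact natDegree_X_mul_derivative_le hP
  · exact natDegree_derivative_le_of_le hP'
  · exact natDegree_X_mul_derivative_le hP'

theorem coeff_M : (M n αL αR βL βR).coeff n = H n αL αR βL βR * (jacobi 0 0 n).coeff n := by
  have hP := jacobi_natDegree_le 0 n
  have hP' := natDegree_derivative_le_of_le hP
  have e : coefP n αL αR βL βR + n * coefXDP n αL αR βL βR = H n αL αR βL βR := by
    simp only [coefP, coefXDP, H, H₁, H₂, H₃, H₀]
    ring
  rw [M_eq]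
  simp only [coeff_add, coeff_C_mul, coeff_X_mul_derivative, coeff_derivative_eq_zero hP,
    coeff_derivative_eq_zero hP', ← e]
  ring

/-- `M_n` is orthogonal for the Lebesgue measure with the additional terms
`2αL f(-1) - 24βL f'(-1)` and, mirrored, `2αR f(1) + 24βR f'(1)`. -/
theorem massFunctional_M_mul {g : ℝ[X]} (hg : g.natDegree ≤ n) :
    massFunctional (2 * αL) (-24 * βL) (2 * αR) (24 * βR) (M n αL αR βL βR * g) =
      g.coeff n * (H (n + 1) αL αR βL βR * jacobiNorm 0 n) := by
  have h1 := intPoly_legendre_mul hg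
  have h2 := intPoly_derivative_legendre_mul hg
  have h3 := intPoly_X_mul_derivative_legendre_mul hg
  have h4 := intPoly_derivative_two_legendre_mul hg
  have h5 := intPoly_X_mul_derivative_two_legendre_mul hg
  have eH : coefP n αL αR βL βR - (n + 1) * coefXDP n αL αR βL βR =
      H (n + 1) αL αR βL βR := by
    simp only [coefP, coefXDP, H, H₁, H₂, H₃, H₀]
    ring
  -- The values and slopes of `M_n` at the end points cancel the boundary terms of the integrals.
  have r0 : (M n αL αR βL βR).eval 1 = coefP n αL αR βL βR +
      (coefDP n αL αR βL βR + coefXDP n αL αR βL βR) * (n * (n + 1) / 2) +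
      (coefDDP n αL αR βL βR + coefXDDP n αL αR βL βR) *
        ((n * (n + 1) - 2) * (n * (n + 1)) / 8) := by
    rw [M_eq]
    simp only [eval_add, eval_mul, eval_C, eval_X, legendre_eval_one,
      legendre_derivative_eval_one, legendre_derivative_two_eval_one]
    ring
  have r1 : (derivative (M n αL αR βL βR)).eval 1 =
      (coefP n αL αR βL βR + coefXDP n αL αR βL βR) * (n * (n + 1) / 2) +
      (coefDP n αL αR βL βR + coefXDP n αL αR βL βR + coefXDDP n αL αR βL βR) *
        ((n * (n + 1) - 2) * (n * (n + 1)) / 8) +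
      (coefDDP n αL αR βL βR + coefXDDP n αL αR βL βR) *
        ((n * (n + 1) - 6) * (n * (n + 1) - 2) * (n * (n + 1)) / 48) := by
    rw [M_eq]
    simp only [derivative_add, derivative_mul, derivative_C, derivative_X, eval_add, eval_mul,
      eval_C, eval_X, eval_one, eval_zero, legendre_derivative_eval_one,
      legendre_derivative_two_eval_one, legendre_derivative_three_eval_one]
    ring
  have l0 : (M n αL αR βL βR).eval (-1) = (coefP n αL αR βL βR -
      (coefDP n αL αR βL βR - coefXDP n αL αR βL βR) * (n * (n + 1) / 2) +
      (coefDDP n αL αR βL βR - coefXDDP n αL αR βL βR) *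
        ((n * (n + 1) - 2) * (n * (n + 1)) / 8)) * (jacobi 0 0 n).eval (-1) := by
    rw [M_eq]
    simp only [eval_add, eval_mul, eval_C, eval_X,
      legendre_derivative_eval_neg_one, legendre_derivative_two_eval_neg_one]
    ring
  have l1 : (derivative (M n αL αR βL βR)).eval (-1) =
      (-((coefP n αL αR βL βR + coefXDP n αL αR βL βR) * (n * (n + 1) / 2)) +
      (coefDP n αL αR βL βR - coefXDP n αL αR βL βR + coefXDDP n αL αR βL βR) *
        ((n * (n + 1) - 2) * (n * (n + 1)) / 8) -
      (coefDDP n αL αR βL βR - coefXDDP n αL αR βL βR) *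
        ((n * (n + 1) - 6) * (n * (n + 1) - 2) * (n * (n + 1)) / 48)) *
      (jacobi 0 0 n).eval (-1) := by
    rw [M_eq]
    simp only [derivative_add, derivative_mul, derivative_C, derivative_X, eval_add, eval_mul,
      eval_C, eval_X, eval_one, eval_zero, legendre_derivative_eval_neg_one,
      legendre_derivative_two_eval_neg_one, legendre_derivative_three_eval_neg_one]
    ring
  have c1 : 24 * βR * (M n αL αR βL βR).eval 1 =
      coefDDP n αL αR βL βR + coefXDDP n αL αR βL βR := by
    rw [r0]
    simp only [coefP, coefDP, coefXDP, coefDDP, coefXDDP, H₁, H₂, H₃, H₄, H₀]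
    ring
  have c2 : -24 * βL * (M n αL αR βL βR).eval (-1) =
      -(coefDDP n αL αR βL βR - coefXDDP n αL αR βL βR) * (jacobi 0 0 n).eval (-1) := by
    rw [l0]
    simp only [coefP, coefDP, coefXDP, coefDDP, coefXDDP, H₁, H₂, H₃, H₄, H₀]
    ring
  have c3 : 2 * αR * (M n αL αR βL βR).eval 1 + 24 * βR * (derivative (M n αL αR βL βR)).eval 1 =
      -(coefDP n αL αR βL βR + coefXDP n αL αR βL βR +
        (coefDDP n αL αR βL βR + coefXDDP n αL αR βL βR) * (n * (n + 1) / 2) -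
        coefXDDP n αL αR βL βR) := by
    rw [r0, r1]
    simp only [coefP, coefDP, coefXDP, coefDDP, coefXDDP, H₁, H₂, H₃, H₄, H₀]
    ring
  have c4 : 2 * αL * (M n αL αR βL βR).eval (-1) -
      24 * βL * (derivative (M n αL αR βL βR)).eval (-1) =
      (coefDP n αL αR βL βR - coefXDP n αL αR βL βR -
        (coefDDP n αL αR βL βR - coefXDDP n αL αR βL βR) * (n * (n + 1) / 2) -
        coefXDDP n αL αR βL βR) * (jacobi 0 0 n).eval (-1) := by
    rw [l0, l1]
    simp only [coefP, coefDP, coefXDP, coefDDP, coefXDDP, H₁, H₂, H₃, H₄, H₀]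
    ring
  have e : M n αL αR βL βR * g = C (coefP n αL αR βL βR) * (jacobi 0 0 n * g) +
      C (coefDP n αL αR βL βR) * (derivative (jacobi 0 0 n) * g) +
      C (coefXDP n αL αR βL βR) * (X * derivative (jacobi 0 0 n) * g) +
      C (coefDDP n αL αR βL βR) * (derivative (derivative (jacobi 0 0 n)) * g) +
      C (coefXDDP n αL αR βL βR) * (X * derivative (derivative (jacobi 0 0 n)) * g) := by
    rw [M_eq]; ring
  have eI : intPoly (M n αL αR βL βR * g) = _ := congrArg intPoly e
  rw [LinearMap.map_add, LinearMap.map_add, LinearMap.map_add, LinearMap.map_add,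
    intPoly_C_mul, intPoly_C_mul, intPoly_C_mul, intPoly_C_mul,
    intPoly_C_mul, h1, h2, h3, h4, h5, legendre_derivative_eval_one,
    legendre_derivative_eval_neg_one] at eI
  rw [massFunctional_apply, eI, ← eH]
  simp only [derivative_mul, eval_add, eval_mul]
  linear_combination g.eval 1 * c3 + g.eval (-1) * c4 + (derivative g).eval 1 * c1 +
    (derivative g).eval (-1) * c2

/-- The quadrature formula of the middle interval. -/
theorem mid_quadrature (j : ℕ) {αL αR βL βR : ℝ}
    (hroots : (M (j + 1) αL αR βL βR).roots.toFinset.card = j + 1) :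
    (∀ x ∈ (M (j + 1) αL αR βL βR).roots, weightMDen (j + 1) αL αR βL βR x ≠ 0) ∧
    ∀ f : ℝ[X], f.natDegree ≤ 2 * j + 1 →
      massFunctional (2 * αL) (-24 * βL) (2 * αR) (24 * βR) f =
        ∑ x ∈ (M (j + 1) αL αR βL βR).roots.toFinset,
          weightM (j + 1) αL αR βL βR x * f.eval x := by
  -- A polynomial of degree at most `j + 1` with `j + 1` roots has a nonzero top coefficient.
  have hH : H (j + 1 : ℕ) αL αR βL βR ≠ 0 := by
    intro h0
    have hd : (M (j + 1) αL αR βL βR).natDegree ≤ j := by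
      rw [natDegree_le_iff_coeff_eq_zero]
      intro k hk
      rcases (Nat.succ_le_of_lt hk).lt_or_eq with h3 | h3
      · exact coeff_eq_zero_of_natDegree_lt ((natDegree_M_le _ _ _ _ _).trans_lt h3)
      · rw [← h3, Nat.succ_eq_add_one, coeff_M, h0, zero_mul]
    have := (Multiset.toFinset_card_le _).trans (card_roots' (M (j + 1) αL αR βL βR))
    omega
  push_cast at hH
  have hk : (M (j + 1) αL αR βL βR).coeff (j + 1) * (H (j + 1) αL αR βL βR * jacobiNorm 0 j) =
      2 / (j + 1) * H (j + 1) αL αR βL βR ^ 2 := by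
    have h1 := jacobi_coeff_mul_jacobiNorm 0 j
    have h2 : (2 ^ 0 * (2 * j + 2 + (0 : ℕ)) / ((j + 1) * (j + 1 + (0 : ℕ))) : ℝ) =
        2 / (j + 1) := by
      have : (j + 1 : ℝ) ≠ 0 := by positivity
      push_cast
      field_simp
      ring
    rw [h2] at h1
    rw [coeff_M]
    push_cast
    linear_combination H (j + 1) αL αR βL βR ^ 2 * h1
  have hc : (M (j + 1) αL αR βL βR).coeff (j + 1) *
      (H (j + 1) αL αR βL βR * jacobiNorm 0 j) ≠ 0 := by
    rw [hk]
    have : (2 / (j + 1) : ℝ) ≠ 0 := by positivity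
    exact mul_ne_zero this (pow_ne_zero 2 hH)
  obtain ⟨hne, hquad⟩ := gauss_of_orthogonal (d := j + 1)
    (massFunctional (2 * αL) (-24 * βL) (2 * αR) (24 * βR))
    (natDegree_M_le (j + 1) αL αR βL βR) hroots j.le_succ
    (fun g hg => by
      rw [degree_lt_iff_coeff_zero] at hg
      rw [massFunctional_M_mul _ _ _ _ _
        (natDegree_le_iff_coeff_eq_zero.2 fun N hN => hg N hN.le), hg _ le_rfl, zero_mul])
    (natDegree_M_le j αL αR βL βR) (fun g hg => massFunctional_M_mul j αL αR βL βR hg) hc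
  have hden : ∀ x, weightMDen (j + 1) αL αR βL βR x = (j + 1) *
      ((derivative (M (j + 1) αL αR βL βR)).eval x * (M j αL αR βL βR).eval x) := by
    intro x
    simp only [weightMDen, Nat.add_sub_cancel]
    push_cast
    ring
  have hj : (j + 1 : ℝ) ≠ 0 := by positivity
  refine ⟨fun x hx => ?_, fun f hf => ?_⟩
  · rw [hden]
    exact mul_ne_zero hj (hne x hx)
  · rw [hquad f ((degree_le_of_natDegree_le hf).trans_lt (by
      exact_mod_cast (by omega : 2 * j + 1 < j + 1 + (j + 1))))]
    refine Finset.sum_congr rfl fun x hx => ?_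
    have := hne x (Multiset.mem_toFinset.1 hx)
    rw [hk, weightM, hden]
    push_cast
    field_simp

end C1

/-! ### Scaling quadrature formulas to the subintervals -/

/-- The polynomial `p` on `[u, v]`, seen as a polynomial on `[-1, 1]`. -/
noncomputable def pullback (u v : ℝ) (p : ℝ[X]) : ℝ[X] :=
  p.comp (C u + C ((v - u) / 2) * (1 + X))

theorem pullback_eval (u v : ℝ) (p : ℝ[X]) (x w : ℝ) :
    (pullback u v p).eval x = p.eval (scale u v (x, w)).1 := by
  simp only [pullback, scale, eval_comp, eval_add, eval_mul, eval_C, eval_one, eval_X]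
  congr 1
  ring

theorem pullback_derivative (u v : ℝ) (p : ℝ[X]) :
    derivative (pullback u v p) = C ((v - u) / 2) * pullback u v (derivative p) := by
  simp [pullback, derivative_comp]

theorem natDegree_pullback_le (u v : ℝ) {p : ℝ[X]} {D : ℕ} (hp : p.natDegree ≤ D) :
    (pullback u v p).natDegree ≤ D := by
  have h1 : (C u + C ((v - u) / 2) * (1 + X) : ℝ[X]).natDegree ≤ 1 := by compute_degree
  rw [pullback]
  calc _ ≤ p.natDegree * (C u + C ((v - u) / 2) * (1 + X) : ℝ[X]).natDegree := natDegree_comp_le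
    _ ≤ p.natDegree * 1 := Nat.mul_le_mul_left _ h1
    _ ≤ D := by omega

theorem scale_neg_one (u v w : ℝ) : (scale u v (-1, w)).1 = u := by
  simp [scale]

theorem scale_one (u v w : ℝ) : (scale u v (1, w)).1 = v := by
  simp only [scale]
  ring

theorem integral_eq_intPoly_pullback {u v : ℝ} (huv : u < v) (p : ℝ[X]) :
    ∫ x in u..v, p.eval x = (v - u) / 2 * intPoly (pullback u v p) := by
  have hc : (v - u) / 2 ≠ 0 := by
    have : 0 < (v - u) / 2 := by linarith
    exact this.ne'
  have h := intervalIntegral.smul_integral_comp_mul_add (a := -1) (b := 1) (fun x => p.eval x)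
    ((v - u) / 2) ((u + v) / 2)
  rw [intPoly_apply]
  simp only [smul_eq_mul] at h
  rw [show (v - u) / 2 * -1 + (u + v) / 2 = u by ring,
    show (v - u) / 2 * 1 + (u + v) / 2 = v by ring] at h
  rw [← h]
  congr 1
  refine intervalIntegral.integral_congr fun x _ => ?_
  simp only [pullback, eval_comp, eval_add, eval_mul, eval_C, eval_one, eval_X]
  congr 1
  ring

theorem scale_injective {u v : ℝ} (huv : u < v) : Function.Injective (scale u v) := by
  rintro ⟨x, w⟩ ⟨x', w'⟩ h
  simp only [scale, Prod.mk.injEq] at h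
  have hc : v - u ≠ 0 := (sub_pos.2 huv).ne'
  have h1 : (v - u) * (x - x') = 0 := by linarith [h.1]
  have h2 : (v - u) * (w - w') = 0 := by linarith [h.2]
  rw [Prod.mk.injEq]
  exact ⟨sub_eq_zero.1 ((mul_eq_zero.1 h1).resolve_left hc),
    sub_eq_zero.1 ((mul_eq_zero.1 h2).resolve_left hc)⟩

/-- The quadrature sum on `[u, v]` of the rule `W` given on `[-1, 1]`. -/
noncomputable def scaledSum (u v : ℝ) (W : Finset (ℝ × ℝ)) (p : ℝ[X]) : ℝ :=
  ∑ q ∈ W, (scale u v q).2 * p.eval (scale u v q).1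

theorem scaledSum_eq (u v : ℝ) (W : Finset (ℝ × ℝ)) (p : ℝ[X]) :
    scaledSum u v W p = (v - u) / 2 * ∑ q ∈ W, q.2 * (pullback u v p).eval q.1 := by
  rw [scaledSum, Finset.mul_sum]
  refine Finset.sum_congr rfl fun q _ => ?_
  rw [pullback_eval u v p q.1 q.2]
  simp only [scale]
  ring

/-! ### Passing the end point terms from subinterval to subinterval -/

/-- The quadrature formulas on the subintervals `0, …, m - 1`, each of which replaces the terms
`a s`, `b s` at its left end by the terms `A s`, `B s` at its right end, telescope: the total error
only depends on the value and the slope at the knot `t s`. Where `b` vanishes, the slopes need not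
match. -/
theorem left_chain {D m : ℕ} {t : ℕ → ℝ} (ht : ∀ s ≤ m, t s < t (s + 1))
    {W : ℕ → Finset (ℝ × ℝ)} {a b A B : ℕ → ℝ} (ha : a 0 = 0) (hb : b 0 = 0)
    (hA : ∀ s < m, A s * lenL t s = a (s + 1) * lenL t (s + 1))
    (hB : ∀ s < m, B s * lenL t s ^ 2 = b (s + 1) * lenL t (s + 1) ^ 2)
    (hW : ∀ s < m, ∀ f : ℝ[X], f.natDegree ≤ D → massFunctional (a s) (b s) 0 0 f =
      ∑ q ∈ W s, q.2 * f.eval q.1 + A s * f.eval 1 + B s * (derivative f).eval 1)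
    {p : ℕ → ℝ[X]} (hp : ∀ s < m, (p s).natDegree ≤ D)
    (hp0 : ∀ s < m, (p s).eval (t (s + 1)) = (p (s + 1)).eval (t (s + 1)))
    (hp1 : ∀ s < m, b (s + 1) * (derivative (p s)).eval (t (s + 1)) =
      b (s + 1) * (derivative (p (s + 1))).eval (t (s + 1))) :
    ∀ s ≤ m, ∑ i ∈ Finset.range s,
      ((∫ x in t i..t (i + 1), (p i).eval x) - scaledSum (t i) (t (i + 1)) (W i) (p i)) =
      lenL t s / 2 * (a s * (p s).eval (t s) +
        b s * (lenL t s / 2) * (derivative (p s)).eval (t s)) := by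
  intro s hs
  induction s with
  | zero => simp [ha, hb]
  | succ s ih =>
    have h1 := hW s hs (pullback (t s) (t (s + 1)) (p s)) (natDegree_pullback_le _ _ (hp s hs))
    rw [massFunctional_apply, pullback_derivative, eval_mul, eval_mul,
      pullback_eval _ _ _ 1 0, pullback_eval _ _ _ (-1) 0, pullback_eval _ _ _ 1 0,
      pullback_eval _ _ _ (-1) 0, scale_one, scale_neg_one, eval_C, eval_C] at h1
    have hAs := hA s hs
    have hBs := hB s hs
    have hq := hp1 s hs
    rw [Finset.sum_range_succ, ih (by omega), integral_eq_intPoly_pullback (ht s (by omega)),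
      scaledSum_eq, ← hp0 s hs]
    simp only [lenL] at hAs hBs ⊢
    linear_combination (t (s + 1) - t s) / 2 * h1 + (p s).eval (t (s + 1)) / 2 * hAs +
      (derivative (p s)).eval (t (s + 1)) / 4 * hBs +
      (t (s + 1 + 1) - t (s + 1)) ^ 2 / 4 * hq

/-! ### The assembled rule -/

section Assemble

variable {S m : ℕ} {t : ℕ → ℝ} {left right : ℕ → Finset (ℝ × ℝ)} {mid : Finset (ℝ × ℝ)}

theorem knots_le {S : ℕ} {t : ℕ → ℝ} (ht : ∀ s < S, t s < t (s + 1)) {i j : ℕ} (hij : i ≤ j)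
    (hj : j ≤ S) : t i ≤ t j := by
  induction j, hij using Nat.le_induction with
  | base => exact le_rfl
  | succ j _ ih => exact (ih (by omega)).trans (ht j (by omega)).le

/-- The pairs that the algorithm puts on the subinterval `s`. -/
noncomputable def piece (S m : ℕ) (t : ℕ → ℝ) (left right : ℕ → Finset (ℝ × ℝ))
    (mid : Finset (ℝ × ℝ)) (s : ℕ) : Finset (ℝ × ℝ) :=
  if s < m then (left s).image (scale (t s) (t (s + 1)))
  else if s = m then mid.image (scale (t s) (t (s + 1)))
  else (right (S - 1 - s)).image fun p => scale (t s) (t (s + 1)) (-p.1, p.2)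

/-- The part of the subinterval `s` to which its nodes belong. -/
def cell (m : ℕ) (t : ℕ → ℝ) (s : ℕ) : Set ℝ :=
  if s < m then Set.Ico (t s) (t (s + 1))
  else if s = m then Set.Icc (t s) (t (s + 1))
  else Set.Ioc (t s) (t (s + 1))

theorem assemble_eq_biUnion (hm : m < S) :
    assemble S m t left right mid = (Finset.range S).biUnion (piece S m t left right mid) := by
  ext q
  simp only [assemble, Finset.mem_union, Finset.mem_biUnion, Finset.mem_range]
  constructor
  · rintro ((⟨s, hs, hq⟩ | hq) | ⟨j, hj, hq⟩)
    · exact ⟨s, by omega, by rwa [piece, if_pos hs]⟩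
    · exact ⟨m, hm, by rwa [piece, if_neg (lt_irrefl m), if_pos rfl]⟩
    · refine ⟨S - 1 - j, by omega, ?_⟩
      rw [piece, if_neg (by omega), if_neg (by omega), show S - 1 - (S - 1 - j) = j by omega,
        show S - 1 - j + 1 = S - j by omega, show S - 1 - j = S - j - 1 by omega]
      exact hq
  · rintro ⟨s, hs, hq⟩
    rw [piece] at hq
    split_ifs at hq with h1 h2
    · exact Or.inl (Or.inl ⟨s, h1, hq⟩)
    · subst h2
      exact Or.inl (Or.inr hq)
    · refine Or.inr ⟨S - 1 - s, by omega, ?_⟩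
      rw [show S - (S - 1 - s) = s + 1 by omega, Nat.add_sub_cancel]
      exact hq

theorem cell_subset (m : ℕ) (t : ℕ → ℝ) (s : ℕ) : cell m t s ⊆ Set.Icc (t s) (t (s + 1)) := by
  rw [cell]
  split_ifs
  exacts [Set.Ico_subset_Icc_self, le_rfl, Set.Ioc_subset_Icc_self]

theorem cell_disjoint (ht : ∀ s < S, t s < t (s + 1)) {i j : ℕ} (hij : i < j) (hj : j < S) {x : ℝ}
    (hi : x ∈ cell m t i) : x ∉ cell m t j := by
  intro hxj
  have h := knots_le ht (Nat.succ_le_of_lt hij) hj.le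
  have h1 := (cell_subset m t i hi).2
  have h2 := (cell_subset m t j hxj).1
  rw [Nat.succ_eq_add_one] at h
  by_cases him : i < m
  · rw [cell, if_pos him] at hi
    linarith [hi.2]
  · rw [cell, if_neg (by omega), if_neg (by omega)] at hxj
    linarith [hxj.1]

theorem cell_eq_of_mem (ht : ∀ s < S, t s < t (s + 1)) {i j : ℕ} (hi : i < S) (hj : j < S) {x : ℝ}
    (hxi : x ∈ cell m t i) (hxj : x ∈ cell m t j) : i = j := by
  rcases lt_trichotomy i j with h | h | h
  · exact (cell_disjoint ht h hj hxi hxj).elim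
  · exact h
  · exact (cell_disjoint ht h hi hxj hxi).elim

theorem scale_mem_Icc {u v x : ℝ} (w : ℝ) (huv : u < v) (hx : x ∈ Set.Icc (-1) 1) :
    (scale u v (x, w)).1 ∈ Set.Icc u v := by
  simp only [scale]
  have : 0 < v - u := sub_pos.2 huv
  constructor <;> nlinarith [hx.1, hx.2]

theorem scale_mem_Ico {u v x : ℝ} (w : ℝ) (huv : u < v) (hx : x ∈ Set.Ico (-1) 1) :
    (scale u v (x, w)).1 ∈ Set.Ico u v := by
  refine ⟨(scale_mem_Icc w huv (Set.Ico_subset_Icc_self hx)).1, ?_⟩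
  simp only [scale]
  have : 0 < v - u := sub_pos.2 huv
  nlinarith [hx.2]

theorem scale_neg_mem_Ioc {u v x : ℝ} (w : ℝ) (huv : u < v) (hx : x ∈ Set.Ico (-1) 1) :
    (scale u v (-x, w)).1 ∈ Set.Ioc u v := by
  have hx' : -x ∈ Set.Icc (-1 : ℝ) 1 := ⟨by linarith [hx.2], by linarith [hx.1]⟩
  refine ⟨?_, (scale_mem_Icc w huv hx').2⟩
  simp only [scale]
  have : 0 < v - u := sub_pos.2 huv
  nlinarith [hx.2]

theorem scale_fst_injOn {u v : ℝ} (huv : u < v) {W : Set (ℝ × ℝ)} (hW : Set.InjOn Prod.fst W)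
    {p q : ℝ × ℝ} (hp : p ∈ W) (hq : q ∈ W) (h : (scale u v p).1 = (scale u v q).1) : p = q := by
  apply hW hp hq
  simp only [scale] at h
  have hc : v - u ≠ 0 := (sub_pos.2 huv).ne'
  have h1 : (v - u) * (p.1 - q.1) = 0 := by linarith
  exact sub_eq_zero.1 ((mul_eq_zero.1 h1).resolve_left hc)

/-- Rules on `[-1, 1]` for the subintervals whose nodes avoid the end points that adjacent
subintervals might share. -/
structure NodesFit (S m : ℕ) (left right : ℕ → Finset (ℝ × ℝ)) (mid : Finset (ℝ × ℝ)) : Prop where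
  left_mem : ∀ s < m, ∀ p ∈ left s, p.1 ∈ Set.Ico (-1 : ℝ) 1
  left_inj : ∀ s < m, Set.InjOn Prod.fst (left s : Set (ℝ × ℝ))
  mid_mem : ∀ p ∈ mid, p.1 ∈ Set.Icc (-1 : ℝ) 1
  mid_inj : Set.InjOn Prod.fst (mid : Set (ℝ × ℝ))
  right_mem : ∀ j < S - 1 - m, ∀ p ∈ right j, p.1 ∈ Set.Ico (-1 : ℝ) 1
  right_inj : ∀ j < S - 1 - m, Set.InjOn Prod.fst (right j : Set (ℝ × ℝ))

theorem NodesFit.mem_cell (h : NodesFit S m left right mid) (ht : ∀ s < S, t s < t (s + 1))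
    {s : ℕ} (hs : s < S) {q : ℝ × ℝ} (hq : q ∈ piece S m t left right mid s) :
    q.1 ∈ cell m t s := by
  rw [piece] at hq
  rw [cell]
  split_ifs at hq ⊢ with h1 h2
  · obtain ⟨p, hp, rfl⟩ := Finset.mem_image.1 hq
    exact scale_mem_Ico p.2 (ht s hs) (h.left_mem s h1 p hp)
  · obtain ⟨p, hp, rfl⟩ := Finset.mem_image.1 hq
    exact scale_mem_Icc p.2 (ht s hs) (h.mid_mem p hp)
  · obtain ⟨p, hp, rfl⟩ := Finset.mem_image.1 hq
    exact scale_neg_mem_Ioc p.2 (ht s hs) (h.right_mem _ (by omega) p hp)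

theorem NodesFit.injOn_piece (h : NodesFit S m left right mid) (ht : ∀ s < S, t s < t (s + 1))
    {s : ℕ} (hs : s < S) :
    Set.InjOn Prod.fst (piece S m t left right mid s : Set (ℝ × ℝ)) := by
  intro q hq q' hq' hqq
  rw [Finset.mem_coe, piece] at hq hq'
  split_ifs at hq hq' with h1 h2
  · obtain ⟨p, hp, rfl⟩ := Finset.mem_image.1 hq
    obtain ⟨p', hp', rfl⟩ := Finset.mem_image.1 hq'
    rw [scale_fst_injOn (ht s hs) (h.left_inj s h1) hp hp' hqq]
  · obtain ⟨p, hp, rfl⟩ := Finset.mem_image.1 hq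
    obtain ⟨p', hp', rfl⟩ := Finset.mem_image.1 hq'
    rw [scale_fst_injOn (ht s hs) h.mid_inj hp hp' hqq]
  · obtain ⟨p, hp, rfl⟩ := Finset.mem_image.1 hq
    obtain ⟨p', hp', rfl⟩ := Finset.mem_image.1 hq'
    rw [h.right_inj (S - 1 - s) (by omega) hp hp' ?_]
    simp only [scale] at hqq
    have hc : t (s + 1) - t s ≠ 0 := (sub_pos.2 (ht s hs)).ne'
    have h3 : (t (s + 1) - t s) * (p.1 - p'.1) = 0 := by linarith
    exact sub_eq_zero.1 ((mul_eq_zero.1 h3).resolve_left hc)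

theorem NodesFit.pairwiseDisjoint (h : NodesFit S m left right mid)
    (ht : ∀ s < S, t s < t (s + 1)) :
    Set.PairwiseDisjoint (Finset.range S : Set ℕ) (piece S m t left right mid) := by
  intro i hi j hj hij
  rw [Finset.mem_coe, Finset.mem_range] at hi hj
  rw [Function.onFun, Finset.disjoint_left]
  intro q hqi hqj
  exact hij (cell_eq_of_mem ht hi hj (h.mem_cell ht hi hqi) (h.mem_cell ht hj hqj))

theorem neg_scale_injective {u v : ℝ} (huv : u < v) :
    Function.Injective fun p : ℝ × ℝ => scale u v (-p.1, p.2) := by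
  rintro ⟨x, w⟩ ⟨x', w'⟩ hq
  have := scale_injective huv hq
  simpa using this

theorem NodesFit.card_assemble (h : NodesFit S m left right mid) (hm : m < S)
    (ht : ∀ s < S, t s < t (s + 1)) {N : ℕ} (hl : ∀ s < m, (left s).card = N)
    (hmid : mid.card = N + 1) (hr : ∀ j < S - 1 - m, (right j).card = N) :
    (assemble S m t left right mid).card = N * S + 1 := by
  rw [assemble_eq_biUnion hm, Finset.card_biUnion (fun i hi j hj => h.pairwiseDisjoint ht hi hj)]
  have hc : ∀ s ∈ Finset.range S, (piece S m t left right mid s).card =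
      N + if s = m then 1 else 0 := by
    intro s hs
    rw [Finset.mem_range] at hs
    rw [piece]
    split_ifs with h1 h2 h2
    · omega
    · rw [Finset.card_image_of_injective _ (scale_injective (ht s hs)), hl s h1, add_zero]
    · rw [Finset.card_image_of_injective _ (scale_injective (ht s hs)), hmid]
    · rw [Finset.card_image_of_injective _ (neg_scale_injective (ht s hs)), hr _ (by omega),
        add_zero]
  rw [Finset.sum_congr rfl hc, Finset.sum_add_distrib, Finset.sum_const, Finset.card_range,
    smul_eq_mul, Finset.sum_ite_eq', if_pos (Finset.mem_range.2 hm), mul_comm]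

end Assemble

/-! ### Exactness of the assembled rule -/

section Exactness

variable {D c S m : ℕ} {t : ℕ → ℝ} {left right : ℕ → Finset (ℝ × ℝ)} {mid : Finset (ℝ × ℝ)}

theorem integral_spline (ht : ∀ s < S, t s < t (s + 1)) {f : ℝ → ℝ} {p : ℕ → ℝ[X]}
    (hf : ∀ s < S, ∀ x ∈ Set.Icc (t s) (t (s + 1)), f x = (p s).eval x) :
    ∫ x in t 0..t S, f x = ∑ s ∈ Finset.range S, ∫ x in t s..t (s + 1), (p s).eval x := by
  have hi : ∀ s < S, IntervalIntegrable f MeasureTheory.volume (t s) (t (s + 1)) := by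
    intro s hs
    refine ContinuousOn.intervalIntegrable ?_
    rw [Set.uIcc_of_le (ht s hs).le]
    exact (p s).continuous.continuousOn.congr (hf s hs)
  rw [← intervalIntegral.sum_integral_adjacent_intervals hi]
  refine Finset.sum_congr rfl fun s hs => ?_
  have hs' := Finset.mem_range.1 hs
  refine intervalIntegral.integral_congr fun x hx => ?_
  rw [Set.uIcc_of_le (ht s hs').le] at hx
  exact hf s hs' x hx

/-- The knots reflected in the origin. -/
def reflectKnots (S : ℕ) (t : ℕ → ℝ) (j : ℕ) : ℝ := -t (S - j)

theorem lenL_reflectKnots (S : ℕ) (t : ℕ → ℝ) : lenL (reflectKnots S t) = lenR S t := by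
  funext j
  simp only [lenL, reflectKnots, lenR, Nat.sub_sub]
  ring

theorem integral_comp_neg_X (u v : ℝ) (p : ℝ[X]) :
    ∫ x in -v..-u, (p.comp (-X)).eval x = ∫ x in u..v, p.eval x := by
  have h := intervalIntegral.integral_comp_neg (a := -v) (b := -u) fun x => p.eval x
  rw [neg_neg, neg_neg] at h
  simpa using h

theorem scaledSum_comp_neg_X (u v : ℝ) (W : Finset (ℝ × ℝ)) (p : ℝ[X]) :
    scaledSum (-v) (-u) W (p.comp (-X)) =
      ∑ q ∈ W, (scale u v (-q.1, q.2)).2 * p.eval (scale u v (-q.1, q.2)).1 := by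
  refine Finset.sum_congr rfl fun q _ => ?_
  simp only [scale, eval_comp, eval_neg, eval_X]
  congr 1
  · ring
  · congr 1
    ring

/-- The data that make the local quadrature formulas fit together: the end point terms produced on
one subinterval are those consumed on the next, seen from both sides. The families `right`, `aR`, `bR`
belong to the reflected right half, counted from the right; reflection changes the sign of first
derivatives, whence `-bR` in `mid_quad`. If the splines are only continuous, the derivative terms
have to be absent. -/
structure ChainFit (D c S m : ℕ) (t : ℕ → ℝ) (left right : ℕ → Finset (ℝ × ℝ))
    (mid : Finset (ℝ × ℝ)) (aL bL AL BL aR bR AR BR : ℕ → ℝ) : Prop where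
  aL_zero : aL 0 = 0
  bL_zero : bL 0 = 0
  aR_zero : aR 0 = 0
  bR_zero : bR 0 = 0
  aL_succ : ∀ s < m, AL s * lenL t s = aL (s + 1) * lenL t (s + 1)
  bL_succ : ∀ s < m, BL s * lenL t s ^ 2 = bL (s + 1) * lenL t (s + 1) ^ 2
  aR_succ : ∀ s < S - 1 - m, AR s * lenR S t s = aR (s + 1) * lenR S t (s + 1)
  bR_succ : ∀ s < S - 1 - m, BR s * lenR S t s ^ 2 = bR (s + 1) * lenR S t (s + 1) ^ 2
  left_quad : ∀ s < m, ∀ f : ℝ[X], f.natDegree ≤ D → massFunctional (aL s) (bL s) 0 0 f =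
    ∑ q ∈ left s, q.2 * f.eval q.1 + AL s * f.eval 1 + BL s * (derivative f).eval 1
  right_quad : ∀ s < S - 1 - m, ∀ f : ℝ[X], f.natDegree ≤ D →
    massFunctional (aR s) (bR s) 0 0 f =
      ∑ q ∈ right s, q.2 * f.eval q.1 + AR s * f.eval 1 + BR s * (derivative f).eval 1
  mid_quad : ∀ f : ℝ[X], f.natDegree ≤ D →
    massFunctional (aL m) (bL m) (aR (S - 1 - m)) (-bR (S - 1 - m)) f =
      ∑ q ∈ mid, q.2 * f.eval q.1
  smooth : 1 ≤ c ∨ ∀ s, bL s = 0 ∧ bR s = 0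

variable {aL bL AL BL aR bR AR BR : ℕ → ℝ}

/-- The left chain and the reflected right chain leave terms at the two ends of the middle subinterval,
which the middle formula absorbs. -/
theorem ChainFit.sum_eq (h : ChainFit D c S m t left right mid aL bL AL BL aR bR AR BR)
    (hm : m < S) (ht : ∀ s < S, t s < t (s + 1)) {p : ℕ → ℝ[X]}
    (hp : ∀ s < S, (p s).natDegree ≤ D)
    (hpc : ∀ s, s + 1 < S → ∀ k ≤ c,
      (derivative^[k] (p s)).eval (t (s + 1)) = (derivative^[k] (p (s + 1))).eval (t (s + 1))) :
    ∑ s ∈ Finset.range S, ∫ x in t s..t (s + 1), (p s).eval x =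
      ∑ s ∈ Finset.range S, ∑ q ∈ piece S m t left right mid s, q.2 * (p s).eval q.1 := by
  have hp0 : ∀ s, s + 1 < S → (p s).eval (t (s + 1)) = (p (s + 1)).eval (t (s + 1)) :=
    fun s hs => hpc s hs 0 (Nat.zero_le c)
  have hL := left_chain (D := D) (m := m) (fun s hs => ht s (by omega)) h.aL_zero h.bL_zero
    h.aL_succ h.bL_succ h.left_quad (p := p) (fun s hs => hp s (by omega))
    (fun s hs => hp0 s (by omega))
    (fun s hs => by
      rcases h.smooth with h1 | h1
      · rw [show (derivative (p s)).eval (t (s + 1)) = (derivative (p (s + 1))).eval (t (s + 1)) from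
          hpc s (by omega) 1 h1]
      · rw [(h1 (s + 1)).1, zero_mul, zero_mul]) m le_rfl
  set k := S - 1 - m with hk
  set p' : ℕ → ℝ[X] := fun j => (p (S - 1 - j)).comp (-X) with hp'
  have hdp' : ∀ j, derivative (p' j) = -(derivative (p (S - 1 - j))).comp (-X) := by
    intro j
    simp [hp', derivative_comp]
  have hidx : ∀ s, s + 1 ≤ k → S - 1 - (s + 1) + 1 = S - 1 - s := fun s hs => by omega
  have hR := left_chain (D := D) (m := k) (t := reflectKnots S t)
    (fun s hs => by
      simp only [reflectKnots]
      have := ht (S - (s + 1)) (by omega)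
      rw [show S - (s + 1) + 1 = S - s by omega] at this
      linarith)
    h.aR_zero h.bR_zero (by rw [lenL_reflectKnots]; exact h.aR_succ)
    (by rw [lenL_reflectKnots]; exact h.bR_succ) h.right_quad (p := p')
    (fun s hs => by
      rw [hp']
      refine natDegree_comp_le.trans ?_
      rw [natDegree_neg, natDegree_X, mul_one]
      exact hp _ (by omega))
    (fun s hs => by
      have := hp0 (S - 1 - (s + 1)) (by omega)
      simp only [hp', reflectKnots, eval_comp, eval_neg, eval_X, neg_neg]
      rw [hidx s hs] at this
      rw [show S - (s + 1) = S - 1 - s by omega]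
      exact this.symm)
    (fun s hs => by
      rcases h.smooth with h1 | h1
      · have := hpc (S - 1 - (s + 1)) (by omega) 1 h1
        rw [hidx s hs] at this
        simp only [hdp', reflectKnots, eval_comp, eval_neg, eval_X, neg_neg]
        rw [show S - (s + 1) = S - 1 - s by omega]
        simp only [Function.iterate_one] at this
        rw [this]
      · rw [(h1 (s + 1)).2, zero_mul, zero_mul]) k le_rfl
  have hM := h.mid_quad (pullback (t m) (t (m + 1)) (p m)) (natDegree_pullback_le _ _ (hp m hm))
  rw [massFunctional_apply, pullback_derivative, eval_mul, eval_mul,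
      pullback_eval _ _ _ 1 0, pullback_eval _ _ _ (-1) 0, pullback_eval _ _ _ 1 0,
      pullback_eval _ _ _ (-1) 0, scale_one, scale_neg_one, eval_C, eval_C] at hM
  -- The sum over the right subintervals, rewritten in the original coordinates.
  have hRsum : ∑ i ∈ Finset.range k, ((∫ x in reflectKnots S t i..reflectKnots S t (i + 1),
      (p' i).eval x) - scaledSum (reflectKnots S t i) (reflectKnots S t (i + 1)) (right i) (p' i)) =
      ∑ i ∈ Finset.range k, ((∫ x in t (m + 1 + i)..t (m + 1 + i + 1), (p (m + 1 + i)).eval x) -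
        ∑ q ∈ piece S m t left right mid (m + 1 + i), q.2 * (p (m + 1 + i)).eval q.1) := by
    rw [← Finset.sum_range_reflect (fun i => (∫ x in t (m + 1 + i)..t (m + 1 + i + 1),
      (p (m + 1 + i)).eval x) -
        ∑ q ∈ piece S m t left right mid (m + 1 + i), q.2 * (p (m + 1 + i)).eval q.1)]
    refine Finset.sum_congr rfl fun i hi => ?_
    have hi' := Finset.mem_range.1 hi
    have e : m + 1 + (k - 1 - i) = S - 1 - i := by omega
    have e2 : S - 1 - i + 1 = S - i := by omega
    have e3 : S - (i + 1) = S - 1 - i := by omega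
    simp only [e, e2, hp', reflectKnots, e3]
    rw [integral_comp_neg_X, scaledSum_comp_neg_X, piece, if_neg (by omega), if_neg (by omega),
      e2, show S - 1 - (S - 1 - i) = i by omega,
      Finset.sum_image fun a _ b _ hab => neg_scale_injective
        (by have := ht (S - 1 - i) (by omega); rwa [e2] at this) hab]
  have hLsum : ∑ i ∈ Finset.range m, ((∫ x in t i..t (i + 1), (p i).eval x) -
      scaledSum (t i) (t (i + 1)) (left i) (p i)) =
      ∑ i ∈ Finset.range m, ((∫ x in t i..t (i + 1), (p i).eval x) -
        ∑ q ∈ piece S m t left right mid i, q.2 * (p i).eval q.1) := by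
    refine Finset.sum_congr rfl fun i hi => ?_
    have hi' := Finset.mem_range.1 hi
    rw [piece, if_pos hi', Finset.sum_image fun a _ b _ hab => scale_injective (ht i (by omega)) hab,
      scaledSum]
  have hMsum : ∑ q ∈ piece S m t left right mid m, q.2 * (p m).eval q.1 =
      scaledSum (t m) (t (m + 1)) mid (p m) := by
    rw [piece, if_neg (lt_irrefl m), if_pos rfl,
      Finset.sum_image fun a _ b _ hab => scale_injective (ht m hm) hab, scaledSum]
  rw [← sub_eq_zero, ← Finset.sum_sub_distrib, show S = m + 1 + k by omega,
    Finset.sum_range_add, Finset.sum_range_succ, show m + 1 + k = S by omega, ← hRsum, hR, ← hLsum,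
    hL, hMsum, scaledSum_eq, integral_eq_intPoly_pullback (ht m hm), lenL_reflectKnots, hdp']
  have e4 : S - k = m + 1 := by omega
  have e6 : S - 1 - k = m := by omega
  simp only [hp', lenL, lenR, reflectKnots, e4, e6, eval_comp, eval_neg, eval_X, neg_neg,
    Nat.add_sub_cancel]
  linear_combination (t (m + 1) - t m) / 2 * hM

theorem ChainFit.isExactRule (h : ChainFit D c S m t left right mid aL bL AL BL aR bR AR BR)
    (hfit : NodesFit S m left right mid) (hm : m < S) (ht : ∀ s < S, t s < t (s + 1)) :
    IsExactRule (splineSpace D c S t) (t 0) (t S) (assemble S m t left right mid) := by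
  rw [assemble_eq_biUnion hm]
  refine ⟨?_, ?_, ?_⟩
  · intro q hq
    obtain ⟨s, hs, hqs⟩ := Finset.mem_biUnion.1 hq
    have hs' := Finset.mem_range.1 hs
    have h1 := cell_subset m t s (hfit.mem_cell ht hs' hqs)
    exact ⟨(knots_le ht (Nat.zero_le s) hs'.le).trans h1.1, h1.2.trans (knots_le ht hs' le_rfl)⟩
  · intro q hq q' hq' hqq
    obtain ⟨s, hs, hqs⟩ := Finset.mem_biUnion.1 (Finset.mem_coe.1 hq)
    obtain ⟨s', hs', hqs'⟩ := Finset.mem_biUnion.1 (Finset.mem_coe.1 hq')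
    rw [Finset.mem_range] at hs hs'
    have h1 := hfit.mem_cell ht hs hqs
    have h2 := hfit.mem_cell ht hs' hqs'
    rw [← hqq] at h2
    obtain rfl := cell_eq_of_mem ht hs hs' h1 h2
    exact hfit.injOn_piece ht hs hqs hqs' hqq
  · rintro f ⟨p, hp, hpc⟩
    rw [integral_spline ht fun s hs => (hp s hs).2, h.sum_eq hm ht (fun s hs => (hp s hs).1) hpc,
      Finset.sum_biUnion (hfit.pairwiseDisjoint ht)]
    refine Finset.sum_congr rfl fun s hs => Finset.sum_congr rfl fun q hq => ?_
    have hs' := Finset.mem_range.1 hs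
    rw [(hp s hs').2 q.1 (cell_subset m t s (hfit.mem_cell ht hs' hq))]

end Exactness

/-! ### Nonnegative polynomials with prescribed zeros -/

/-- All derivatives of orders `0, …, c` of `p` vanish at `x`. -/
def IsFlatAt (c : ℕ) (p : ℝ[X]) (x : ℝ) : Prop :=
  ∀ k ≤ c, (derivative^[k] p).eval x = 0

/-- `p` is positive at `x` and its derivatives of orders `1, …, c` are nonnegative there. -/
def IsRisingAt (c : ℕ) (p : ℝ[X]) (x : ℝ) : Prop :=
  0 < p.eval x ∧ ∀ k ≤ c, 0 ≤ (derivative^[k] p).eval x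

/-- The derivatives of orders `0, …, c` of `p` and `q` agree at `x`. -/
def JetEq (c : ℕ) (p q : ℝ[X]) (x : ℝ) : Prop :=
  ∀ k ≤ c, (derivative^[k] p).eval x = (derivative^[k] q).eval x

/-- `p` is admissible on `[u, v]`: it has degree at most `D`, is nonnegative, and vanishes on `Y`. -/
def IsBump (D : ℕ) (u v : ℝ) (Y : Finset ℝ) (p : ℝ[X]) : Prop :=
  p.natDegree ≤ D ∧ (∀ x ∈ Set.Icc u v, 0 ≤ p.eval x) ∧ ∀ y ∈ Y, p.eval y = 0

/-- On one subinterval: what nonnegative polynomials of degree at most `D` can achieve when they have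
to vanish at the points of `Y`, in terms of the number of these points. With fewer than `N` points a
rising polynomial on the left can be brought down to zero (`finish`); with exactly `N` points it can
be continued by a rising one (`extend`); and with fewer than `N` points one can begin from zero at the
left end, and either return to zero or, if a single point is missing, arrive rising (`start`). -/
structure HasBumps (c D N : ℕ) : Prop where
  finish : ∀ {u v : ℝ} {Y : Finset ℝ} {r : ℝ[X]}, u < v → (∀ y ∈ Y, y ∈ Set.Ioo u v) →
    Y.card < N → IsRisingAt c r u → ∃ p, IsBump D u v Y p ∧ JetEq c r p u ∧ IsFlatAt c p v
  extend : ∀ {u v : ℝ} {Y : Finset ℝ} {r : ℝ[X]}, u < v → (∀ y ∈ Y, y ∈ Set.Ioo u v) →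
    Y.card = N → IsRisingAt c r u → ∃ p, IsBump D u v Y p ∧ JetEq c r p u ∧ IsRisingAt c p v
  start : ∀ {u v : ℝ} {Y : Finset ℝ}, u < v → (∀ y ∈ Y, y ∈ Set.Ioo u v) →
    Y.card < N → ∃ p, IsBump D u v Y p ∧ p ≠ 0 ∧ IsFlatAt c p u ∧
      (IsFlatAt c p v ∨ (Y.card + 1 = N ∧ IsRisingAt c p v))

/-- The polynomial with double zeros at the points of `Y`. -/
noncomputable def squareNodal (Y : Finset ℝ) : ℝ[X] := ∏ y ∈ Y, (X - C y) ^ 2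

theorem natDegree_squareNodal_le (Y : Finset ℝ) : (squareNodal Y).natDegree ≤ 2 * Y.card := by
  refine (natDegree_prod_le _ _).trans ?_
  rw [mul_comm, ← smul_eq_mul]
  refine Finset.sum_le_card_nsmul _ _ _ fun y _ => ?_
  compute_degree

theorem squareNodal_eval_nonneg (Y : Finset ℝ) (x : ℝ) : 0 ≤ (squareNodal Y).eval x := by
  rw [squareNodal, eval_prod]
  exact Finset.prod_nonneg fun y _ => by simp only [eval_pow]; positivity

theorem squareNodal_eval_eq_zero {Y : Finset ℝ} {y : ℝ} (hy : y ∈ Y) :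
    (squareNodal Y).eval y = 0 := by
  rw [squareNodal, eval_prod]
  exact Finset.prod_eq_zero hy (by simp)

theorem squareNodal_eval_pos {Y : Finset ℝ} {x : ℝ} (hx : x ∉ Y) : 0 < (squareNodal Y).eval x := by
  rw [squareNodal, eval_prod]
  refine Finset.prod_pos fun y hy => ?_
  have : x - y ≠ 0 := sub_ne_zero.2 (by rintro rfl; exact hx hy)
  simp only [eval_pow, eval_sub, eval_X, eval_C]
  positivity

theorem squareNodal_derivative_nonneg {Y : Finset ℝ} {x : ℝ} (hx : ∀ y ∈ Y, y ≤ x) :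
    0 ≤ (derivative (squareNodal Y)).eval x := by
  classical
  induction Y using Finset.induction_on with
  | empty => simp [squareNodal]
  | insert a Y ha ih =>
    have h1 := ih fun y hy => hx y (Finset.mem_insert_of_mem hy)
    have h2 := squareNodal_eval_nonneg Y x
    have h3 : 0 ≤ x - a := sub_nonneg.2 (hx a (Finset.mem_insert_self a Y))
    rw [squareNodal, Finset.prod_insert ha, ← squareNodal]
    simp only [derivative_mul, derivative_X_sub_C_sq, eval_add, eval_mul, eval_C, eval_sub, eval_X,
      eval_pow]
    positivity

theorem squareNodal_derivative_nonpos {Y : Finset ℝ} {x : ℝ} (hx : ∀ y ∈ Y, x ≤ y) :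
    (derivative (squareNodal Y)).eval x ≤ 0 := by
  classical
  induction Y using Finset.induction_on with
  | empty => simp [squareNodal]
  | insert a Y ha ih =>
    have h1 := ih fun y hy => hx y (Finset.mem_insert_of_mem hy)
    have h2 := squareNodal_eval_nonneg Y x
    have h3 : 0 ≤ a - x := sub_nonneg.2 (hx a (Finset.mem_insert_self a Y))
    rw [squareNodal, Finset.prod_insert ha, ← squareNodal]
    simp only [derivative_mul, derivative_X_sub_C_sq, eval_add, eval_mul, eval_C, eval_sub, eval_X,
      eval_pow]
    nlinarith [mul_nonneg h3 h2, mul_nonneg (sq_nonneg (x - a)) (neg_nonneg.2 h1)]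

theorem notMem_of_forall_mem_Ioo {u v : ℝ} {Y : Finset ℝ} (hY : ∀ y ∈ Y, y ∈ Set.Ioo u v) :
    u ∉ Y ∧ v ∉ Y :=
  ⟨fun h => lt_irrefl _ (hY u h).1, fun h => lt_irrefl _ (hY v h).2⟩

/-- With double zeros at the points of `Y`, degree `2N` leaves room for a linear factor at `v` as soon as
a point is missing, and for linear factors at both ends. -/
theorem hasBumps_zero (N : ℕ) : HasBumps 0 (2 * N) N where
  finish := by
    intro u v Y r huv hY hc hr
    have hu := squareNodal_eval_pos (notMem_of_forall_mem_Ioo hY).1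
    have hvu := sub_pos.2 huv
    refine ⟨C (r.eval u / ((squareNodal Y).eval u * (v - u))) * (squareNodal Y * (C v - X)),
      ⟨?_, fun x hx => ?_, fun y hy => ?_⟩, ?_, ?_⟩
    · have h1 : (C v - X : ℝ[X]).natDegree ≤ 1 := by compute_degree
      have h2 := natDegree_mul_le_of_le (natDegree_squareNodal_le Y) h1
      exact (natDegree_C_mul_le _ _).trans (h2.trans (by omega))
    · have h1 := squareNodal_eval_nonneg Y x
      have h2 : 0 ≤ v - x := sub_nonneg.2 hx.2
      have h3 := hr.1
      simp only [eval_mul, eval_C, eval_sub, eval_X]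
      positivity
    · simp [squareNodal_eval_eq_zero hy]
    · intro k hk
      obtain rfl := Nat.le_zero.1 hk
      simp only [Function.iterate_zero, id_eq, eval_mul, eval_C, eval_sub, eval_X]
      field_simp
    · intro k hk
      obtain rfl := Nat.le_zero.1 hk
      simp
  extend := by
    intro u v Y r huv hY hc hr
    have hu := squareNodal_eval_pos (notMem_of_forall_mem_Ioo hY).1
    have hv := squareNodal_eval_pos (notMem_of_forall_mem_Ioo hY).2
    have h3 := hr.1
    refine ⟨C (r.eval u / (squareNodal Y).eval u) * squareNodal Y,
      ⟨?_, fun x hx => ?_, fun y hy => ?_⟩, ?_, ?_, ?_⟩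
    · exact (natDegree_C_mul_le _ _).trans ((natDegree_squareNodal_le Y).trans (by omega))
    · have h1 := squareNodal_eval_nonneg Y x
      simp only [eval_mul, eval_C]
      positivity
    · simp [squareNodal_eval_eq_zero hy]
    · intro k hk
      obtain rfl := Nat.le_zero.1 hk
      simp only [Function.iterate_zero, id_eq, eval_mul, eval_C]
      field_simp
    · simp only [eval_mul, eval_C]
      positivity
    · intro k hk
      obtain rfl := Nat.le_zero.1 hk
      simp only [Function.iterate_zero, id_eq, eval_mul, eval_C]
      positivity
  start := by
    intro u v Y huv hY hc
    refine ⟨squareNodal Y * ((X - C u) * (C v - X)), ⟨?_, fun x hx => ?_, fun y hy => ?_⟩, ?_,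
      ?_, Or.inl ?_⟩
    · have h1 : ((X - C u) * (C v - X) : ℝ[X]).natDegree ≤ 2 := by compute_degree
      have h2 := natDegree_mul_le_of_le (natDegree_squareNodal_le Y) h1
      omega
    · have h1 := squareNodal_eval_nonneg Y x
      have h2 : 0 ≤ v - x := sub_nonneg.2 hx.2
      have h3 : 0 ≤ x - u := sub_nonneg.2 hx.1
      simp only [eval_mul, eval_C, eval_sub, eval_X]
      positivity
    · simp [squareNodal_eval_eq_zero hy]
    · have hq : squareNodal Y ≠ 0 := by
        intro h0
        have hu := squareNodal_eval_pos (notMem_of_forall_mem_Ioo hY).1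
        simp [h0] at hu
      refine mul_ne_zero hq (mul_ne_zero (X_sub_C_ne_zero u) ?_)
      rw [← neg_sub]
      exact neg_ne_zero.2 (X_sub_C_ne_zero v)
    · intro k hk
      obtain rfl := Nat.le_zero.1 hk
      simp
    · intro k hk
      obtain rfl := Nat.le_zero.1 hk
      simp

/-- A nonnegative polynomial `q` that does not rise at `u` can be multiplied by a nonnegative
affine function that is nondecreasing, so that the product gets any prescribed rising jet at `u`. -/
theorem exists_affine_mul {q r : ℝ[X]} {u : ℝ} (hq0 : 0 < q.eval u)
    (hq1 : (derivative q).eval u ≤ 0) (hr : IsRisingAt 1 r u) :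
    ∃ l₀ > 0, ∃ l₁ ≥ 0, JetEq 1 r (q * (C l₀ + C l₁ * (X - C u))) u := by
  have hr0 := hr.1
  have hr1 : 0 ≤ (derivative r).eval u := hr.2 1 le_rfl
  refine ⟨r.eval u / q.eval u, by positivity,
    ((derivative r).eval u - (derivative q).eval u * (r.eval u / q.eval u)) / q.eval u, ?_, ?_⟩
  · have : 0 ≤ -(derivative q).eval u * (r.eval u / q.eval u) := by
      have : 0 ≤ -(derivative q).eval u := by linarith
      positivity
    refine div_nonneg ?_ hq0.le
    linarith
  · intro k hk
    interval_cases k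
    · simp only [Function.iterate_zero, id_eq, eval_mul, eval_add, eval_C, eval_sub, eval_X,
        sub_self, mul_zero, add_zero]
      field_simp
    · simp only [Function.iterate_one, derivative_mul, derivative_add, derivative_C,
        derivative_sub, derivative_X, eval_mul, eval_add, eval_C, eval_sub, eval_X, eval_zero,
        eval_one, sub_self, mul_zero, add_zero]
      field_simp
      ring

/-- With double zeros at the points of `Y`, a missing point leaves room for a double zero at one end
point, and the odd degree for an affine factor that adjusts the slope. Double zeros at both end
points need two missing points. -/
theorem hasBumps_one (N : ℕ) : HasBumps 1 (2 * N + 1) N where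
  finish := by
    intro u v Y r huv hY hc hr
    have hu := squareNodal_eval_pos (notMem_of_forall_mem_Ioo hY).1
    have hu' := squareNodal_derivative_nonpos fun y hy => (hY y hy).1.le
    have hvu := sub_pos.2 huv
    have hq0 : 0 < (squareNodal Y * (X - C v) ^ 2).eval u := by
      have : u - v ≠ 0 := by linarith
      simp only [eval_mul, eval_C, eval_sub, eval_X, eval_pow]
      positivity
    have hq1 : (derivative (squareNodal Y * (X - C v) ^ 2)).eval u ≤ 0 := by
      simp only [derivative_mul, derivative_X_sub_C_sq, eval_add, eval_mul, eval_C, eval_sub,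
        eval_X, eval_pow]
      nlinarith [mul_pos hu hvu, mul_nonneg (sq_nonneg (u - v)) (neg_nonneg.2 hu')]
    obtain ⟨l₀, hl₀, l₁, hl₁, hjet⟩ := exists_affine_mul hq0 hq1 hr
    refine ⟨_, ⟨?_, fun x hx => ?_, fun y hy => ?_⟩, hjet, ?_⟩
    · have h1 : ((X - C v) ^ 2 : ℝ[X]).natDegree ≤ 2 := by compute_degree
      have h2 : (C l₀ + C l₁ * (X - C u) : ℝ[X]).natDegree ≤ 1 := by compute_degree
      have h3 := natDegree_mul_le_of_le (natDegree_mul_le_of_le (natDegree_squareNodal_le Y) h1) h2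
      omega
    · have h1 := squareNodal_eval_nonneg Y x
      have h3 : 0 ≤ x - u := sub_nonneg.2 hx.1
      simp only [eval_mul, eval_C, eval_sub, eval_X, eval_pow, eval_add]
      positivity
    · simp [squareNodal_eval_eq_zero hy]
    · intro k hk
      interval_cases k <;> simp [derivative_mul, derivative_X_sub_C_sq]
  extend := by
    intro u v Y r huv hY hc hr
    have hu := squareNodal_eval_pos (notMem_of_forall_mem_Ioo hY).1
    have hv := squareNodal_eval_pos (notMem_of_forall_mem_Ioo hY).2
    have hu' := squareNodal_derivative_nonpos fun y hy => (hY y hy).1.le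
    have hv' := squareNodal_derivative_nonneg fun y hy => (hY y hy).2.le
    have hvu := sub_pos.2 huv
    obtain ⟨l₀, hl₀, l₁, hl₁, hjet⟩ := exists_affine_mul hu hu' hr
    have hpos : 0 < (squareNodal Y * (C l₀ + C l₁ * (X - C u))).eval v := by
      simp only [eval_mul, eval_C, eval_sub, eval_X, eval_add]
      positivity
    refine ⟨_, ⟨?_, fun x hx => ?_, fun y hy => ?_⟩, hjet, hpos, ?_⟩
    · have h2 : (C l₀ + C l₁ * (X - C u) : ℝ[X]).natDegree ≤ 1 := by compute_degree
      have h3 := natDegree_mul_le_of_le (natDegree_squareNodal_le Y) h2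
      omega
    · have h1 := squareNodal_eval_nonneg Y x
      have h3 : 0 ≤ x - u := sub_nonneg.2 hx.1
      simp only [eval_mul, eval_C, eval_sub, eval_X, eval_add]
      positivity
    · simp [squareNodal_eval_eq_zero hy]
    · intro k hk
      interval_cases k
      · exact hpos.le
      · simp only [Function.iterate_one, derivative_mul, derivative_add, derivative_C,
          derivative_sub, derivative_X, eval_mul, eval_add, eval_C, eval_sub, eval_X,
          zero_mul, zero_add, sub_zero, mul_one]
        positivity
  start := by
    intro u v Y huv hY hc
    have hu := squareNodal_eval_pos (notMem_of_forall_mem_Ioo hY).1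
    have hv := squareNodal_eval_pos (notMem_of_forall_mem_Ioo hY).2
    have hv' := squareNodal_derivative_nonneg fun y hy => (hY y hy).2.le
    have hvu := sub_pos.2 huv
    have hq : squareNodal Y ≠ 0 := by
      intro h0
      simp [h0] at hu
    have h1 : ∀ z : ℝ, ((X - C z) ^ 2 : ℝ[X]).natDegree ≤ 2 := fun z => by compute_degree
    have hne : ∀ z : ℝ, ((X - C z) ^ 2 : ℝ[X]) ≠ 0 := fun z => pow_ne_zero 2 (X_sub_C_ne_zero z)
    by_cases hN : Y.card + 1 = N
    · have hpos : 0 < (squareNodal Y * (X - C u) ^ 2).eval v := by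
        simp only [eval_mul, eval_C, eval_sub, eval_X, eval_pow]
        positivity
      refine ⟨squareNodal Y * (X - C u) ^ 2, ⟨?_, fun x hx => ?_, fun y hy => ?_⟩, ?_,
        ?_, Or.inr ⟨hN, hpos, ?_⟩⟩
      · have h3 := natDegree_mul_le_of_le (natDegree_squareNodal_le Y) (h1 u)
        omega
      · have h1 := squareNodal_eval_nonneg Y x
        simp only [eval_mul, eval_pow]
        positivity
      · simp [squareNodal_eval_eq_zero hy]
      · exact mul_ne_zero hq (hne u)
      · intro k hk
        interval_cases k <;> simp [derivative_mul, derivative_X_sub_C_sq]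
      · intro k hk
        interval_cases k
        · exact hpos.le
        · simp only [Function.iterate_one, derivative_mul, derivative_X_sub_C_sq, eval_add,
            eval_mul, eval_C, eval_sub, eval_X, eval_pow]
          positivity
    · refine ⟨squareNodal Y * (X - C u) ^ 2 * (X - C v) ^ 2,
        ⟨?_, fun x hx => ?_, fun y hy => ?_⟩, ?_, ?_, Or.inl ?_⟩
      · have h3 := natDegree_mul_le_of_le
          (natDegree_mul_le_of_le (natDegree_squareNodal_le Y) (h1 u)) (h1 v)
        omega
      · have h1 := squareNodal_eval_nonneg Y x
        simp only [eval_mul, eval_pow]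
        positivity
      · simp [squareNodal_eval_eq_zero hy]
      · exact mul_ne_zero (mul_ne_zero hq (hne u)) (hne v)
      · intro k hk
        interval_cases k <;> simp [derivative_mul, derivative_X_sub_C_sq]
      · intro k hk
        interval_cases k <;> simp [derivative_mul, derivative_X_sub_C_sq]

/-! ### The lower bound for the number of nodes -/

/-- The polynomials `p 1, …, p s` form a nonnegative spline on the subintervals `0, …, s - 1` that
vanishes on the part of `Y` to the left of the knot `t s`. The polynomial `p 0` only fixes the jet at
the first knot. -/
structure IsPartialSpline (c D : ℕ) (t : ℕ → ℝ) (Y : Finset ℝ) (s : ℕ) (p : ℕ → ℝ[X]) : Prop where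
  natDegree_le : ∀ i < s, (p (i + 1)).natDegree ≤ D
  nonneg : ∀ i < s, ∀ x ∈ Set.Icc (t i) (t (i + 1)), 0 ≤ (p (i + 1)).eval x
  zero : ∀ i < s, ∀ y ∈ Y, y ∈ Set.Ico (t i) (t (i + 1)) → (p (i + 1)).eval y = 0
  jet : ∀ i < s, JetEq c (p i) (p (i + 1)) (t i)

theorem isPartialSpline_zero (c D : ℕ) (t : ℕ → ℝ) (Y : Finset ℝ) (s : ℕ) :
    IsPartialSpline c D t Y s 0 :=
  ⟨fun _ _ => by simp, fun _ _ _ _ => by simp, fun _ _ _ _ _ => by simp, fun _ _ _ _ => rfl⟩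

/-- A partial spline is prolonged by a polynomial that matches its jet at the last knot. -/
theorem IsPartialSpline.extend {c D : ℕ} {t : ℕ → ℝ} {Y : Finset ℝ} {s : ℕ} {p : ℕ → ℝ[X]}
    (h : IsPartialSpline c D t Y s p) {q : ℝ[X]} (hq : IsBump D (t s) (t (s + 1))
      (Y.filter fun y => y ∈ Set.Ioo (t s) (t (s + 1))) q)
    (hjet : JetEq c (p s) q (t s)) (hz : t s ∈ Y → q.eval (t s) = 0) :
    ∃ p', IsPartialSpline c D t Y (s + 1) p' ∧ p' (s + 1) = q ∧ ∀ i ≤ s, p' i = p i := by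
  classical
  have hup : ∀ i ≤ s, Function.update p (s + 1) q i = p i := fun i hi =>
    Function.update_of_ne (by omega) _ _
  have hq' : Function.update p (s + 1) q (s + 1) = q := Function.update_self _ _ _
  refine ⟨Function.update p (s + 1) q, ⟨fun i hi => ?_, fun i hi => ?_, fun i hi => ?_,
    fun i hi => ?_⟩, hq', hup⟩ <;> rcases Nat.lt_succ_iff_lt_or_eq.1 hi with h' | rfl
  · rw [hup _ h']; exact h.natDegree_le i h'
  · rw [hq']; exact hq.1
  · rw [hup _ h']; exact h.nonneg i h'
  · rw [hq']; exact hq.2.1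
  · rw [hup _ h']; exact h.zero i h'
  · rw [hq']
    intro y hy hyi
    rcases hyi.1.eq_or_lt with h1 | h1
    · rw [← h1]
      exact hz (h1 ▸ hy)
    · exact hq.2.2 y (Finset.mem_filter.2 ⟨hy, h1, hyi.2⟩)
  · rw [hup _ h', hup _ h'.le]; exact h.jet i h'
  · rw [hq', hup _ le_rfl]; exact hjet

theorem card_filter_lt_succ {Y : Finset ℝ} {u v : ℝ} (huv : u < v) :
    (Y.filter fun y => y < u).card + (Y.filter fun y => y ∈ Set.Ioo u v).card +
      (if u ∈ Y then 1 else 0) = (Y.filter fun y => y < v).card := by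
  classical
  have h1 : (Y.filter fun y => y < v) = ((Y.filter fun y => y < u) ∪
      (Y.filter fun y => y ∈ Set.Ioo u v)) ∪ (Y.filter fun y => y = u) := by
    ext y
    simp only [Finset.mem_filter, Finset.mem_union, Set.mem_Ioo]
    constructor
    · rintro ⟨hy, hyv⟩
      rcases lt_trichotomy y u with h | h | h
      · exact Or.inl (Or.inl ⟨hy, h⟩)
      · exact Or.inr ⟨hy, h⟩
      · exact Or.inl (Or.inr ⟨hy, h, hyv⟩)
    · rintro ((⟨hy, h⟩ | ⟨hy, h⟩) | ⟨hy, h⟩)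
      · exact ⟨hy, h.trans huv⟩
      · exact ⟨hy, h.2⟩
      · exact ⟨hy, h ▸ huv⟩
  rw [h1, Finset.card_union_of_disjoint, Finset.card_union_of_disjoint, Finset.filter_eq']
  · split_ifs <;> simp
  · rw [Finset.disjoint_left]
    intro y hy hy'
    linarith [(Finset.mem_filter.1 hy).2, (Finset.mem_filter.1 hy').2.1]
  · rw [Finset.disjoint_left]
    intro y hy hy'
    have h2 := (Finset.mem_filter.1 hy').2
    rcases Finset.mem_union.1 hy with h3 | h3
    · linarith [(Finset.mem_filter.1 h3).2]
    · linarith [(Finset.mem_filter.1 h3).2.1]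

/-- Going through the subintervals from left to right, either a nonnegative spline vanishing on the
points met so far has been completed, or one is under construction and the points met are at least
`N` per subinterval, or the points met are more than `N` per subinterval. -/
theorem exists_partialSpline {c D N S : ℕ} (hB : HasBumps c D N) {t : ℕ → ℝ}
    (ht : ∀ s < S, t s < t (s + 1)) (Y : Finset ℝ) : ∀ s ≤ S,
    (∃ p, IsPartialSpline c D t Y s p ∧ IsFlatAt c (p s) (t s) ∧ ∃ i < s, p (i + 1) ≠ 0) ∨
    (∃ p, IsPartialSpline c D t Y s p ∧ IsRisingAt c (p s) (t s) ∧
      N * s ≤ (Y.filter fun y => y < t s).card) ∨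
    N * s + 1 ≤ (Y.filter fun y => y < t s).card := by
  intro s hs
  induction s with
  | zero =>
    -- Before the first knot, the constant `1` serves as a rising polynomial.
    refine Or.inr (Or.inl ⟨fun _ => 1, ⟨fun i hi => ?_, fun i hi => ?_, fun i hi => ?_,
      fun i hi => ?_⟩, ⟨by simp, fun k _ => ?_⟩, by simp⟩)
    · omega
    · omega
    · omega
    · omega
    · rcases k with _ | k
      · simp
      · rw [Function.iterate_succ_apply, derivative_one, iterate_derivative_zero, eval_zero]
  | succ s ih =>
    have hlt := ht s hs
    set Z := Y.filter fun y => y ∈ Set.Ioo (t s) (t (s + 1)) with hZ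
    have hZm : ∀ y ∈ Z, y ∈ Set.Ioo (t s) (t (s + 1)) := fun y hy => (Finset.mem_filter.1 hy).2
    have hcard := card_filter_lt_succ (Y := Y) hlt
    rw [← hZ] at hcard
    -- If the points met, with the knot itself, exceed `N` per subinterval, one starts afresh from zero:
    -- either the next subinterval keeps the excess, or it has a deficit that makes room for a bump.
    have hblocked : N * s + 1 ≤ (Y.filter fun y => y < t s).card + (if t s ∈ Y then 1 else 0) →
        (∃ p, IsPartialSpline c D t Y (s + 1) p ∧ IsFlatAt c (p (s + 1)) (t (s + 1)) ∧
          ∃ i < s + 1, p (i + 1) ≠ 0) ∨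
        (∃ p, IsPartialSpline c D t Y (s + 1) p ∧ IsRisingAt c (p (s + 1)) (t (s + 1)) ∧
          N * (s + 1) ≤ (Y.filter fun y => y < t (s + 1)).card) ∨
        N * (s + 1) + 1 ≤ (Y.filter fun y => y < t (s + 1)).card := by
      intro hb
      rcases lt_or_ge Z.card N with hc | hc
      · obtain ⟨q, hq, hq0, hqu, hqv⟩ := hB.start hlt hZm hc
        obtain ⟨p, hp, hps, -⟩ := (isPartialSpline_zero c D t Y s).extend hq
          (fun k hk => by simp [hqu k hk])
          (fun _ => hqu 0 (Nat.zero_le c))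
        rcases hqv with h | ⟨h1, h2⟩
        · exact Or.inl ⟨p, hp, hps ▸ h, s, s.lt_succ_self, hps ▸ hq0⟩
        · refine Or.inr (Or.inl ⟨p, hp, hps ▸ h2, ?_⟩)
          rw [Nat.mul_succ]
          omega
      · refine Or.inr (Or.inr ?_)
        rw [Nat.mul_succ]
        omega
    rcases ih (by omega) with ⟨p, hp, hflat, i, hi, hne⟩ | ⟨p, hp, hrise, hcnt⟩ | hcnt
    · obtain ⟨p', hp', hps, hpi⟩ := hp.extend (q := 0)
        ⟨by simp, fun x _ => by simp, fun y _ => by simp⟩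
        (fun k hk => by simp [hflat k hk]) (fun _ => by simp)
      refine Or.inl ⟨p', hp', ?_, i, by omega, by rwa [hpi _ hi]⟩
      rw [hps]
      intro k _
      simp
    · by_cases hk : t s ∈ Y
      · exact hblocked (by rw [if_pos hk]; omega)
      · rcases lt_trichotomy Z.card N with hc | hc | hc
        · obtain ⟨q, hq, hjet, hflat⟩ := hB.finish hlt hZm hc hrise
          obtain ⟨p', hp', hps, -⟩ := hp.extend hq hjet fun h => (hk h).elim
          refine Or.inl ⟨p', hp', hps ▸ hflat, s, s.lt_succ_self, ?_⟩
          rw [hps]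
          rintro rfl
          have := hjet 0 (Nat.zero_le c)
          have h1 := hrise.1
          simp only [Function.iterate_zero, id_eq, eval_zero] at this
          linarith
        · obtain ⟨q, hq, hjet, hr⟩ := hB.extend hlt hZm hc hrise
          obtain ⟨p', hp', hps, -⟩ := hp.extend hq hjet fun h => (hk h).elim
          refine Or.inr (Or.inl ⟨p', hp', hps ▸ hr, ?_⟩)
          rw [Nat.mul_succ]
          omega
        · refine Or.inr (Or.inr ?_)
          rw [Nat.mul_succ]
          omega
    · exact hblocked (by omega)

theorem exists_piecewise {S : ℕ} {t : ℕ → ℝ} (ht : ∀ s < S, t s < t (s + 1)) (p : ℕ → ℝ[X])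
    (hp : ∀ s, s + 1 < S → (p s).eval (t (s + 1)) = (p (s + 1)).eval (t (s + 1))) :
    ∃ f : ℝ → ℝ, ∀ s < S, ∀ x ∈ Set.Icc (t s) (t (s + 1)), f x = (p s).eval x := by
  classical
  induction S with
  | zero => exact ⟨0, fun s hs => by omega⟩
  | succ S ih =>
    obtain ⟨f, hf⟩ := ih (fun s hs => ht s (by omega)) fun s hs => hp s (by omega)
    refine ⟨fun x => if x < t S then f x else (p S).eval x, fun s hs x hx => ?_⟩
    dsimp only
    split_ifs with h
    · rcases Nat.lt_succ_iff_lt_or_eq.1 hs with h1 | rfl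
      · exact hf s h1 x hx
      · linarith [hx.1]
    · rcases Nat.lt_succ_iff_lt_or_eq.1 hs with h1 | rfl
      · have h2 : t (s + 1) ≤ t S := knots_le ht (Nat.succ_le_of_lt h1) S.le_succ
        have h3 : t (s + 1) = t S := by linarith [hx.2]
        have hx' : x = t (s + 1) := by linarith [hx.2]
        have h4 : s + 1 = S := by
          by_contra hne
          have h5 := ht (s + 1) (by omega)
          have h6 : t (s + 1 + 1) ≤ t S := knots_le ht (by omega) S.le_succ
          linarith
        rw [hx', hp s (by omega), h4]
      · rfl

theorem exists_mem_Ico {S : ℕ} {t : ℕ → ℝ} {x : ℝ} (h0 : t 0 ≤ x) (hS : x < t S) :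
    ∃ s < S, x ∈ Set.Ico (t s) (t (s + 1)) := by
  induction S with
  | zero => linarith
  | succ S ih =>
    rcases lt_or_ge x (t S) with h | h
    · obtain ⟨s, hs, hx⟩ := ih h
      exact ⟨s, by omega, hx⟩
    · exact ⟨S, S.lt_succ_self, h, hS⟩

/-- A rule that is exact on the splines has more than `N` nodes per subinterval: otherwise some
nonzero nonnegative spline vanishes at all nodes. -/
theorem IsExactRule.card_gt {c D N S : ℕ} (hB : HasBumps c D N) {t : ℕ → ℝ}
    (ht : ∀ s < S, t s < t (s + 1)) (hS : 0 < S) {R : Finset (ℝ × ℝ)}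
    (hR : IsExactRule (splineSpace D c S t) (t 0) (t S) R) : N * S + 1 ≤ R.card := by
  classical
  by_contra hlt
  set Y := R.image Prod.fst with hY
  have hYc : Y.card ≤ N * S := Finset.card_image_le.trans (by omega)
  have hYm : ∀ y ∈ Y, y ∈ Set.Icc (t 0) (t S) := by
    intro y hy
    obtain ⟨q, hq, rfl⟩ := Finset.mem_image.1 hy
    exact hR.1 q hq
  obtain ⟨p, hp, hne, hend⟩ : ∃ p, IsPartialSpline c D t Y S p ∧ (∃ i < S, p (i + 1) ≠ 0) ∧
      (t S ∈ Y → (p S).eval (t S) = 0) := by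
    rcases exists_partialSpline hB ht Y S le_rfl with ⟨p, hp, hflat, hne⟩ | ⟨p, hp, hrise, hcnt⟩ | h
    · exact ⟨p, hp, hne, fun _ => hflat 0 (Nat.zero_le c)⟩
    · refine ⟨p, hp, ⟨S - 1, by omega, ?_⟩, fun hm => ?_⟩
      · rw [Nat.sub_add_cancel hS]
        intro h0
        have := hrise.1
        simp [h0] at this
      -- By counting, all nodes lie to the left of the last knot, so it is not one of them.
      · have h1 : (Y.filter fun y => y < t S) = Y :=
          Finset.eq_of_subset_of_card_le (Finset.filter_subset _ _) (hYc.trans hcnt)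
        rw [← h1] at hm
        exact (lt_irrefl _ (Finset.mem_filter.1 hm).2).elim
    · have := Finset.card_filter_le Y fun y => y < t S
      omega
  obtain ⟨f, hf⟩ := exists_piecewise ht (fun i => p (i + 1)) fun s hs =>
    hp.jet (s + 1) hs 0 (Nat.zero_le c)
  have hfV : f ∈ splineSpace D c S t :=
    ⟨fun i => p (i + 1), fun s hs => ⟨hp.natDegree_le s hs, hf s hs⟩, fun s hs => hp.jet (s + 1) hs⟩
  have hzero : ∑ q ∈ R, q.2 * f q.1 = 0 := by
    refine Finset.sum_eq_zero fun q hq => ?_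
    have hq' : q.1 ∈ Y := Finset.mem_image_of_mem _ hq
    have hm := hYm _ hq'
    have : f q.1 = 0 := by
      rcases hm.2.lt_or_eq with h | h
      · obtain ⟨s, hs, hx⟩ := exists_mem_Ico hm.1 h
        rw [hf s hs _ (Set.Ico_subset_Icc_self hx)]
        exact hp.zero s hs _ hq' hx
      · have hl := ht (S - 1) (by omega)
        have h1 := hf (S - 1) (by omega) q.1
        rw [Nat.sub_add_cancel hS] at h1 hl
        rw [h1 ⟨h ▸ hl.le, h.le⟩, h]
        exact hend (h ▸ hq')
    rw [this, mul_zero]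
  have hpos : 0 < ∫ x in t 0..t S, f x := by
    rw [integral_spline ht hf]
    obtain ⟨i, hi, hne⟩ := hne
    have hnn : ∀ s ∈ Finset.range S, 0 ≤ ∫ x in t s..t (s + 1), (p (s + 1)).eval x :=
      fun s hs => intervalIntegral.integral_nonneg (ht s (Finset.mem_range.1 hs)).le fun x hx =>
        hp.nonneg s (Finset.mem_range.1 hs) x hx
    refine Finset.sum_pos' hnn ⟨i, Finset.mem_range.2 hi, ?_⟩
    refine intervalIntegral.integral_pos (ht i hi) (p (i + 1)).continuous.continuousOn
      (fun x hx => hp.nonneg i hi x ⟨hx.1.le, hx.2⟩) ?_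
    by_contra! hn
    refine hne (eq_zero_of_infinite_isRoot _ ((Set.Icc_infinite (ht i hi)).mono fun x hx => ?_))
    exact le_antisymm (hn x hx) (hp.nonneg i hi x hx)
  rw [hR.2.2 f hfV, hzero] at hpos
  exact lt_irrefl _ hpos

/-! ### Roots of orthogonal polynomials -/

/-- `L` is positive on the nonzero polynomials that are nonnegative on `[-1, 1]`. -/
def IsPositive (L : ℝ[X] →ₗ[ℝ] ℝ) : Prop :=
  ∀ p : ℝ[X], p ≠ 0 → (∀ x ∈ Set.Icc (-1 : ℝ) 1, 0 ≤ p.eval x) → 0 < L p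

theorem isPositive_massFunctional {a b : ℝ} (ha : 0 ≤ a) (hb : 0 ≤ b) :
    IsPositive (massFunctional a 0 b 0) := by
  intro p hp h
  have h1 := intPoly_pos hp h
  have h2 := mul_nonneg ha (h (-1) (by norm_num))
  have h3 := mul_nonneg hb (h 1 (by norm_num))
  rw [massFunctional_apply]
  linarith

theorem IsPositive.mulLeft_one_sub_X {L : ℝ[X] →ₗ[ℝ] ℝ} (hL : IsPositive L) :
    IsPositive (L ∘ₗ LinearMap.mulLeft ℝ (1 - X)) := by
  intro p hp h
  refine hL _ (mul_ne_zero ?_ hp) fun x hx => ?_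
  · intro h0
    have := congrArg (eval 0) h0
    simp at this
  · rw [LinearMap.mulLeft_apply, eval_mul, eval_sub, eval_one, eval_X]
    exact mul_nonneg (sub_nonneg.2 hx.2) (h x hx)

theorem IsPositive.mul_sq_ne_zero {L : ℝ[X] →ₗ[ℝ] ℝ} (hL : IsPositive L) {q s : ℝ[X]} (hq : q ≠ 0)
    (hs : s ≠ 0) (hsign : (∀ x ∈ Set.Icc (-1 : ℝ) 1, 0 ≤ q.eval x) ∨
      ∀ x ∈ Set.Icc (-1 : ℝ) 1, q.eval x ≤ 0) : L (q * s * s) ≠ 0 := by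
  rcases hsign with h | h
  · refine (hL _ (mul_ne_zero (mul_ne_zero hq hs) hs) fun x hx => ?_).ne'
    rw [eval_mul, eval_mul, mul_assoc]
    exact mul_nonneg (h x hx) (mul_self_nonneg _)
  · have := hL (-(q * s * s)) (neg_ne_zero.2 (mul_ne_zero (mul_ne_zero hq hs) hs)) fun x hx => by
      rw [eval_neg, eval_mul, eval_mul, mul_assoc, neg_nonneg]
      exact mul_nonpos_of_nonpos_of_nonneg (h x hx) (mul_self_nonneg _)
    rw [map_neg] at this
    linarith

theorem eval_sign_of_no_roots {q : ℝ[X]} (h : ∀ x, q.eval x ≠ 0) :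
    (∀ x, 0 ≤ q.eval x) ∨ ∀ x, q.eval x ≤ 0 := by
  by_contra! hn
  obtain ⟨⟨x, hx⟩, y, hy⟩ := hn
  obtain ⟨z, hz⟩ := mem_range_of_exists_le_of_exists_ge q.continuous ⟨x, hx.le⟩ ⟨y, hy.le⟩
  exact h z hz

/-- A polynomial of degree `n` orthogonal to all degrees below `n - 1` has `n` distinct real roots:
a rootless factor or a squared linear factor has constant sign and degree at least two. -/
theorem card_roots_of_orthogonal {L : ℝ[X] →ₗ[ℝ] ℝ} (hL : IsPositive L) {n : ℕ} {Q : ℝ[X]}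
    (hQ0 : Q ≠ 0) (hQ : Q.natDegree = n)
    (horth : ∀ g : ℝ[X], g.natDegree + 2 ≤ n → L (Q * g) = 0) : Q.roots.toFinset.card = n := by
  have hcard : Q.roots.card = n := by
    obtain ⟨q, hq, hdeg, hr⟩ := exists_prod_multiset_X_sub_C_mul Q
    set s := (Q.roots.map fun a => X - C a).prod with hs
    have hs0 : s ≠ 0 := fun h => hQ0 (by rw [← hq, h, zero_mul])
    have hq0 : q ≠ 0 := fun h => hQ0 (by rw [← hq, h, mul_zero])
    have hsd : s.natDegree = Q.roots.card := natDegree_multiset_prod_X_sub_C_eq_card _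
    have hnr : ∀ x, q.eval x ≠ 0 := by
      intro x hx
      have : x ∈ q.roots := (mem_roots hq0).2 hx
      simp [hr] at this
    have hq1 : q.natDegree ≠ 1 := by
      intro h1
      obtain ⟨x, hx⟩ := exists_root_of_degree_eq_one (degree_eq_iff_natDegree_eq hq0 |>.2 h1)
      exact hnr x hx
    by_contra hne
    have h0 := horth s (by omega)
    rw [← hq, mul_comm s q] at h0
    refine hL.mul_sq_ne_zero hq0 hs0 ?_ h0
    rcases eval_sign_of_no_roots hnr with h | h
    · exact Or.inl fun x _ => h x
    · exact Or.inr fun x _ => h x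
  rw [Multiset.toFinset_card_of_nodup, hcard]
  rw [Multiset.nodup_iff_count_le_one]
  intro x
  rw [count_roots]
  by_contra hx
  obtain ⟨r, hr⟩ := (le_rootMultiplicity_iff hQ0).1 (show 2 ≤ rootMultiplicity x Q by omega)
  have hr0 : r ≠ 0 := by
    rintro rfl
    simp [hr] at hQ0
  have hx2 : (X - C x) ^ 2 ≠ 0 := pow_ne_zero 2 (X_sub_C_ne_zero x)
  have hd := natDegree_mul hx2 hr0
  rw [← hr, natDegree_pow, natDegree_X_sub_C, hQ] at hd
  have h0 := horth r (by omega)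
  rw [hr] at h0
  refine hL.mul_sq_ne_zero hx2 hr0 (Or.inl fun y _ => ?_) h0
  rw [eval_pow]
  positivity

/-- A polynomial of degree `n` orthogonal to all lower degrees has its roots in `(-1, 1)`. -/
theorem roots_mem_Ioo_of_orthogonal {L : ℝ[X] →ₗ[ℝ] ℝ} (hL : IsPositive L) {n : ℕ} {Q : ℝ[X]}
    (hQ0 : Q ≠ 0) (hQ : Q.natDegree = n)
    (horth : ∀ g : ℝ[X], g.natDegree + 1 ≤ n → L (Q * g) = 0) :
    ∀ x ∈ Q.roots, x ∈ Set.Ioo (-1 : ℝ) 1 := by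
  intro x hx
  obtain ⟨r, hr⟩ := dvd_iff_isRoot.2 ((mem_roots hQ0).1 hx)
  have hr0 : r ≠ 0 := by
    rintro rfl
    simp [hr] at hQ0
  have hd := natDegree_mul (X_sub_C_ne_zero x) hr0
  rw [← hr, natDegree_X_sub_C, hQ] at hd
  have h0 := horth r (by omega)
  rw [hr] at h0
  by_contra hn
  refine hL.mul_sq_ne_zero (X_sub_C_ne_zero x) hr0 ?_ h0
  simp only [eval_sub, eval_X, eval_C]
  rw [Set.mem_Ioo, not_and_or, not_lt, not_lt] at hn
  rcases hn with h | h
  · exact Or.inl fun y hy => by linarith [hy.1]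
  · exact Or.inr fun y hy => by linarith [hy.2]

/-! ### Perturbation of the roots -/

/-- Outside `(-1, 1)`, a monic polynomial with roots in `[-ρ, ρ]` grows like `|x|` to its degree,
uniformly. -/
theorem le_abs_eval_prod_X_sub_C {ρ x : ℝ} (hx : 1 ≤ |x|) (hρ : ρ ≤ 1) (s : Multiset ℝ)
    (hs : ∀ a ∈ s, |a| ≤ ρ) :
    ((1 - ρ) * |x|) ^ s.card ≤ |(s.map fun a => X - C a).prod.eval x| := by
  induction s using Multiset.induction_on with
  | empty => simp
  | cons a s ih =>
    have h1 := ih fun b hb => hs b (Multiset.mem_cons_of_mem hb)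
    have h2 := hs a (Multiset.mem_cons_self a s)
    have h3 : (1 - ρ) * |x| ≤ |x - a| := by
      have h4 := abs_sub_abs_le_abs_sub x a
      have h5 : 0 ≤ ρ := (abs_nonneg a).trans h2
      nlinarith
    rw [Multiset.card_cons, pow_succ, Multiset.map_cons, Multiset.prod_cons, eval_mul, abs_mul,
      mul_comm]
    simp only [eval_sub, eval_X, eval_C]
    refine mul_le_mul h3 h1 ?_ (abs_nonneg _)
    exact pow_nonneg (mul_nonneg (by linarith) (abs_nonneg x)) _

theorem abs_eval_le_of_one_le_abs {x : ℝ} (hx : 1 ≤ |x|) {p : ℝ[X]} {n : ℕ} (hp : p.natDegree ≤ n) :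
    |p.eval x| ≤ (∑ i ∈ Finset.range (n + 1), |p.coeff i|) * |x| ^ n := by
  rw [eval_eq_sum_range' (Nat.lt_succ_of_le hp), Finset.sum_mul]
  refine (Finset.abs_sum_le_sum_abs _ _).trans (Finset.sum_le_sum fun i hi => ?_)
  rw [abs_mul, abs_pow]
  exact mul_le_mul_of_nonneg_left
    (pow_le_pow_right₀ hx (Nat.lt_succ_iff.1 (Finset.mem_range.1 hi))) (abs_nonneg _)

/-- If all roots of `P` lie in `(-1, 1)`, then so do those of `P + ω R` for small `ω`, provided that
`deg R ≤ deg P`. -/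
theorem exists_delta_roots_mem_Ioo {P R : ℝ[X]} (hP0 : P ≠ 0)
    (hcard : P.roots.card = P.natDegree) (hroots : ∀ x ∈ P.roots, x ∈ Set.Ioo (-1 : ℝ) 1)
    (hR : R.natDegree ≤ P.natDegree) :
    ∃ δ > 0, ∀ ω : ℝ, |ω| < δ → ∀ x, (P + C ω * R).eval x = 0 → x ∈ Set.Ioo (-1 : ℝ) 1 := by
  obtain ⟨ρ, hρ1, hρ⟩ : ∃ ρ < 1, ∀ a ∈ P.roots, |a| ≤ ρ := by
    by_cases hne : P.roots.toFinset.Nonempty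
    · obtain ⟨b, hb, hmax⟩ := P.roots.toFinset.exists_max_image (fun a => |a|) hne
      refine ⟨|b|, abs_lt.2 (hroots b (Multiset.mem_toFinset.1 hb)), fun a ha => ?_⟩
      exact hmax a (Multiset.mem_toFinset.2 ha)
    · refine ⟨0, zero_lt_one, fun a ha => (hne ⟨a, Multiset.mem_toFinset.2 ha⟩).elim⟩
  set n := P.natDegree with hn
  set K := ∑ i ∈ Finset.range (n + 1), |R.coeff i| with hK
  have hK0 : 0 ≤ K := Finset.sum_nonneg fun i _ => abs_nonneg _
  have hk : 0 < |P.leadingCoeff| := abs_pos.2 (leadingCoeff_ne_zero.2 hP0)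
  have hρ' : 0 < 1 - ρ := by linarith
  refine ⟨|P.leadingCoeff| * (1 - ρ) ^ n / (K + 1), by positivity, fun ω hω x hx => ?_⟩
  by_contra hout
  have hx1 : 1 ≤ |x| := by
    by_contra hlt
    exact hout (abs_lt.1 (not_le.1 hlt))
  have hprod := C_leadingCoeff_mul_prod_multiset_X_sub_C hcard
  have h1 := le_abs_eval_prod_X_sub_C hx1 hρ1.le P.roots hρ
  have h2 := abs_eval_le_of_one_le_abs hx1 hR
  have h3 : |P.eval x| = |P.leadingCoeff| * |(P.roots.map fun a => X - C a).prod.eval x| := by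
    rw [← abs_mul]
    congr 1
    conv_lhs => rw [← hprod]
    rw [eval_mul, eval_C]
  have h4 : |P.eval x| = |ω| * |R.eval x| := by
    rw [eval_add, eval_mul, eval_C] at hx
    rw [← abs_mul, ← abs_neg (ω * _)]
    congr 1
    linarith
  have hxn : 0 < |x| ^ n := by positivity
  rw [lt_div_iff₀ (by positivity)] at hω
  rw [hcard, mul_pow] at h1
  have h5 : |P.leadingCoeff| * ((1 - ρ) ^ n * |x| ^ n) ≤ |ω| * (K * |x| ^ n) := by
    calc _ ≤ |P.leadingCoeff| * |(P.roots.map fun a => X - C a).prod.eval x| :=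
          mul_le_mul_of_nonneg_left h1 hk.le
      _ = |ω| * |R.eval x| := by rw [← h3, h4]
      _ ≤ _ := mul_le_mul_of_nonneg_left h2 (abs_nonneg _)
  have h6 : |P.leadingCoeff| * (1 - ρ) ^ n ≤ |ω| * K :=
    le_of_mul_le_mul_right (by linarith) hxn
  nlinarith [abs_nonneg ω]

/-! ### Continuity class 0: roots -/

namespace C0

/-- No cancellation occurs in the recursion for `c = 0`, so that all functionals are positive. -/
theorem param_nonneg {n : ℝ} (hn : 0 ≤ n) {ℓ : ℕ → ℝ} {k : ℕ} (hℓ : ∀ i ≤ k, 0 < ℓ i) :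
    0 ≤ param n ℓ k := by
  induction k with
  | zero => exact le_rfl
  | succ k ih =>
    have h1 := ih fun i hi => hℓ i (by omega)
    have h2 := hℓ k (by omega)
    have h3 := hℓ (k + 1) le_rfl
    rw [param, step, Γ]
    positivity

variable {α αL αR : ℝ}

theorem F_pos {n : ℝ} (hn : 0 ≤ n) (hα : 0 ≤ α) : 0 < F n α := by
  rw [F]; positivity

theorem Γ_pos {n : ℝ} (hn : 0 ≤ n) (hα : 0 ≤ α) : 0 < Γ n α := by
  rw [Γ]; positivity

theorem H_pos (j : ℕ) (hL : 0 ≤ αL) (hR : 0 ≤ αR) : 0 < H (j + 1) αL αR := by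
  rw [H, add_sub_cancel_right]; positivity

theorem Q_hasDistinctRootsIn (N : ℕ) (hα : 0 ≤ α) :
    HasDistinctRootsIn (Q N α) N (Set.Ioo (-1) 1) := by
  have hc : (Q N α).coeff N ≠ 0 := by
    rw [coeff_Q]
    exact (mul_pos (F_pos N.cast_nonneg hα) (jacobi_coeff_pos 1 N)).ne'
  have hQ0 : Q N α ≠ 0 := fun h => hc (by rw [h, coeff_zero])
  have hd : (Q N α).natDegree = N := natDegree_eq_of_le_of_coeff_ne_zero (natDegree_Q_le N α) hc
  have hL := (isPositive_massFunctional (a := 2 * α) (by positivity) le_rfl).mulLeft_one_sub_X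
  have horth : ∀ g : ℝ[X], g.natDegree + 1 ≤ N →
      (massFunctional (2 * α) 0 0 0 ∘ₗ LinearMap.mulLeft ℝ (1 - X)) (Q N α * g) = 0 := by
    intro g hg
    rw [LinearMap.comp_apply, LinearMap.mulLeft_apply, massFunctional_Q_mul N α (by omega),
      coeff_eq_zero_of_natDegree_lt (by omega), zero_mul]
  exact ⟨card_roots_of_orthogonal hL hQ0 hd fun g hg => horth g (by omega),
    roots_mem_Ioo_of_orthogonal hL hQ0 hd horth⟩

theorem Mω_natDegree (j : ℕ) (ω : ℝ) (hL : 0 ≤ αL) (hR : 0 ≤ αR) :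
    (Mω ω (j + 1) αL αR).natDegree = j + 1 := by
  refine natDegree_eq_of_le_of_coeff_ne_zero (natDegree_Mω_le ω j αL αR) ?_
  rw [coeff_Mω]
  exact (mul_pos (H_pos j hL hR) (jacobi_coeff_pos 0 (j + 1))).ne'

theorem Mω_ne_zero (j : ℕ) (ω : ℝ) (hL : 0 ≤ αL) (hR : 0 ≤ αR) : Mω ω (j + 1) αL αR ≠ 0 := by
  intro h
  have := Mω_natDegree j ω hL hR
  simp [h] at this

/-- For `ω ≠ 0` one degree of orthogonality is lost. The roots stay real and distinct, but may leave
`[-1, 1]`. -/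
theorem Mω_card_roots (j : ℕ) (ω : ℝ) (hL : 0 ≤ αL) (hR : 0 ≤ αR) :
    (Mω ω (j + 1) αL αR).roots.toFinset.card = j + 1 := by
  refine card_roots_of_orthogonal (isPositive_massFunctional (a := 2 * αL) (b := 2 * αR)
    (by positivity) (by positivity)) (Mω_ne_zero j ω hL hR) (Mω_natDegree j ω hL hR) fun g hg => ?_
  rw [massFunctional_Mω_mul ω j αL αR (by omega), coeff_eq_zero_of_natDegree_lt (by omega)]
  ring

theorem exists_delta_Mω_roots (j : ℕ) (hL : 0 ≤ αL) (hR : 0 ≤ αR) :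
    ∃ δ > 0, ∀ ω : ℝ, |ω| < δ → ∀ x ∈ (Mω ω (j + 1) αL αR).roots, x ∈ Set.Ioo (-1 : ℝ) 1 := by
  have e : ∀ ω, Mω ω (j + 1) αL αR = Mω 0 (j + 1) αL αR + C ω * M j αL αR := by
    intro ω
    simp [Mω]
  have hd := Mω_natDegree j 0 hL hR
  have hcard : (Mω 0 (j + 1) αL αR).roots.card = (Mω 0 (j + 1) αL αR).natDegree := by
    refine le_antisymm (card_roots' _) ?_
    rw [hd]
    exact (Mω_card_roots j 0 hL hR).symm.le.trans (Multiset.toFinset_card_le _)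
  have horth : ∀ g : ℝ[X], g.natDegree + 1 ≤ j + 1 →
      massFunctional (2 * αL) 0 (2 * αR) 0 (Mω 0 (j + 1) αL αR * g) = 0 := by
    intro g hg
    rw [massFunctional_Mω_mul 0 j αL αR (Nat.le_of_succ_le_succ hg), zero_mul]
  have hroots := roots_mem_Ioo_of_orthogonal
    (isPositive_massFunctional (a := 2 * αL) (b := 2 * αR) (by positivity) (by positivity))
    (Mω_ne_zero j 0 hL hR) hd horth
  have hR' : (M j αL αR).natDegree ≤ (Mω 0 (j + 1) αL αR).natDegree := by
    rw [hd]
    exact (natDegree_M_le j αL αR).trans j.le_succ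
  obtain ⟨δ, hδ, h⟩ := exists_delta_roots_mem_Ioo (Mω_ne_zero j 0 hL hR) hcard hroots hR'
  refine ⟨δ, hδ, fun ω hω x hx => h ω hω x ?_⟩
  rw [← e]
  exact (mem_roots (Mω_ne_zero j ω hL hR)).1 hx

end C0

/-! ### Assembling the rules of the two continuity classes -/

section RootPairs

variable {P : ℝ[X]} {w : ℝ → ℝ}

theorem mem_rootPairs {q : ℝ × ℝ} : q ∈ rootPairs P w ↔ q.1 ∈ P.roots ∧ q.2 = w q.1 := by
  rw [rootPairs, Finset.mem_image]
  constructor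
  · rintro ⟨x, hx, rfl⟩
    exact ⟨Multiset.mem_toFinset.1 hx, rfl⟩
  · rintro ⟨h1, h2⟩
    exact ⟨q.1, Multiset.mem_toFinset.2 h1, Prod.ext rfl h2.symm⟩

theorem rootPairs_injOn : Set.InjOn Prod.fst (rootPairs P w : Set (ℝ × ℝ)) := by
  intro q hq q' hq' h
  rw [Finset.mem_coe, mem_rootPairs] at hq hq'
  refine Prod.ext h ?_
  rw [hq.2, hq'.2, h]

theorem card_rootPairs : (rootPairs P w).card = P.roots.toFinset.card :=
  Finset.card_image_of_injective _ fun _ _ h => (Prod.mk.inj h).1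

theorem sum_rootPairs (f : ℝ[X]) : ∑ q ∈ rootPairs P w, q.2 * f.eval q.1 =
    ∑ x ∈ P.roots.toFinset, w x * f.eval x := by
  rw [rootPairs, Finset.sum_image fun _ _ _ _ h => (Prod.mk.inj h).1]

end RootPairs

theorem lenL_pos {S : ℕ} {t : ℕ → ℝ} (ht : ∀ s < S, t s < t (s + 1)) {s : ℕ} (hs : s < S) :
    0 < lenL t s :=
  sub_pos.2 (ht s hs)

theorem lenR_pos {S : ℕ} {t : ℕ → ℝ} (ht : ∀ s < S, t s < t (s + 1)) {j : ℕ} (hj : j < S) :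
    0 < lenR S t j := by
  have := ht (S - j - 1) (by omega)
  rw [show S - j - 1 + 1 = S - j by omega] at this
  exact sub_pos.2 this

namespace C0

section Rule

variable {N S m : ℕ} {t : ℕ → ℝ}

theorem αLeft_nonneg (ht : ∀ s < S, t s < t (s + 1)) {s : ℕ} (hs : s < S) : 0 ≤ αLeft N t s :=
  param_nonneg N.cast_nonneg fun i hi => lenL_pos ht (by omega)

theorem αRight_nonneg (ht : ∀ s < S, t s < t (s + 1)) {j : ℕ} (hj : j < S) :
    0 ≤ αRight N S t j :=
  param_nonneg N.cast_nonneg fun i hi => lenR_pos ht (by omega)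

theorem param_succ_mul (n : ℝ) {ℓ : ℕ → ℝ} {s : ℕ} (h : 0 < ℓ s) (h' : 0 < ℓ (s + 1)) :
    2 * ((1 + (n + 1) ^ 2 * param n ℓ s) / ((n + 1) * Γ n (param n ℓ s))) * ℓ s =
      2 * param n ℓ (s + 1) * ℓ (s + 1) := by
  rw [param, step]
  field_simp

theorem midPoly_card_roots (hm : m < S) (ht : ∀ s < S, t s < t (s + 1)) (ω : ℝ) :
    (midPoly N S m t ω).roots.toFinset.card = N + 1 :=
  Mω_card_roots N ω (αLeft_nonneg ht hm) (αRight_nonneg ht (by omega))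

theorem mid_quadrature_midPoly (hm : m < S) (ht : ∀ s < S, t s < t (s + 1)) (ω : ℝ) :
    (∀ x ∈ (midPoly N S m t ω).roots,
      weightMDen ω (N + 1) (αLeft N t m) (αRight N S t (S - 1 - m)) x ≠ 0) ∧
    ∀ f : ℝ[X], f.natDegree ≤ 2 * N →
      massFunctional (2 * αLeft N t m) 0 (2 * αRight N S t (S - 1 - m)) 0 f =
        ∑ x ∈ (midPoly N S m t ω).roots.toFinset,
          weightM ω (N + 1) (αLeft N t m) (αRight N S t (S - 1 - m)) x * f.eval x :=
  mid_quadrature N (H_pos N (αLeft_nonneg ht hm) (αRight_nonneg ht (by omega))).ne'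
    (midPoly_card_roots hm ht ω)

theorem side_quadrature_of_nonneg (hN : 1 ≤ N) {α : ℝ} (hα : 0 ≤ α) :
    (∀ x ∈ (Q N α).roots, weightQDen N α x ≠ 0) ∧
    ∀ f : ℝ[X], f.natDegree ≤ 2 * N →
      massFunctional (2 * α) 0 0 0 f =
        ∑ x ∈ (Q N α).roots.toFinset, weightQ N α x * f.eval x +
          2 * ((1 + (N + 1) ^ 2 * α) / ((N + 1) * Γ N α)) * f.eval 1 :=
  side_quadrature hN (Γ_pos N.cast_nonneg hα).ne' (F_pos N.cast_nonneg hα).ne'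
    (Q_hasDistinctRootsIn N hα).1

theorem rootPairs_Q_mem {α : ℝ} (hα : 0 ≤ α) {w : ℝ → ℝ} {q : ℝ × ℝ}
    (hq : q ∈ rootPairs (Q N α) w) : q.1 ∈ Set.Ico (-1 : ℝ) 1 :=
  Set.Ioo_subset_Ico_self ((Q_hasDistinctRootsIn N hα).2 _ (mem_rootPairs.1 hq).1)

theorem nodesFit (hm : m < S) (ht : ∀ s < S, t s < t (s + 1)) {ω : ℝ}
    (hω : ∀ x ∈ (midPoly N S m t ω).roots, x ∈ Set.Icc (-1 : ℝ) 1) :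
    NodesFit S m (fun s => rootPairs (Q N (αLeft N t s)) (weightQ N (αLeft N t s)))
      (fun j => rootPairs (Q N (αRight N S t j)) (weightQ N (αRight N S t j)))
      (rootPairs (midPoly N S m t ω)
        (weightM ω (N + 1) (αLeft N t m) (αRight N S t (S - 1 - m)))) where
  left_mem s hs q hq := rootPairs_Q_mem (αLeft_nonneg ht (by omega)) hq
  left_inj s hs := rootPairs_injOn
  mid_mem q hq := hω _ (mem_rootPairs.1 hq).1
  mid_inj := rootPairs_injOn
  right_mem j hj q hq := rootPairs_Q_mem (αRight_nonneg ht (by omega)) hq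
  right_inj j hj := rootPairs_injOn

theorem chainFit (hN : 1 ≤ N) (hm : m < S) (ht : ∀ s < S, t s < t (s + 1)) (ω : ℝ) :
    ChainFit (2 * N) 0 S m t
      (fun s => rootPairs (Q N (αLeft N t s)) (weightQ N (αLeft N t s)))
      (fun j => rootPairs (Q N (αRight N S t j)) (weightQ N (αRight N S t j)))
      (rootPairs (midPoly N S m t ω)
        (weightM ω (N + 1) (αLeft N t m) (αRight N S t (S - 1 - m))))
      (fun s => 2 * αLeft N t s) (fun _ => 0)
      (fun s => 2 * ((1 + (N + 1) ^ 2 * αLeft N t s) / ((N + 1) * Γ N (αLeft N t s))))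
      (fun _ => 0) (fun j => 2 * αRight N S t j) (fun _ => 0)
      (fun j => 2 * ((1 + (N + 1) ^ 2 * αRight N S t j) / ((N + 1) * Γ N (αRight N S t j))))
      (fun _ => 0) where
  aL_zero := mul_zero 2
  bL_zero := rfl
  aR_zero := mul_zero 2
  bR_zero := rfl
  aL_succ s hs := param_succ_mul N (lenL_pos ht (by omega)) (lenL_pos ht (by omega))
  bL_succ s hs := by rw [zero_mul, zero_mul]
  aR_succ s hs := param_succ_mul N (lenR_pos ht (by omega)) (lenR_pos ht (by omega))
  bR_succ s hs := by rw [zero_mul, zero_mul]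
  left_quad s hs f hf := by
    rw [sum_rootPairs, zero_mul, add_zero]
    exact (side_quadrature_of_nonneg hN (αLeft_nonneg ht (by omega))).2 f hf
  right_quad s hs f hf := by
    rw [sum_rootPairs, zero_mul, add_zero]
    exact (side_quadrature_of_nonneg hN (αRight_nonneg ht (by omega))).2 f hf
  mid_quad f hf := by
    rw [sum_rootPairs, neg_zero]
    exact (mid_quadrature_midPoly hm ht ω).2 f hf
  smooth := Or.inr fun _ => ⟨rfl, rfl⟩

theorem card_rule (hm : m < S) (ht : ∀ s < S, t s < t (s + 1)) {ω : ℝ}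
    (hω : ∀ x ∈ (midPoly N S m t ω).roots, x ∈ Set.Icc (-1 : ℝ) 1) :
    (rule N S m t ω).card = N * S + 1 := by
  refine (nodesFit hm ht hω).card_assemble hm ht (fun s hs => ?_) ?_ fun j hj => ?_ <;>
    rw [card_rootPairs]
  · exact (Q_hasDistinctRootsIn N (αLeft_nonneg ht (by omega))).1
  · exact midPoly_card_roots hm ht ω
  · exact (Q_hasDistinctRootsIn N (αRight_nonneg ht (by omega))).1

/-- Rules for different `ω` differ: a common node of the middle interval would be a common root of
two of the `M_{ω,N+1}`, hence a root of `M_N`, at which the denominator of the weight vanishes. -/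
theorem rule_injOn (hm : m < S) (ht : ∀ s < S, t s < t (s + 1)) :
    Set.InjOn (fun ω : ℝ => rule N S m t ω)
      {ω | ∀ x ∈ (midPoly N S m t ω).roots, x ∈ Set.Icc (-1 : ℝ) 1} := by
  intro ω hω ω' hω' h
  obtain ⟨x, hx⟩ : (midPoly N S m t ω).roots.toFinset.Nonempty := by
    rw [← Finset.card_pos, midPoly_card_roots hm ht]
    exact N.succ_pos
  rw [Multiset.mem_toFinset] at hx
  set w := weightM ω (N + 1) (αLeft N t m) (αRight N S t (S - 1 - m)) with hw
  have hq : scale (t m) (t (m + 1)) (x, w x) ∈ rule N S m t ω' := by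
    have h' : rule N S m t ω = rule N S m t ω' := h
    rw [← h', rule, assemble, Finset.mem_union, Finset.mem_union]
    exact Or.inl (Or.inr (Finset.mem_image_of_mem _ (mem_rootPairs.2 ⟨hx, rfl⟩)))
  rw [rule, assemble_eq_biUnion hm, Finset.mem_biUnion] at hq
  obtain ⟨s, hs, hqs⟩ := hq
  have hcm : (scale (t m) (t (m + 1)) (x, w x)).1 ∈ cell m t m := by
    rw [cell, if_neg (lt_irrefl m), if_pos rfl]
    exact scale_mem_Icc _ (ht m hm) (hω x hx)
  obtain rfl := cell_eq_of_mem ht (Finset.mem_range.1 hs) hm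
    ((nodesFit hm ht hω').mem_cell ht (Finset.mem_range.1 hs) hqs) hcm
  rw [piece, if_neg (lt_irrefl s), if_pos rfl, Finset.mem_image] at hqs
  obtain ⟨q, hq, hqx⟩ := hqs
  obtain rfl := scale_injective (ht s hm) hqx
  have hx' := (mem_rootPairs.1 hq).1
  have hne : ∀ ω, midPoly N S s t ω ≠ 0 := fun ω =>
    Mω_ne_zero N ω (αLeft_nonneg ht hm) (αRight_nonneg ht (by omega))
  have e1 : (midPoly N S s t ω).eval x = 0 := (mem_roots (hne ω)).1 hx
  have e2 : (midPoly N S s t ω').eval x = 0 := (mem_roots (hne ω')).1 hx'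
  have hden := (mid_quadrature_midPoly hm ht ω).1 x hx
  rw [weightMDen] at hden
  have hM := right_ne_zero_of_mul hden
  simp only [midPoly, Mω, eval_add, eval_mul, eval_C] at e1 e2
  have e3 : (ω - ω') * (M (N + 1 - 1) (αLeft N t s) (αRight N S t (S - 1 - s))).eval x = 0 := by
    linear_combination e1 - e2
  exact sub_eq_zero.1 ((mul_eq_zero.1 e3).resolve_right hM)

end Rule

end C0

namespace C1

section Rule

variable {N S m : ℕ} {t : ℕ → ℝ}

theorem param_succ_fst_mul (n : ℝ) {ℓ : ℕ → ℝ} {s : ℕ} (h : 0 < ℓ s) (h' : 0 < ℓ (s + 1)) :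
    2 * stepα n (param n ℓ s).1 (param n ℓ s).2 * ℓ s =
      2 * (param n ℓ (s + 1)).1 * ℓ (s + 1) := by
  rw [param, step]
  field_simp

theorem param_succ_snd_mul (n : ℝ) {ℓ : ℕ → ℝ} {s : ℕ} (h : 0 < ℓ s) (h' : 0 < ℓ (s + 1)) :
    -24 * stepβ n (param n ℓ s).1 (param n ℓ s).2 * ℓ s ^ 2 =
      -24 * (param n ℓ (s + 1)).2 * ℓ (s + 1) ^ 2 := by
  rw [param, step]
  field_simp

/-- A root of an admissible `Q_N` is not `1`, because `Q_N(1) = Γ ≠ 0`; it may be `-1`. Hence the nodes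
of adjacent subintervals are distinct. -/
theorem rootPairs_Q_mem (hN : 1 ≤ N) {q : ℝ × ℝ} (hadm : SideAdmissible N q) {w : ℝ → ℝ}
    {p : ℝ × ℝ} (hp : p ∈ rootPairs (Q N q.1 q.2) w) : p.1 ∈ Set.Ico (-1 : ℝ) 1 := by
  have hp' := (mem_rootPairs.1 hp).1
  have h1 := hadm.2.2 _ hp'
  refine ⟨h1.1, h1.2.lt_of_ne fun h => ?_⟩
  rw [h] at hp'
  have hQ0 : Q N q.1 q.2 ≠ 0 := by
    intro h0
    have := hadm.2.1
    rw [h0, roots_zero, Multiset.toFinset_zero, Finset.card_empty] at this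
    omega
  have h2 : (Q N q.1 q.2).eval 1 = 0 := (mem_roots hQ0).1 hp'
  rw [eval_one_Q] at h2
  exact hadm.1 h2

theorem nodesFit (hN : 1 ≤ N) (hL : ∀ s < m, SideAdmissible N (pLeft N t s))
    (hR : ∀ j < S - 1 - m, SideAdmissible N (pRight N S t j))
    (hM : HasDistinctRootsIn (midPoly N S m t) (N + 1) (Set.Icc (-1) 1)) :
    NodesFit S m
      (fun s => rootPairs (Q N (pLeft N t s).1 (pLeft N t s).2)
        (weightQ N (pLeft N t s).1 (pLeft N t s).2))
      (fun j => rootPairs (Q N (pRight N S t j).1 (pRight N S t j).2)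
        (weightQ N (pRight N S t j).1 (pRight N S t j).2))
      (rootPairs (midPoly N S m t)
        (weightM (N + 1) (pLeft N t m).1 (pRight N S t (S - 1 - m)).1
          (pLeft N t m).2 (pRight N S t (S - 1 - m)).2)) where
  left_mem s hs _ hp := rootPairs_Q_mem hN (hL s hs) hp
  left_inj _ _ := rootPairs_injOn
  mid_mem _ hp := hM.2 _ (mem_rootPairs.1 hp).1
  mid_inj := rootPairs_injOn
  right_mem j hj _ hp := rootPairs_Q_mem hN (hR j hj) hp
  right_inj _ _ := rootPairs_injOn

theorem chainFit (hN : 1 ≤ N) (hm : m < S) (ht : ∀ s < S, t s < t (s + 1))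
    (hL : ∀ s < m, SideAdmissible N (pLeft N t s))
    (hR : ∀ j < S - 1 - m, SideAdmissible N (pRight N S t j))
    (hM : HasDistinctRootsIn (midPoly N S m t) (N + 1) (Set.Icc (-1) 1)) :
    ChainFit (2 * N + 1) 1 S m t
      (fun s => rootPairs (Q N (pLeft N t s).1 (pLeft N t s).2)
        (weightQ N (pLeft N t s).1 (pLeft N t s).2))
      (fun j => rootPairs (Q N (pRight N S t j).1 (pRight N S t j).2)
        (weightQ N (pRight N S t j).1 (pRight N S t j).2))
      (rootPairs (midPoly N S m t)
        (weightM (N + 1) (pLeft N t m).1 (pRight N S t (S - 1 - m)).1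
          (pLeft N t m).2 (pRight N S t (S - 1 - m)).2))
      (fun s => 2 * (pLeft N t s).1) (fun s => -24 * (pLeft N t s).2)
      (fun s => 2 * stepα N (pLeft N t s).1 (pLeft N t s).2)
      (fun s => -24 * stepβ N (pLeft N t s).1 (pLeft N t s).2)
      (fun j => 2 * (pRight N S t j).1) (fun j => -24 * (pRight N S t j).2)
      (fun j => 2 * stepα N (pRight N S t j).1 (pRight N S t j).2)
      (fun j => -24 * stepβ N (pRight N S t j).1 (pRight N S t j).2) where
  aL_zero := mul_zero 2
  bL_zero := mul_zero (-24)
  aR_zero := mul_zero 2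
  bR_zero := mul_zero (-24)
  aL_succ s hs := param_succ_fst_mul N (lenL_pos ht (by omega)) (lenL_pos ht (by omega))
  bL_succ s hs := param_succ_snd_mul N (lenL_pos ht (by omega)) (lenL_pos ht (by omega))
  aR_succ s hs := param_succ_fst_mul N (lenR_pos ht (by omega)) (lenR_pos ht (by omega))
  bR_succ s hs := param_succ_snd_mul N (lenR_pos ht (by omega)) (lenR_pos ht (by omega))
  left_quad s hs f hf := by
    rw [sum_rootPairs]
    exact (side_quadrature hN (hL s hs).1 (hL s hs).2.1).2 f hf
  right_quad s hs f hf := by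
    rw [sum_rootPairs]
    exact (side_quadrature hN (hR s hs).1 (hR s hs).2.1).2 f hf
  mid_quad f hf := by
    rw [sum_rootPairs, ← neg_mul, neg_neg]
    exact (mid_quadrature N hM.1).2 f hf
  smooth := Or.inl le_rfl

end Rule

end C1

end SplineQuad

theorem mainTheorem1 (N S m : ℕ) (hN : 1 ≤ N) (hm : m < S) (a b : ℝ) (t : ℕ → ℝ)
    (ha : t 0 = a) (hb : t S = b) (ht : ∀ s < S, t s < t (s + 1)) :
    -- continuity class 0, even degree
    ((∀ α : ℝ, ((∃ s < m, α = SplineQuad.C0.αLeft N t s) ∨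
          ∃ j < S - 1 - m, α = SplineQuad.C0.αRight N S t j) →
        SplineQuad.C0.Γ N α ≠ 0 ∧
        SplineQuad.HasDistinctRootsIn (SplineQuad.C0.Q N α) N (Set.Ioo (-1) 1) ∧
        ∀ x ∈ (SplineQuad.C0.Q N α).roots, SplineQuad.C0.weightQDen N α x ≠ 0) ∧
      (∀ ω : ℝ,
        SplineQuad.HasDistinctRootsIn (SplineQuad.C0.midPoly N S m t ω) (N + 1) Set.univ ∧
        ∀ x ∈ (SplineQuad.C0.midPoly N S m t ω).roots,
          SplineQuad.C0.weightMDen ω (N + 1) (SplineQuad.C0.αLeft N t m)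
            (SplineQuad.C0.αRight N S t (S - 1 - m)) x ≠ 0) ∧
      (∃ δ > 0, ∀ ω : ℝ, |ω| < δ →
        ∀ x ∈ (SplineQuad.C0.midPoly N S m t ω).roots, x ∈ Set.Ioo (-1 : ℝ) 1) ∧
      (∀ ω : ℝ, (∀ x ∈ (SplineQuad.C0.midPoly N S m t ω).roots, x ∈ Set.Icc (-1 : ℝ) 1) →
        (SplineQuad.C0.rule N S m t ω).card = N * S + 1 ∧
        SplineQuad.IsOptimalRule (SplineQuad.splineSpace (2 * N) 0 S t) a b
          (SplineQuad.C0.rule N S m t ω)) ∧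
      Set.InjOn (fun ω : ℝ => SplineQuad.C0.rule N S m t ω)
        {ω | ∀ x ∈ (SplineQuad.C0.midPoly N S m t ω).roots, x ∈ Set.Icc (-1 : ℝ) 1}) ∧
    -- continuity class 1, odd degree
    ((∀ s < m, SplineQuad.C1.SideAdmissible N (SplineQuad.C1.pLeft N t s)) →
      (∀ j < S - 1 - m, SplineQuad.C1.SideAdmissible N (SplineQuad.C1.pRight N S t j)) →
      SplineQuad.HasDistinctRootsIn (SplineQuad.C1.midPoly N S m t) (N + 1) (Set.Icc (-1) 1) →
      (∀ q : ℝ × ℝ, ((∃ s < m, q = SplineQuad.C1.pLeft N t s) ∨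
          ∃ j < S - 1 - m, q = SplineQuad.C1.pRight N S t j) →
        ∀ x ∈ (SplineQuad.C1.Q N q.1 q.2).roots,
          SplineQuad.C1.weightQDen N q.1 q.2 x ≠ 0) ∧
      (∀ x ∈ (SplineQuad.C1.midPoly N S m t).roots, SplineQuad.C1.midDen N S m t x ≠ 0) ∧
      (SplineQuad.C1.rule N S m t).card = N * S + 1 ∧
      SplineQuad.IsOptimalRule (SplineQuad.splineSpace (2 * N + 1) 1 S t) a b
        (SplineQuad.C1.rule N S m t)) := by
  subst ha hb
  refine ⟨⟨?_, ?_, ?_, ?_, SplineQuad.C0.rule_injOn hm ht⟩, ?_⟩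
  · intro α hα
    have hα0 : 0 ≤ α := by
      rcases hα with ⟨s, hs, rfl⟩ | ⟨j, hj, rfl⟩
      · exact SplineQuad.C0.αLeft_nonneg ht (by omega)
      · exact SplineQuad.C0.αRight_nonneg ht (by omega)
    exact ⟨(SplineQuad.C0.Γ_pos N.cast_nonneg hα0).ne', SplineQuad.C0.Q_hasDistinctRootsIn N hα0,
      (SplineQuad.C0.side_quadrature_of_nonneg hN hα0).1⟩
  · intro ω
    exact ⟨⟨SplineQuad.C0.midPoly_card_roots hm ht ω, fun x _ => Set.mem_univ x⟩,
      (SplineQuad.C0.mid_quadrature_midPoly hm ht ω).1⟩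
  · exact SplineQuad.C0.exists_delta_Mω_roots N (SplineQuad.C0.αLeft_nonneg ht hm)
      (SplineQuad.C0.αRight_nonneg ht (by omega))
  · intro ω hω
    have hcard := SplineQuad.C0.card_rule hm ht hω
    refine ⟨hcard, (SplineQuad.C0.chainFit hN hm ht ω).isExactRule
      (SplineQuad.C0.nodesFit hm ht hω) hm ht, fun R' hR' => ?_⟩
    rw [hcard]
    exact hR'.card_gt (SplineQuad.hasBumps_zero N) ht (by omega)
  · intro hL hR hM
    have hfit := SplineQuad.C1.nodesFit hN hL hR hM
    have hcard : (SplineQuad.C1.rule N S m t).card = N * S + 1 := by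
      refine hfit.card_assemble hm ht (fun s hs => ?_) ?_ fun j hj => ?_ <;>
        rw [SplineQuad.card_rootPairs]
      · exact (hL s hs).2.1
      · exact hM.1
      · exact (hR j hj).2.1
    refine ⟨?_, (SplineQuad.C1.mid_quadrature N hM.1).1, hcard,
      (SplineQuad.C1.chainFit hN hm ht hL hR hM).isExactRule hfit hm ht, fun R' hR' => ?_⟩
    · intro q hq
      have hadm : SplineQuad.C1.SideAdmissible N q := by
        rcases hq with ⟨s, hs, rfl⟩ | ⟨j, hj, rfl⟩
        · exact hL s hs
        · exact hR j hj
      exact (SplineQuad.C1.side_quadrature hN hadm.1 hadm.2.1).1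
    · rw [hcard]
      exact hR'.card_gt (SplineQuad.hasBumps_one N) ht (by omega)
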